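/- Let $p$ be a prime, $S$ a finite $p$-group, $\mathcal F$ a saturated fusion system on $S$, and $T\le S$ a strongly $\mathcal F$-closed subgroup, i.e. $\varphi(Q)\le T$ for all $Q\le T$ and $\varphi\in\mathrm{Hom}_{\mathcal F}(Q,S)$ (so $T$ is normal in $S$). Write $\bar S=S/T$, and let $\bar{\mathcal F}=\mathcal F/T$ be the quotient fusion system on $\bar S$: for $T\le R,Q\le S$, $\mathrm{Hom}_{\bar{\mathcal F}}(R/T,Q/T)$ is the set of homomorphisms induced by $\mathrm{Hom}_{\mathcal F}(R,Q)$. For finite groups $G,H$, a $(G,H)$-biset is a finite set with commuting right $G$-action and left $H$-action. Let $B(G,H)$ be the Grothendieck group (under disjoint union) of isomorphism classes of all $(G,H)$-bisets, and $A(G,H)$ that of the left-free ones (those with free $H$-action); the canonical map $A(G,H)\to B(G,H)$ is injective, and we regard $A(G,H)$ as a subgroup of $B(G,H)$. Write $A(G,H)_{(p)}\subseteq B(G,H)_{(p)}$ for the $p$-localizations (obtained by tensoring with $\mathbb Z_{(p)}$). Composition $A(H,K)_{(p)}\times A(G,H)_{(p)}\to A(G,K)_{(p)}$ is the bilinear map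 with $[X]\circ[Y]=[X\times_H Y]$. For $L\le G$ and a homomorphism $\varphi\colon L\to H$, $[L,\varphi]_G^H$ is the class of $(H\times G)/\bigl((x,ky)\sim(x\varphi(k),y),\ k\in L\bigr)$. The augmentation $\epsilon\colon A(G,H)_{(p)}\to\mathbb Z_{(p)}$ is linear with $\epsilon([X])=|H\backslash X|$. An element $\Omega\in A(S,S)_{(p)}$ is a right (resp. left, fully) characteristic element for $\mathcal F$ if (i) it is a $\mathbb Z_{(p)}$-linear combination of classes $[P,\varphi]_S^S$ with $P\le S$ and $\varphi\in\mathrm{Hom}_{\mathcal F}(P,S)$; (ii) it is right (resp. left, both right and left) $\mathcal F$-stable, where right stability means $\Omega\circ[P,\varphi]_P^S=\Omega\circ[P,\mathrm{incl}]_P^S$ and left stability means $[\varphi(P),\varphi^{-1}]_S^P\circ\Omega=[P,\mathrm{id}]_S^P\circ\Omega$, for all $P\le S$ and $\varphi\in\mathrm{Hom}_{\mathcal F}(P,S)$; (iii) $\epsilon(\Omega)$ is prime to $p$. It is idempotent mod $p$ if $\Omega\circ\Omega-\Omega\in p\,A(S,S)_{(p)}$. A characteristic idempotent for $\mathcal F$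 is a fully characteristic element $\omega$ with $\omega\circ\omega=\omega$. The same terms are used for $\bar{\mathcal F}$ on $\bar S$. The bideflation map $\mathrm{bidef}\colon A(S,S)_{(p)}\to B(\bar S,\bar S)_{(p)}$ is the $\mathbb Z_{(p)}$-linear map sending the class of a left-free biset $X$ to the class of the double quotient $T\backslash X/T$ with the induced $(\bar S,\bar S)$-action. Then: (a) If $\Omega\in A(S,S)_{(p)}$ is a right (respectively left, respectively fully) characteristic element for $\mathcal F$ that is idempotent mod $p$, then $\mathrm{bidef}(\Omega)$ lies in $A(\bar S,\bar S)_{(p)}$ and is a right (respectively left, respectively fully) characteristic element for $\bar{\mathcal F}$ that is idempotent mod $p$. (b) If $\omega_{\mathcal F}\in A(S,S)_{(p)}$ is a characteristic idempotent for $\mathcal F$, then $\mathrm{bidef}(\omega_{\mathcal F})$ lies in $A(\bar S,\bar S)_{(p)}$ and is the unique characteristic idempotent for $\bar{\mathcal F}$. -/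

import Mathlib

open scoped TensorProduct

noncomputable section

namespace BisetFusion

universe u

/-! ### Fusion systems -/

/-- A fusion system on `S`: a category whose objects are the subgroups of `S` and whose morphisms
are injective group homomorphisms, containing all conjugations by elements of `S`, and such that
every morphism `P → Q` induces an isomorphism `P ≃ φ(P)` which, together with its inverse, is again
a morphism. -/
structure FusionSystem (S : Type u) [Group S] where
  Hom : ∀ P Q : Subgroup S, Set (P →* Q)
  injective : ∀ {P Q : Subgroup S} {φ : P →* Q}, φ ∈ Hom P Q → Function.Injective φ
  conj_mem : ∀ {P Q : Subgroup S} (φ : P →* Q) (g : S),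
    (∀ x : P, (φ x : S) = g * x * g⁻¹) → φ ∈ Hom P Q
  /- A group isomorphism `e : P ≃* R` with `e x = φ x` for all `x` has `R = φ(P)`, and it is the
  isomorphism `P ≃ φ(P)` induced by `φ`. -/
  iso_mem : ∀ {P Q : Subgroup S} {φ : P →* Q}, φ ∈ Hom P Q →
    ∀ (R : Subgroup S) (e : P ≃* R), (∀ x : P, (e x : S) = φ x) →
      e.toMonoidHom ∈ Hom P R ∧ e.symm.toMonoidHom ∈ Hom R P
  comp_mem : ∀ {P Q R : Subgroup S} {φ : P →* Q} {ψ : Q →* R},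
    φ ∈ Hom P Q → ψ ∈ Hom Q R → ψ.comp φ ∈ Hom P R

namespace FusionSystem

variable {S : Type u} [Group S] (F : FusionSystem S)

/-- `Hom_F(P, S)`, as a set of homomorphisms into the group `S` itself (rather than into the
subgroup `⊤` of `S`). -/
def HomS (P : Subgroup S) : Set (P →* S) :=
  {φ | ∃ ψ ∈ F.Hom P ⊤, ∀ x : P, φ x = (ψ x : S)}

theorem homS_injective {P : Subgroup S} {φ : P →* S} (hφ : φ ∈ F.HomS P) :
    Function.Injective φ := by
  obtain ⟨ψ, hψ, h⟩ := hφ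
  intro x y hxy
  apply F.injective hψ
  apply Subtype.ext
  rw [← h, ← h, hxy]

/-- Two subgroups are `F`-conjugate if there is an isomorphism between them in `F`. -/
def IsConjugate (P Q : Subgroup S) : Prop :=
  ∃ φ ∈ F.Hom P Q, Function.Bijective φ

def FullyCentralized (P : Subgroup S) : Prop :=
  ∀ Q : Subgroup S, F.IsConjugate P Q →
    Nat.card (Subgroup.centralizer (Q : Set S)) ≤ Nat.card (Subgroup.centralizer (P : Set S))

def FullyNormalized (P : Subgroup S) : Prop :=
  ∀ Q : Subgroup S, F.IsConjugate P Q →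
    Nat.card (Subgroup.normalizer (Q : Set S)) ≤ Nat.card (Subgroup.normalizer (P : Set S))

/-- `Aut_F(P)`, as a subgroup of the group of all automorphisms of `P`. -/
def autF (P : Subgroup S) : Subgroup (MulAut P) where
  carrier := {e | MulEquiv.toMonoidHom e ∈ F.Hom P P}
  mul_mem' {a b} ha hb := F.comp_mem (φ := b.toMonoidHom) (ψ := a.toMonoidHom) hb ha
  one_mem' := F.conj_mem _ 1 (by intro x; simp [MulEquiv.toMonoidHom])
  inv_mem' {a} ha := (F.iso_mem ha P a (fun _ => rfl)).2

/-- `Aut_S(P)`: the automorphisms of `P` induced by conjugation by elements of `N_S(P)`. -/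
def autS (P : Subgroup S) : Subgroup (MulAut P) :=
  P.normalizerMonoidHom.range

/-- For `φ : P → S`, the subgroup `N_φ` of all `x ∈ N_S(P)` for which there is `y ∈ N_S(φ(P))` with
`φ(x u x⁻¹) = y φ(u) y⁻¹` for all `u ∈ P`. -/
def extender {P : Subgroup S} (φ : P →* S) : Subgroup S where
  carrier := {x | x ∈ Subgroup.normalizer (P : Set S) ∧
    ∃ y ∈ Subgroup.normalizer (φ.range : Set S),
      ∀ u v : P, (v : S) = x * u * x⁻¹ → φ v = y * φ u * y⁻¹}
  one_mem' := ⟨one_mem _, 1, one_mem _, by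
    intro u v h
    have : v = u := Subtype.ext (by simpa using h)
    simp [this]⟩
  mul_mem' := by
    rintro a b ⟨ha, y, hy, hya⟩ ⟨hb, z, hz, hzb⟩
    refine ⟨mul_mem ha hb, y * z, mul_mem hy hz, ?_⟩
    intro u v h
    have hw : b * u * b⁻¹ ∈ P := (Subgroup.mem_normalizer_iff.1 hb u).1 u.2
    rw [hya ⟨b * u * b⁻¹, hw⟩ v (by rw [h]; group), hzb u ⟨b * u * b⁻¹, hw⟩ rfl]
    group
  inv_mem' := by
    rintro a ⟨ha, y, hy, hya⟩
    refine ⟨inv_mem ha, y⁻¹, inv_mem hy, ?_⟩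
    intro u v h
    rw [hya v u (by rw [h]; group)]
    group

/-- Saturation, in the form of Broto, Levi and Oliver. -/
structure IsSaturated (p : ℕ) : Prop where
  fullyCentralized_of_fullyNormalized : ∀ P : Subgroup S, F.FullyNormalized P →
    F.FullyCentralized P
  sylow_of_fullyNormalized : ∀ P : Subgroup S, F.FullyNormalized P →
    ∃ Q : Sylow p (F.autF P), (Q : Subgroup (F.autF P)).map (F.autF P).subtype = autS P
  extension : ∀ (P : Subgroup S) (φ : P →* S), φ ∈ F.HomS P → F.FullyCentralized φ.range →
    ∃ ψ ∈ F.HomS (extender φ), ∀ (x : P) (y : extender φ), (y : S) = x → ψ y = φ x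

/-- `T` is strongly `F`-closed: morphisms of `F` send subgroups of `T` into `T`. -/
def StronglyClosed (T : Subgroup S) : Prop :=
  ∀ Q : Subgroup S, Q ≤ T → ∀ φ ∈ F.HomS Q, φ.range ≤ T

theorem conj_mem_homS (P : Subgroup S) (g : S) :
    (MulAut.conj g).toMonoidHom.comp P.subtype ∈ F.HomS P := by
  refine ⟨((MulAut.conj g).toMonoidHom.comp P.subtype).codRestrict ⊤ (fun _ => trivial),
    F.conj_mem _ g ?_, ?_⟩
  · intro x; simp
  · intro x; simp

/-- A strongly closed subgroup is normal in `S`. -/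
theorem StronglyClosed.normal {T : Subgroup S} (hT : F.StronglyClosed T) : T.Normal := by
  refine ⟨fun n hn g => ?_⟩
  have := hT T le_rfl _ (F.conj_mem_homS T g)
  exact this ⟨⟨n, hn⟩, by simp⟩

variable {F}

theorem StronglyClosed.apply_mem {T : Subgroup S} (hT : F.StronglyClosed T) {R Q : Subgroup S}
    {φ : R →* Q} (hφ : φ ∈ F.Hom R Q) (x : R) (hx : (x : S) ∈ T) : (φ x : S) ∈ T := by
  let ι : (R ⊓ T : Subgroup S) →* R := Subgroup.inclusion inf_le_left
  let κ : Q →* (⊤ : Subgroup S) := Subgroup.inclusion le_top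
  have hι : ι ∈ F.Hom (R ⊓ T) R := F.conj_mem _ 1 (by intro y; simp [ι])
  have hκ : κ ∈ F.Hom Q ⊤ := F.conj_mem _ 1 (by intro y; simp [κ])
  have h := hT (R ⊓ T) inf_le_right ((⊤ : Subgroup S).subtype.comp (κ.comp (φ.comp ι)))
    ⟨κ.comp (φ.comp ι), F.comp_mem (F.comp_mem hι hφ) hκ, fun _ => rfl⟩
  exact h ⟨⟨x, x.2, hx⟩, rfl⟩

theorem StronglyClosed.mem_of_apply_mem {T : Subgroup S} (hT : F.StronglyClosed T)
    {R Q : Subgroup S} {φ : R →* Q} (hφ : φ ∈ F.Hom R Q) (x : R) (hx : (φ x : S) ∈ T) :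
    (x : S) ∈ T := by
  let f : R →* S := Q.subtype.comp φ
  have hf : Function.Injective f := fun a b h => F.injective hφ (Subtype.ext h)
  let e : R ≃* f.range := MonoidHom.ofInjective hf
  have h := hT.apply_mem (F.iso_mem hφ f.range e (fun _ => rfl)).2 (e x) hx
  change ((e.symm (e x) : R) : S) ∈ T at h
  rwa [MulEquiv.symm_apply_apply] at h

theorem StronglyClosed.exists_apply_eq [Finite S] {T : Subgroup S} [T.Normal]
    (hT : F.StronglyClosed T) {P : Subgroup (S ⧸ T)} {Q : Subgroup S}
    {φ : P.comap (QuotientGroup.mk' T) →* Q} (hφ : φ ∈ F.Hom (P.comap (QuotientGroup.mk' T)) Q)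
    (t : S) (ht : t ∈ T) : ∃ x, (φ x : S) = t := by
  have hmem : ∀ s : T, (s : S) ∈ P.comap (QuotientGroup.mk' T) := by
    intro s
    rw [Subgroup.mem_comap, QuotientGroup.mk'_apply, (QuotientGroup.eq_one_iff _).2 s.2]
    exact one_mem _
  let f : T → T := fun s => ⟨φ ⟨s, hmem s⟩, hT.apply_mem hφ _ s.2⟩
  have hf : Function.Injective f := by
    intro a b h
    have h1 := F.injective hφ (Subtype.ext (congrArg (fun z : T => (z : S)) h))
    exact Subtype.ext (congrArg (fun z => ((z : P.comap (QuotientGroup.mk' T)) : S)) h1)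
  obtain ⟨s, hs⟩ := Finite.surjective_of_injective hf ⟨t, ht⟩
  exact ⟨⟨s, hmem s⟩, congrArg (fun z : T => (z : S)) hs⟩

/-- The homomorphism `ρ : P → Q` between subgroups of `S ⧸ T` is induced by `φ : R → R'`, where
`R = π⁻¹(P)` and `R' = π⁻¹(Q)` are the corresponding subgroups of `S` containing `T`. -/
def Induces {T : Subgroup S} [T.Normal] {P Q : Subgroup (S ⧸ T)}
    (φ : P.comap (QuotientGroup.mk' T) →* Q.comap (QuotientGroup.mk' T)) (ρ : P →* Q) : Prop :=
  ∀ (x : P.comap (QuotientGroup.mk' T)) (y : P), (y : S ⧸ T) = ((x : S) : S ⧸ T) →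
    (ρ y : S ⧸ T) = ((φ x : S) : S ⧸ T)

variable (F)

/-- The quotient system `F/T` on `S ⧸ T`: the morphisms from `R/T` to `Q/T`, for subgroups
`R` and `Q` of `S` containing `T`, are the homomorphisms induced by `Hom_F(R, Q)`. -/
def quotient [Finite S] (T : Subgroup S) [T.Normal] (hT : F.StronglyClosed T) :
    FusionSystem (S ⧸ T) where
  Hom P Q := {ρ | ∃ φ ∈ F.Hom (P.comap (QuotientGroup.mk' T)) (Q.comap (QuotientGroup.mk' T)),
    Induces φ ρ}
  injective := by
    rintro P Q ρ ⟨φ, hφ, hi⟩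
    rw [injective_iff_map_eq_one]
    rintro ⟨y, hy⟩ h
    obtain ⟨s, rfl⟩ := QuotientGroup.mk_surjective y
    have h1 := hi ⟨s, hy⟩ ⟨s, hy⟩ rfl
    rw [h] at h1
    have h2 := (QuotientGroup.eq_one_iff _).1 h1.symm
    exact Subtype.ext ((QuotientGroup.eq_one_iff _).2
      (hT.mem_of_apply_mem hφ ⟨s, hy⟩ h2))
  conj_mem := by
    rintro P Q ρ g h
    obtain ⟨g, rfl⟩ := QuotientGroup.mk_surjective g
    have hm : ∀ x : P.comap (QuotientGroup.mk' T), (g * x * g⁻¹ : S) ∈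
        Q.comap (QuotientGroup.mk' T) := by
      intro x
      have := h ⟨((x : S) : S ⧸ T), x.2⟩
      rw [Subgroup.mem_comap]
      simp only [QuotientGroup.mk'_apply, QuotientGroup.mk_mul, QuotientGroup.mk_inv]
      exact this ▸ (ρ _).2
    refine ⟨((MulAut.conj g).toMonoidHom.comp (Subgroup.subtype _)).codRestrict _ hm,
      F.conj_mem _ g (fun x => rfl), ?_⟩
    intro x y hxy
    rw [h y, hxy]
    rfl
  iso_mem := by
    rintro P Q ρ ⟨φ, hφ, hi⟩ R e he
    have hm : ∀ x, (φ x : S) ∈ R.comap (QuotientGroup.mk' T) := by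
      intro x
      have h1 := hi x ⟨((x : S) : S ⧸ T), x.2⟩ rfl
      rw [← he] at h1
      change ((φ x : S) : S ⧸ T) ∈ R
      exact h1 ▸ (e _).2
    let f : P.comap (QuotientGroup.mk' T) →* R.comap (QuotientGroup.mk' T) :=
      ((Subgroup.subtype _).comp φ).codRestrict _ hm
    have hf : Function.Bijective f := by
      constructor
      · intro a b hab
        exact F.injective hφ (Subtype.ext
          (congrArg (fun z : R.comap (QuotientGroup.mk' T) => (z : S)) hab))
      · rintro ⟨r, hr⟩
        obtain ⟨⟨y, hy⟩, hey⟩ := e.surjective ⟨(r : S ⧸ T), hr⟩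
        obtain ⟨s, rfl⟩ := QuotientGroup.mk_surjective y
        have h1 := hi ⟨s, hy⟩ ⟨s, hy⟩ rfl
        rw [← he, hey] at h1
        have h2 : ((φ ⟨s, hy⟩ : S))⁻¹ * r ∈ T := QuotientGroup.eq.1 h1.symm
        obtain ⟨t, ht⟩ := hT.exists_apply_eq hφ _ h2
        refine ⟨⟨s, hy⟩ * t, Subtype.ext ?_⟩
        change (φ (⟨s, hy⟩ * t) : S) = r
        rw [map_mul, Subgroup.coe_mul, ht]
        group
    obtain ⟨h1, h2⟩ := F.iso_mem hφ _ (MulEquiv.ofBijective f hf) (fun _ => rfl)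
    refine ⟨⟨_, h1, ?_⟩, ⟨_, h2, ?_⟩⟩
    · intro x y hxy
      exact (he y).trans (hi x y hxy)
    · intro x y hxy
      obtain ⟨w, rfl⟩ := hf.2 x
      have h3 : (MulEquiv.ofBijective f hf).symm (f w) = w :=
        (MulEquiv.ofBijective f hf).symm_apply_apply w
      change (e.symm y : S ⧸ T) = (((MulEquiv.ofBijective f hf).symm (f w) : S) : S ⧸ T)
      rw [h3]
      have h4 := hi w ⟨((w : S) : S ⧸ T), w.2⟩ rfl
      rw [← he] at h4
      have h5 : e ⟨((w : S) : S ⧸ T), w.2⟩ = y := Subtype.ext (h4.trans hxy.symm)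
      rw [← h5, MulEquiv.symm_apply_apply]
  comp_mem := by
    rintro P Q R ρ σ ⟨φ, hφ, hi⟩ ⟨ψ, hψ, hj⟩
    exact ⟨ψ.comp φ, F.comp_mem hφ hψ, fun x y hxy => hj _ _ (hi x y hxy)⟩

end FusionSystem

/-! ### Bisets -/

/-- A finite `(G, H)`-biset: a finite set with a right action of `G` (an action of the opposite
group) and a left action of `H` which commute. -/
structure Biset (G H : Type u) [Group G] [Group H] where
  carrier : Type u
  [finite : Finite carrier]
  [left : MulAction H carrier]
  [right : MulAction Gᵐᵒᵖ carrier]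
  [comm : SMulCommClass H Gᵐᵒᵖ carrier]

attribute [instance] Biset.finite Biset.left Biset.right Biset.comm

namespace Biset

variable {G H K : Type u} [Group G] [Group H] [Group K]

/-- `x` acted upon on the right by `g`. -/
abbrev rmul {X : Biset G H} (x : X.carrier) (g : G) : X.carrier := MulOpposite.op g • x

structure Iso (X Y : Biset G H) where
  toEquiv : X.carrier ≃ Y.carrier
  map_left : ∀ (h : H) (x : X.carrier), toEquiv (h • x) = h • toEquiv x
  map_right : ∀ (g : G) (x : X.carrier), toEquiv (rmul x g) = rmul (toEquiv x) g

def Iso.refl (X : Biset G H) : Iso X X := ⟨Equiv.refl _, fun _ _ => rfl, fun _ _ => rfl⟩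

def Iso.symm {X Y : Biset G H} (e : Iso X Y) : Iso Y X where
  toEquiv := e.toEquiv.symm
  map_left h x := by
    apply e.toEquiv.injective; rw [e.map_left]; simp
  map_right g x := by
    apply e.toEquiv.injective; rw [e.map_right]; simp

def Iso.trans {X Y Z : Biset G H} (e : Iso X Y) (f : Iso Y Z) : Iso X Z where
  toEquiv := e.toEquiv.trans f.toEquiv
  map_left h x := by simp [e.map_left, f.map_left]
  map_right g x := by simp [e.map_right, f.map_right]

instance isoSetoid (G H : Type u) [Group G] [Group H] : Setoid (Biset G H) where
  r X Y := Nonempty (Iso X Y)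
  iseqv := ⟨fun X => ⟨Iso.refl X⟩, fun ⟨e⟩ => ⟨e.symm⟩, fun ⟨e⟩ ⟨f⟩ => ⟨e.trans f⟩⟩

def empty (G H : Type u) [Group G] [Group H] : Biset G H where
  carrier := PEmpty
  left := { smul := fun _ x => x, one_smul := fun _ => rfl, mul_smul := fun _ _ _ => rfl }
  right := { smul := fun _ x => x, one_smul := fun _ => rfl, mul_smul := fun _ _ _ => rfl }
  comm := @SMulCommClass.mk _ _ _ (_) (_) (fun _ _ x => x.elim)

/-- The disjoint union of two bisets. -/
def sum (X Y : Biset G H) : Biset G H where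
  carrier := X.carrier ⊕ Y.carrier

def Iso.sum {X X' Y Y' : Biset G H} (e : Iso X X') (f : Iso Y Y') :
    Iso (X.sum Y) (X'.sum Y') where
  toEquiv := Equiv.sumCongr e.toEquiv f.toEquiv
  map_left h x := by
    rcases x with x | x
    · exact congrArg Sum.inl (e.map_left h x)
    · exact congrArg Sum.inr (f.map_left h x)
  map_right g x := by
    rcases x with x | x
    · exact congrArg Sum.inl (e.map_right g x)
    · exact congrArg Sum.inr (f.map_right g x)

/-- A biset is left-free if the left action is free. -/
def IsLeftFree (X : Biset G H) : Prop := ∀ (h : H) (x : X.carrier), h • x = x → h = 1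

theorem IsLeftFree.of_iso {X Y : Biset G H} (e : Iso X Y) (hX : X.IsLeftFree) : Y.IsLeftFree := by
  intro h y hy
  refine hX h (e.toEquiv.symm y) ?_
  apply e.toEquiv.injective
  rw [e.map_left]
  simpa using hy

theorem IsLeftFree.sum {X Y : Biset G H} (hX : X.IsLeftFree) (hY : Y.IsLeftFree) :
    (X.sum Y).IsLeftFree := by
  rintro h (x | x) hx
  · exact hX h x (Sum.inl_injective hx)
  · exact hY h x (Sum.inr_injective hx)

/-! #### The biset `H ×_{(L,φ)} G` -/

/-- The relation `(x, k y) ∼ (x φ(k), y)` on `H × G`, for `k ∈ L`. -/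
def pairSetoid (L : Subgroup G) (φ : L →* H) : Setoid (H × G) where
  r a b := ∃ k : L, b.1 = a.1 * φ k ∧ a.2 = k * b.2
  iseqv :=
    { refl := fun a => ⟨1, by simp⟩
      symm := by
        rintro a b ⟨k, h1, h2⟩
        exact ⟨k⁻¹, by rw [h1]; simp, by rw [h2]; simp⟩
      trans := by
        rintro a b c ⟨k, h1, h2⟩ ⟨l, h3, h4⟩
        exact ⟨k * l, by rw [h3, h1]; simp [mul_assoc], by rw [h2, h4]; simp [mul_assoc]⟩ }

/-- The biset `H ×_{(L,φ)} G` of a `(G, H)`-pair `(L, φ)`. -/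
def pair [Finite G] [Finite H] (L : Subgroup G) (φ : L →* H) : Biset G H where
  carrier := Quotient (pairSetoid L φ)
  left :=
    { smul := fun h => Quotient.map (fun a => (h * a.1, a.2)) (by
        rintro a b ⟨k, h1, h2⟩
        exact ⟨k, by simp [h1, mul_assoc], h2⟩)
      one_smul := by
        rintro ⟨a⟩
        exact congrArg (Quotient.mk _) (Prod.ext (one_mul _) rfl)
      mul_smul := by
        rintro g h ⟨a⟩
        exact congrArg (Quotient.mk _) (Prod.ext (mul_assoc _ _ _) rfl) }
  right :=
    { smul := fun g => Quotient.map (fun a => (a.1, a.2 * g.unop)) (by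
        rintro a b ⟨k, h1, h2⟩
        exact ⟨k, h1, by simp [h2, mul_assoc]⟩)
      one_smul := by
        rintro ⟨a⟩
        exact congrArg (Quotient.mk _) (Prod.ext rfl (mul_one _))
      mul_smul := by
        rintro g h ⟨a⟩
        exact congrArg (Quotient.mk _) (Prod.ext rfl (mul_assoc _ _ _).symm) }
  comm := @SMulCommClass.mk _ _ _ (_) (_) (by rintro g h ⟨a⟩; rfl)

theorem pair_isLeftFree [Finite G] [Finite H] (L : Subgroup G) (φ : L →* H) :
    (pair L φ).IsLeftFree := by
  rintro h ⟨a⟩ hx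
  obtain ⟨k, h1, h2⟩ := Quotient.exact hx
  have hk : (k : G) = 1 := by simpa using h2
  have : k = 1 := Subtype.ext hk
  subst this
  simpa using h1

/-! #### Composition -/

/-- The relation `(x h, y) ∼ (x, h y)` on `X × Y`, for `h ∈ H`. -/
def compSetoid (X : Biset H K) (Y : Biset G H) : Setoid (X.carrier × Y.carrier) where
  r a b := ∃ h : H, a.1 = rmul b.1 h ∧ b.2 = h • a.2
  iseqv :=
    { refl := fun a => ⟨1, by simp [rmul]⟩
      symm := by
        rintro a b ⟨k, h1, h2⟩
        exact ⟨k⁻¹, by simp [rmul, h1], by simp [h2]⟩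
      trans := by
        rintro a b c ⟨k, h1, h2⟩ ⟨l, h3, h4⟩
        exact ⟨l * k, by rw [h1, h3]; simp [rmul, mul_smul], by rw [h4, h2, mul_smul]⟩ }

/-- The biset `X ×_H Y`. -/
def comp (X : Biset H K) (Y : Biset G H) : Biset G K where
  carrier := Quotient (compSetoid X Y)
  left :=
    { smul := fun k => Quotient.map (fun a => (k • a.1, a.2)) (by
        rintro a b ⟨h, h1, h2⟩
        exact ⟨h, by simp [rmul, h1, smul_comm], h2⟩)
      one_smul := by
        rintro ⟨a⟩
        exact congrArg (Quotient.mk _) (Prod.ext (one_smul _ _) rfl)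
      mul_smul := by
        rintro g h ⟨a⟩
        exact congrArg (Quotient.mk _) (Prod.ext (mul_smul _ _ _) rfl) }
  right :=
    { smul := fun g => Quotient.map (fun a => (a.1, g • a.2)) (by
        rintro a b ⟨h, h1, h2⟩
        exact ⟨h, h1, by simp [h2, smul_comm]⟩)
      one_smul := by
        rintro ⟨a⟩
        exact congrArg (Quotient.mk _) (Prod.ext rfl (one_smul _ _))
      mul_smul := by
        rintro g h ⟨a⟩
        exact congrArg (Quotient.mk _) (Prod.ext rfl (mul_smul _ _ _)) }
  comm := @SMulCommClass.mk _ _ _ (_) (_) (by rintro g h ⟨a⟩; rfl)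

def Iso.comp {X X' : Biset H K} {Y Y' : Biset G H} (e : Iso X X') (f : Iso Y Y') :
    Iso (X.comp Y) (X'.comp Y') where
  toEquiv := Quotient.congr (Equiv.prodCongr e.toEquiv f.toEquiv) (by
    intro a b
    refine exists_congr fun h => and_congr ?_ ?_
    · simp only [Equiv.prodCongr_apply, Prod.map_fst]
      rw [← e.map_right, e.toEquiv.injective.eq_iff]
    · simp only [Equiv.prodCongr_apply, Prod.map_snd]
      rw [← f.map_left, f.toEquiv.injective.eq_iff])
  map_left k := by
    rintro ⟨a⟩
    exact congrArg (Quotient.mk _) (Prod.ext (e.map_left _ _) rfl)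
  map_right g := by
    rintro ⟨a⟩
    exact congrArg (Quotient.mk _) (Prod.ext rfl (f.map_right _ _))

def sumComp (X X' : Biset H K) (Y : Biset G H) :
    Iso ((X.sum X').comp Y) ((X.comp Y).sum (X'.comp Y)) where
  toEquiv :=
    { toFun := Quotient.lift (fun a : (X.carrier ⊕ X'.carrier) × Y.carrier =>
        Sum.elim (fun x => (Sum.inl (Quotient.mk _ (x, a.2)) :
            (X.comp Y).carrier ⊕ (X'.comp Y).carrier))
          (fun x => Sum.inr (Quotient.mk _ (x, a.2))) a.1) (by
        rintro ⟨a | a, y⟩ ⟨b | b, z⟩ ⟨h, h1, h2⟩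
        · exact congrArg Sum.inl (Quotient.sound ⟨h, Sum.inl_injective h1, h2⟩)
        · exact (Sum.inl_ne_inr h1).elim
        · exact (Sum.inr_ne_inl h1).elim
        · exact congrArg Sum.inr (Quotient.sound ⟨h, Sum.inr_injective h1, h2⟩))
      invFun := Sum.elim
        (Quotient.map (fun a => (Sum.inl a.1, a.2)) (by
          rintro a b ⟨h, h1, h2⟩; exact ⟨h, congrArg Sum.inl h1, h2⟩))
        (Quotient.map (fun a => (Sum.inr a.1, a.2)) (by
          rintro a b ⟨h, h1, h2⟩; exact ⟨h, congrArg Sum.inr h1, h2⟩))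
      left_inv := by rintro ⟨a | a, y⟩ <;> rfl
      right_inv := by
        rintro (a | a) <;> refine Quotient.inductionOn a fun b => rfl }
  map_left k := by rintro ⟨a | a, y⟩ <;> rfl
  map_right k := by rintro ⟨a | a, y⟩ <;> rfl

def compSum (X : Biset H K) (Y Y' : Biset G H) :
    Iso (X.comp (Y.sum Y')) ((X.comp Y).sum (X.comp Y')) where
  toEquiv :=
    { toFun := Quotient.lift (fun a : X.carrier × (Y.carrier ⊕ Y'.carrier) =>
        Sum.elim (fun y => (Sum.inl (Quotient.mk _ (a.1, y)) :
            (X.comp Y).carrier ⊕ (X.comp Y').carrier))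
          (fun y => Sum.inr (Quotient.mk _ (a.1, y))) a.2) (by
        rintro ⟨y, a | a⟩ ⟨z, b | b⟩ ⟨h, h1, h2⟩
        · exact congrArg Sum.inl (Quotient.sound ⟨h, h1, Sum.inl_injective h2⟩)
        · exact (Sum.inr_ne_inl h2).elim
        · exact (Sum.inl_ne_inr h2).elim
        · exact congrArg Sum.inr (Quotient.sound ⟨h, h1, Sum.inr_injective h2⟩))
      invFun := Sum.elim
        (Quotient.map (fun a => (a.1, Sum.inl a.2)) (by
          rintro a b ⟨h, h1, h2⟩; exact ⟨h, h1, congrArg Sum.inl h2⟩))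
        (Quotient.map (fun a => (a.1, Sum.inr a.2)) (by
          rintro a b ⟨h, h1, h2⟩; exact ⟨h, h1, congrArg Sum.inr h2⟩))
      left_inv := by rintro ⟨y, a | a⟩ <;> rfl
      right_inv := by
        rintro (a | a) <;> refine Quotient.inductionOn a fun b => rfl }
  map_left k := by rintro ⟨y, a | a⟩ <;> rfl
  map_right k := by rintro ⟨y, a | a⟩ <;> rfl

theorem IsLeftFree.comp {X : Biset H K} {Y : Biset G H} (hX : X.IsLeftFree) (hY : Y.IsLeftFree) :
    (X.comp Y).IsLeftFree := by
  rintro k ⟨a⟩ hx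
  obtain ⟨h, h1, h2⟩ := Quotient.exact hx
  have hh : h = 1 := hY h a.2 h2.symm
  subst hh
  exact hX k a.1 (by simpa [rmul] using h1)

/-! #### Bideflation -/

/-- The relation `x ∼ m x n` on a biset, for `m ∈ M` and `n ∈ N`. -/
def deflSetoid (N : Subgroup G) (M : Subgroup H) (X : Biset G H) : Setoid X.carrier where
  r a b := ∃ m ∈ M, ∃ n ∈ N, b = m • rmul a n
  iseqv :=
    { refl := fun a => ⟨1, one_mem _, 1, one_mem _, by simp [rmul]⟩
      symm := by
        rintro a b ⟨m, hm, n, hn, h⟩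
        refine ⟨m⁻¹, inv_mem hm, n⁻¹, inv_mem hn, ?_⟩
        rw [h]; simp [rmul, smul_comm m]
      trans := by
        rintro a b c ⟨m, hm, n, hn, h⟩ ⟨m', hm', n', hn', h'⟩
        refine ⟨m' * m, mul_mem hm' hm, n * n', mul_mem hn hn', ?_⟩
        rw [h', h]; simp [rmul, mul_smul, smul_comm m] }

/-- The double quotient `M \ X / N` of a `(G, H)`-biset by normal subgroups `N` of `G` and `M`
of `H`, with the induced `(G ⧸ N, H ⧸ M)`-action. -/
def defl (N : Subgroup G) [N.Normal] (M : Subgroup H) [M.Normal] (X : Biset G H) :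
    Biset (G ⧸ N) (H ⧸ M) where
  carrier := Quotient (deflSetoid N M X)
  left :=
    { smul := fun h x => Quotient.liftOn₂' h x
        (fun h x => (Quotient.mk (deflSetoid N M X) (h • x))) (by
        rintro h x h' x' hh ⟨m, hm, n, hn, e⟩
        have hh' : h⁻¹ * h' ∈ M := QuotientGroup.leftRel_apply.1 hh
        refine Quotient.sound ⟨h' * m * h⁻¹, ?_, n, hn, ?_⟩
        · have : h' * m * h⁻¹ = h' * (m * (h⁻¹ * h')) * h'⁻¹ := by group
          rw [this]
          exact Subgroup.Normal.conj_mem inferInstance _ (mul_mem hm hh') _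
        · rw [e]
          simp only [rmul]
          rw [← smul_comm h, smul_smul, smul_smul, inv_mul_cancel_right])
      one_smul := by
        rintro ⟨a⟩
        exact congrArg (Quotient.mk _) (one_smul _ _)
      mul_smul := by
        rintro ⟨g⟩ ⟨h⟩ ⟨a⟩
        exact congrArg (Quotient.mk _) (mul_smul _ _ _) }
  right :=
    { smul := fun g x => Quotient.liftOn₂' g.unop x
        (fun g x => (Quotient.mk (deflSetoid N M X) (rmul x g))) (by
        rintro h x h' x' hh ⟨m, hm, n, hn, e⟩
        have hh' : h⁻¹ * h' ∈ N := QuotientGroup.leftRel_apply.1 hh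
        refine Quotient.sound ⟨m, hm, h⁻¹ * n * h', ?_, ?_⟩
        · have : h⁻¹ * n * h' = h⁻¹ * n * h⁻¹⁻¹ * (h⁻¹ * h') := by group
          rw [this]
          exact mul_mem (Subgroup.Normal.conj_mem inferInstance _ hn _) hh'
        · rw [e]
          simp only [rmul]
          rw [← smul_comm m, smul_smul, smul_smul, ← MulOpposite.op_mul, ← MulOpposite.op_mul]
          congr 3
          group)
      one_smul := by
        rintro ⟨a⟩
        exact congrArg (Quotient.mk _) (one_smul _ _)
      mul_smul := by
        rintro ⟨⟨g⟩⟩ ⟨⟨h⟩⟩ ⟨a⟩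
        exact congrArg (Quotient.mk _) (mul_smul (MulOpposite.op g) (MulOpposite.op h) a) }
  comm := @SMulCommClass.mk _ _ _ (_) (_) (by
    rintro ⟨g⟩ ⟨⟨h⟩⟩ ⟨a⟩
    exact congrArg (Quotient.mk _) (smul_comm g (MulOpposite.op h) a))

theorem Iso.deflCongr {X Y : Biset G H} (N : Subgroup G) [N.Normal] (M : Subgroup H) [M.Normal]
    (e : Iso X Y) : Nonempty (Iso (X.defl N M) (Y.defl N M)) := ⟨{
  toEquiv := Quotient.congr e.toEquiv (by
    intro a b
    refine exists_congr fun m => and_congr_right fun _ => exists_congr fun n =>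
      and_congr_right fun _ => ?_
    rw [← e.map_right, ← e.map_left, e.toEquiv.injective.eq_iff])
  map_left := by
    rintro ⟨h⟩ ⟨a⟩
    exact congrArg (Quotient.mk _) (e.map_left h a)
  map_right := by
    rintro ⟨g⟩ ⟨a⟩
    exact congrArg (Quotient.mk _) (e.map_right g a) }⟩

theorem defl_sum (N : Subgroup G) [N.Normal] (M : Subgroup H) [M.Normal] (X Y : Biset G H) :
    Nonempty (Iso ((X.sum Y).defl N M) ((X.defl N M).sum (Y.defl N M))) := ⟨{
  toEquiv :=
    { toFun := Quotient.lift (fun a : X.carrier ⊕ Y.carrier =>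
        Sum.elim (fun x => (Sum.inl (Quotient.mk _ x) :
            (X.defl N M).carrier ⊕ (Y.defl N M).carrier))
          (fun x => Sum.inr (Quotient.mk _ x)) a) (by
        rintro (a | a) (b | b) ⟨m, hm, n, hn, h⟩
        · exact congrArg Sum.inl (Quotient.sound ⟨m, hm, n, hn, Sum.inl_injective h⟩)
        · exact (Sum.inr_ne_inl h).elim
        · exact (Sum.inl_ne_inr h).elim
        · exact congrArg Sum.inr (Quotient.sound ⟨m, hm, n, hn, Sum.inr_injective h⟩))
      invFun := Sum.elim
        (Quotient.map Sum.inl (by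
          rintro a b ⟨m, hm, n, hn, h⟩; exact ⟨m, hm, n, hn, congrArg Sum.inl h⟩))
        (Quotient.map Sum.inr (by
          rintro a b ⟨m, hm, n, hn, h⟩; exact ⟨m, hm, n, hn, congrArg Sum.inr h⟩))
      left_inv := by rintro ⟨a | a⟩ <;> rfl
      right_inv := by
        rintro (a | a) <;> refine Quotient.inductionOn a fun b => rfl }
  map_left := by rintro ⟨h⟩ ⟨a | a⟩ <;> rfl
  map_right := by rintro ⟨h⟩ ⟨a | a⟩ <;> rfl }⟩

/-! #### Number of left orbits -/

/-- The number `|H \ X|` of orbits of the left action; for left-free `X` it is `|X| / |H|`. -/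
def numOrbits (X : Biset G H) : ℕ := Nat.card (MulAction.orbitRel.Quotient H X.carrier)

theorem Iso.numOrbits_eq {X Y : Biset G H} (e : Iso X Y) : X.numOrbits = Y.numOrbits := by
  refine Nat.card_congr (Quotient.congr e.toEquiv ?_)
  intro a b
  change a ∈ MulAction.orbit H b ↔ e.toEquiv a ∈ MulAction.orbit H (e.toEquiv b)
  refine exists_congr fun h => ?_
  change h • b = a ↔ h • e.toEquiv b = e.toEquiv a
  rw [← e.map_left, e.toEquiv.injective.eq_iff]

theorem numOrbits_sum (X Y : Biset G H) : (X.sum Y).numOrbits = X.numOrbits + Y.numOrbits := by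
  have : ∀ Z : Biset G H, Finite (MulAction.orbitRel.Quotient H Z.carrier) := fun Z =>
    Quotient.finite _
  have hX := this X
  have hY := this Y
  rw [numOrbits, numOrbits, numOrbits, ← Nat.card_sum]
  exact Nat.card_congr
    { toFun := Quotient.lift (fun a : X.carrier ⊕ Y.carrier =>
        Sum.elim (fun x => (Sum.inl (Quotient.mk _ x) :
            MulAction.orbitRel.Quotient H X.carrier ⊕ MulAction.orbitRel.Quotient H Y.carrier))
          (fun x => Sum.inr (Quotient.mk _ x)) a) (by
        rintro (a | a) (b | b) ⟨m, h⟩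
        · exact congrArg Sum.inl (Quotient.sound ⟨m, Sum.inl_injective h⟩)
        · exact (Sum.inr_ne_inl h).elim
        · exact (Sum.inl_ne_inr h).elim
        · exact congrArg Sum.inr (Quotient.sound ⟨m, Sum.inr_injective h⟩))
      invFun := Sum.elim
        (Quotient.map Sum.inl (by rintro a b ⟨m, h⟩; exact ⟨m, congrArg Sum.inl h⟩))
        (Quotient.map Sum.inr (by rintro a b ⟨m, h⟩; exact ⟨m, congrArg Sum.inr h⟩))
      left_inv := by rintro ⟨a | a⟩ <;> rfl
      right_inv := by
        rintro (a | a) <;> refine Quotient.inductionOn a fun b => rfl }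

end Biset

/-! ### Burnside modules -/

section Burnside

variable (G H K : Type u) [Group G] [Group H] [Group K]

/-- Isomorphism classes of finite `(G, H)`-bisets. -/
def BisetClass : Type (u + 1) := Quotient (Biset.isoSetoid G H)

variable {G H K}

/-- The isomorphism class of a biset. -/
def Biset.cls (X : Biset G H) : BisetClass G H := Quotient.mk _ X

theorem Biset.Iso.cls_eq {X Y : Biset G H} (e : Biset.Iso X Y) : X.cls = Y.cls :=
  Quotient.sound ⟨e⟩

theorem BisetClass.ind {motive : BisetClass G H → Prop} (h : ∀ X : Biset G H, motive X.cls)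
    (x : BisetClass G H) : motive x := Quotient.ind h x

instance : Zero (BisetClass G H) := ⟨(Biset.empty G H).cls⟩

instance : Add (BisetClass G H) :=
  ⟨Quotient.map₂ Biset.sum (fun _ _ ⟨e⟩ _ _ ⟨f⟩ => ⟨e.sum f⟩)⟩

/-- Isomorphism classes of bisets form a commutative monoid under disjoint union. -/
instance : AddCommMonoid (BisetClass G H) where
  nsmul := nsmulRec
  add_assoc := by
    rintro ⟨X⟩ ⟨Y⟩ ⟨Z⟩
    refine Quotient.sound ⟨⟨Equiv.sumAssoc _ _ _, ?_, ?_⟩⟩ <;>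
      rintro h ((x | x) | x) <;> rfl
  zero_add := by
    rintro ⟨X⟩
    refine Quotient.sound ⟨⟨Equiv.emptySum PEmpty _, ?_, ?_⟩⟩ <;>
      rintro h (x | x)
    · exact x.elim
    · rfl
    · exact x.elim
    · rfl
  add_zero := by
    rintro ⟨X⟩
    refine Quotient.sound ⟨⟨Equiv.sumEmpty _ PEmpty, ?_, ?_⟩⟩ <;>
      rintro h (x | x)
    · rfl
    · exact x.elim
    · rfl
    · exact x.elim
  add_comm := by
    rintro ⟨X⟩ ⟨Y⟩
    refine Quotient.sound ⟨⟨Equiv.sumComm _ _, ?_, ?_⟩⟩ <;>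
      rintro h (x | x) <;> rfl

theorem Biset.cls_sum (X Y : Biset G H) : (X.sum Y).cls = X.cls + Y.cls := rfl

variable (G H)

/-- The submonoid of isomorphism classes of left-free bisets. -/
def leftFree : AddSubmonoid (BisetClass G H) where
  carrier := {x | ∃ X : Biset G H, X.IsLeftFree ∧ X.cls = x}
  zero_mem' := ⟨Biset.empty G H, fun _ x => PEmpty.elim x, rfl⟩
  add_mem' := by
    rintro _ _ ⟨X, hX, rfl⟩ ⟨Y, hY, rfl⟩
    exact ⟨X.sum Y, hX.sum hY, rfl⟩

/-- The Burnside module `A(G, H)`: the Grothendieck group of the monoid of isomorphism classes of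
finite left-free `(G, H)`-bisets. -/
abbrev Burnside : Type (u + 1) := Algebra.GrothendieckAddGroup (leftFree G H)

/-- The Grothendieck group `B(G, H)` of the monoid of isomorphism classes of all finite
`(G, H)`-bisets. -/
abbrev BigBurnside : Type (u + 1) := Algebra.GrothendieckAddGroup (BisetClass G H)

variable {G H}

/-- Composition of isomorphism classes, `[X] ∘ [Y] = [X ×_H Y]`, for left-free bisets. -/
def compClass (x : leftFree H K) (y : leftFree G H) : leftFree G K :=
  ⟨Quotient.map₂ (sa := Biset.isoSetoid H K) (sb := Biset.isoSetoid G H)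
    (sc := Biset.isoSetoid G K) Biset.comp (fun _ _ ⟨e⟩ _ _ ⟨f⟩ => ⟨e.comp f⟩) x.1 y.1, by
    obtain ⟨_, X, hX, rfl⟩ := x
    obtain ⟨_, Y, hY, rfl⟩ := y
    exact ⟨X.comp Y, hX.comp hY, rfl⟩⟩

theorem add_compClass (x x' : leftFree H K) (y : leftFree G H) :
    compClass (x + x') y = compClass x y + compClass x' y := by
  obtain ⟨_, X, hX, rfl⟩ := x
  obtain ⟨_, X', hX', rfl⟩ := x'
  obtain ⟨_, Y, hY, rfl⟩ := y
  exact Subtype.ext (Biset.sumComp X X' Y).cls_eq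

theorem compClass_add (x : leftFree H K) (y y' : leftFree G H) :
    compClass x (y + y') = compClass x y + compClass x y' := by
  obtain ⟨_, X, hX, rfl⟩ := x
  obtain ⟨_, Y, hY, rfl⟩ := y
  obtain ⟨_, Y', hY', rfl⟩ := y'
  exact Subtype.ext (Biset.compSum X Y Y').cls_eq

theorem groth_lift_of {M A : Type*} [AddCommMonoid M] [AddCommGroup A] (f : M →+ A) (x : M) :
    Algebra.GrothendieckAddGroup.lift f (Algebra.GrothendieckAddGroup.of x) = f x :=
  DFunLike.congr_fun (Algebra.GrothendieckAddGroup.lift.symm_apply_apply f) x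

theorem groth_ext {M A : Type*} [AddCommMonoid M] [AddCommGroup A]
    {f g : Algebra.GrothendieckAddGroup M →+ A}
    (h : ∀ x : M, f (Algebra.GrothendieckAddGroup.of x) =
      g (Algebra.GrothendieckAddGroup.of x)) : f = g :=
  Algebra.GrothendieckAddGroup.lift.symm.injective (AddMonoidHom.ext h)

/-- The composition pairing `A(H, K) × A(G, H) → A(G, K)`, the biadditive map determined by
`[X] ∘ [Y] = [X ×_H Y]`. -/
def burnsideComp : Burnside H K →+ Burnside G H →+ Burnside G K :=
  Algebra.GrothendieckAddGroup.lift (AddMonoidHom.mk' (fun x : leftFree H K =>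
    Algebra.GrothendieckAddGroup.lift (AddMonoidHom.mk' (fun y : leftFree G H =>
      (Algebra.GrothendieckAddGroup.of (compClass x y) : Burnside G K))
      (fun y y' => by rw [compClass_add, map_add])))
    (fun x x' => by
      refine groth_ext fun y => ?_
      rw [AddMonoidHom.add_apply, groth_lift_of, groth_lift_of, groth_lift_of]
      simp only [AddMonoidHom.mk'_apply]
      rw [add_compClass, map_add]))

/-- The augmentation `A(G, H) → ℤ`, sending the class of a biset `X` to `|H \ X|`. -/
def augInt : Burnside G H →+ ℤ :=
  Algebra.GrothendieckAddGroup.lift (AddMonoidHom.mk' (fun x : leftFree G H =>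
    ((Quotient.lift (s := Biset.isoSetoid G H) Biset.numOrbits
      (fun _ _ ⟨e⟩ => e.numOrbits_eq) x.1 : ℕ) : ℤ)) (by
      rintro ⟨_, X, hX, rfl⟩ ⟨_, Y, hY, rfl⟩
      exact (congrArg Nat.cast (Biset.numOrbits_sum X Y)).trans (Nat.cast_add _ _)))

/-- The canonical map `A(G, H) → B(G, H)`. -/
def toBigInt : Burnside G H →+ BigBurnside G H :=
  Algebra.GrothendieckAddGroup.lift
    (Algebra.GrothendieckAddGroup.of.comp (leftFree G H).subtype)

/-- Bideflation with respect to a normal subgroup `T` of `S`: it sends the class of an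
`(S, S)`-biset `X` to the class of the `(S ⧸ T, S ⧸ T)`-biset `T \ X / T`. As `T \ X / T` need not be
left-free when `X` is, the target is the Grothendieck group of all finite bisets. -/
def bidefInt {S : Type u} [Group S] (T : Subgroup S) [T.Normal] :
    Burnside S S →+ BigBurnside (S ⧸ T) (S ⧸ T) :=
  Algebra.GrothendieckAddGroup.lift (AddMonoidHom.mk' (fun x : leftFree S S =>
    (Algebra.GrothendieckAddGroup.of (Quotient.map (sa := Biset.isoSetoid S S)
      (sb := Biset.isoSetoid (S ⧸ T) (S ⧸ T)) (Biset.defl T T)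
      (fun _ _ ⟨e⟩ => e.deflCongr T T) x.1 : BisetClass (S ⧸ T) (S ⧸ T)) :
        BigBurnside (S ⧸ T) (S ⧸ T))) (by
      rintro ⟨_, X, hX, rfl⟩ ⟨_, Y, hY, rfl⟩
      obtain ⟨e⟩ := Biset.defl_sum T T X Y
      refine Eq.trans ?_ (map_add Algebra.GrothendieckAddGroup.of _ _)
      exact congrArg Algebra.GrothendieckAddGroup.of e.cls_eq))

/-! #### The canonical map `A(G, H) → B(G, H)` is split injective -/

/-- The points of a biset with trivial left stabilizer. -/
def Biset.freePart (X : Biset G H) : Biset G H where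
  carrier := {x : X.carrier // ∀ h : H, h • x = x → h = 1}
  left :=
    { smul := fun h x => ⟨h • x.1, fun k hk => by
        have h1 : (h⁻¹ * k * h) • x.1 = x.1 := by
          rw [mul_smul, mul_smul, hk, inv_smul_smul]
        have h2 := x.2 _ h1
        have h3 : k = h * (h⁻¹ * k * h) * h⁻¹ := by group
        rw [h3, h2]; group⟩
      one_smul := fun x => Subtype.ext (one_smul _ _)
      mul_smul := fun g h x => Subtype.ext (mul_smul _ _ _) }
  right :=
    { smul := fun g x => ⟨g • x.1, fun k hk => x.2 k (by
        rw [smul_comm] at hk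
        exact (MulAction.injective g) hk)⟩
      one_smul := fun x => Subtype.ext (one_smul _ _)
      mul_smul := fun g h x => Subtype.ext (mul_smul _ _ _) }
  comm := @SMulCommClass.mk _ _ _ (_) (_) (fun g h x => Subtype.ext (smul_comm _ _ _))

theorem Biset.freePart_isLeftFree (X : Biset G H) : X.freePart.IsLeftFree :=
  fun h x hx => x.2 h (congrArg Subtype.val hx)

def Biset.IsLeftFree.freePartIso {X : Biset G H} (hX : X.IsLeftFree) : Biset.Iso X.freePart X where
  toEquiv := ⟨Subtype.val, fun x => ⟨x, fun h => hX h x⟩, fun _ => rfl, fun _ => rfl⟩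
  map_left _ _ := rfl
  map_right _ _ := rfl

def Biset.Iso.freePart {X Y : Biset G H} (e : Biset.Iso X Y) :
    Biset.Iso X.freePart Y.freePart where
  toEquiv := e.toEquiv.subtypeEquiv (fun x => by
    refine forall_congr' fun h => ?_
    rw [← e.map_left, e.toEquiv.injective.eq_iff])
  map_left h x := Subtype.ext (e.map_left h x.1)
  map_right g x := Subtype.ext (e.map_right g x.1)

def Biset.freePartSum (X Y : Biset G H) :
    Biset.Iso (X.sum Y).freePart (X.freePart.sum Y.freePart) where
  toEquiv :=
    { toFun := fun x => match x with
        | ⟨Sum.inl x, hx⟩ => Sum.inl ⟨x, fun h e => hx h (congrArg Sum.inl e)⟩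
        | ⟨Sum.inr x, hx⟩ => Sum.inr ⟨x, fun h e => hx h (congrArg Sum.inr e)⟩
      invFun := Sum.elim
        (fun x => ⟨Sum.inl x.1, fun h e => x.2 h (Sum.inl_injective e)⟩)
        (fun x => ⟨Sum.inr x.1, fun h e => x.2 h (Sum.inr_injective e)⟩)
      left_inv := by rintro ⟨x | x, hx⟩ <;> rfl
      right_inv := by rintro (x | x) <;> rfl }
  map_left := by rintro h ⟨x | x, hx⟩ <;> rfl
  map_right := by rintro h ⟨x | x, hx⟩ <;> rfl

/-- The retraction `B(G, H) → A(G, H)` sending the class of a biset to that of its free part. -/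
def ofBigInt : BigBurnside G H →+ Burnside G H :=
  Algebra.GrothendieckAddGroup.lift (AddMonoidHom.mk' (fun x : BisetClass G H =>
    (Algebra.GrothendieckAddGroup.of (⟨Quotient.map (sa := Biset.isoSetoid G H)
      (sb := Biset.isoSetoid G H) Biset.freePart (fun _ _ ⟨e⟩ => ⟨e.freePart⟩) x, by
        obtain ⟨X, rfl⟩ := Quotient.exists_rep x
        exact ⟨X.freePart, X.freePart_isLeftFree, rfl⟩⟩ : leftFree G H) : Burnside G H)) (by
      rintro ⟨X⟩ ⟨Y⟩
      refine Eq.trans ?_ (map_add Algebra.GrothendieckAddGroup.of _ _)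
      exact congrArg Algebra.GrothendieckAddGroup.of
        (Subtype.ext (Biset.freePartSum X Y).cls_eq)))

theorem ofBigInt_toBigInt (x : Burnside G H) : ofBigInt (toBigInt x) = x := by
  suffices h : (ofBigInt (G := G) (H := H)).comp toBigInt = AddMonoidHom.id _ from
    DFunLike.congr_fun h x
  refine groth_ext fun x => ?_
  rw [AddMonoidHom.comp_apply, toBigInt, groth_lift_of, AddMonoidHom.comp_apply, ofBigInt,
    groth_lift_of]
  obtain ⟨_, X, hX, rfl⟩ := x
  exact congrArg Algebra.GrothendieckAddGroup.of (Subtype.ext hX.freePartIso.cls_eq)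

end Burnside

/-! ### `p`-localization -/

section Localization

variable (p : ℕ) [hp : Fact p.Prime] (G H : Type u) {K : Type u} [Group G] [Group H] [Group K]

/-- The ring `ℤ_(p)`: the rational numbers with denominator prime to `p`. -/
def ZLoc : Subring ℚ where
  carrier := {q | ¬ p ∣ q.den}
  zero_mem' := by simpa using hp.out.one_lt.ne'
  one_mem' := by simpa using hp.out.one_lt.ne'
  neg_mem' := by simp
  add_mem' {a b} ha hb h :=
    ((Nat.Prime.dvd_mul hp.out).1 (h.trans (Rat.add_den_dvd a b))).elim ha hb
  mul_mem' {a b} ha hb h :=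
    ((Nat.Prime.dvd_mul hp.out).1 (h.trans (Rat.mul_den_dvd a b))).elim ha hb

/-- `A(G, H)_(p)`. -/
abbrev LocBurnside : Type (u + 1) := ZLoc p ⊗[ℤ] Burnside G H

/-- `B(G, H)_(p)`. -/
abbrev LocBigBurnside : Type (u + 1) := ZLoc p ⊗[ℤ] BigBurnside G H

variable {G H}

/-- The class `[L, φ]_G^H` of the biset `H ×_{(L,φ)} G` in `A(G, H)_(p)`. -/
def pairClass [Finite G] [Finite H] (L : Subgroup G) (φ : L →* H) : LocBurnside p G H :=
  1 ⊗ₜ Algebra.GrothendieckAddGroup.of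
    (⟨(Biset.pair L φ).cls, Biset.pair L φ, Biset.pair_isLeftFree L φ, rfl⟩ : leftFree G H)

/-- The class `[P, φ]_P^H` for a homomorphism `φ` defined on the whole group `P`. -/
def homClass [Finite G] [Finite H] (φ : G →* H) : LocBurnside p G H :=
  pairClass p (⊤ : Subgroup G) (φ.comp (⊤ : Subgroup G).subtype)

/-- The `p`-localized composition pairing. -/
def comp : LocBurnside p H K →ₗ[ℤ] LocBurnside p G H →ₗ[ℤ] LocBurnside p G K :=
  TensorProduct.map₂ (LinearMap.mul ℤ (ZLoc p))
    (LinearMap.mk₂ ℤ (fun x y => burnsideComp x y) (by simp) (by simp) (by simp) (by simp))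

/-- The `p`-localized augmentation. -/
def aug : LocBurnside p G H →ₗ[ZLoc p] ZLoc p :=
  (TensorProduct.AlgebraTensorModule.rid ℤ (ZLoc p) (ZLoc p)).toLinearMap ∘ₗ
    augInt.toIntLinearMap.baseChange (ZLoc p)

/-- The `p`-localized canonical map `A(G, H)_(p) → B(G, H)_(p)`. -/
def toBig : LocBurnside p G H →ₗ[ZLoc p] LocBigBurnside p G H :=
  toBigInt.toIntLinearMap.baseChange (ZLoc p)

/-- Via `toBig`, the module `A(G, H)_(p)` is a submodule of `B(G, H)_(p)`. -/
theorem toBig_injective : Function.Injective (toBig p (G := G) (H := H)) := by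
  refine Function.LeftInverse.injective (g := ofBigInt.toIntLinearMap.baseChange (ZLoc p)) ?_
  intro x
  rw [toBig, ← LinearMap.comp_apply, ← LinearMap.baseChange_comp]
  have : (ofBigInt (G := G) (H := H)).toIntLinearMap ∘ₗ toBigInt.toIntLinearMap =
      LinearMap.id := LinearMap.ext ofBigInt_toBigInt
  rw [this, LinearMap.baseChange_id, LinearMap.id_apply]

/-- The `p`-localized bideflation map. -/
def bidef {S : Type u} [Group S] (T : Subgroup S) [T.Normal] :
    LocBurnside p S S →ₗ[ZLoc p] LocBigBurnside p (S ⧸ T) (S ⧸ T) :=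
  (bidefInt T).toIntLinearMap.baseChange (ZLoc p)

end Localization

/-! ### Characteristic elements -/

section Characteristic

variable (p : ℕ) [Fact p.Prime] {S : Type u} [Group S] [Finite S]

/-- `X` is `F`-generated: a `ℤ_(p)`-linear combination of classes `[L, φ]` with `φ` in `F`. -/
def IsGenerated (F : FusionSystem S) (X : LocBurnside p S S) : Prop :=
  X ∈ Submodule.span (ZLoc p) {Y | ∃ (L : Subgroup S) (φ : L →* S), φ ∈ F.HomS L ∧
    Y = pairClass p L φ}

/-- `X ∘ [P, φ]_P^S = X ∘ [P, incl]_P^S` for all `φ ∈ Hom_F(P, S)`. -/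
def IsRightStable (F : FusionSystem S) (X : LocBurnside p S S) : Prop :=
  ∀ (P : Subgroup S) (φ : P →* S), φ ∈ F.HomS P →
    comp p X (homClass p φ) = comp p X (homClass p P.subtype)

/-- `[φ(P), φ⁻¹]_S^P ∘ X = [P, 1]_S^P ∘ X` for all `φ ∈ Hom_F(P, S)`. -/
def IsLeftStable (F : FusionSystem S) (X : LocBurnside p S S) : Prop :=
  ∀ (P : Subgroup S) (φ : P →* S) (hφ : φ ∈ F.HomS P),
    comp p (pairClass p φ.range
      (MonoidHom.ofInjective (F.homS_injective hφ)).symm.toMonoidHom) X =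
    comp p (pairClass p P (MonoidHom.id P)) X

/-- The augmentation of `X` is prime to `p`. -/
def AugPrimeTo (X : LocBurnside p S S) : Prop := ¬ ((p : ZLoc p) ∣ aug p X)

structure IsRightCharacteristic (F : FusionSystem S) (X : LocBurnside p S S) : Prop where
  generated : IsGenerated p F X
  stable : IsRightStable p F X
  aug : AugPrimeTo p X

structure IsLeftCharacteristic (F : FusionSystem S) (X : LocBurnside p S S) : Prop where
  generated : IsGenerated p F X
  stable : IsLeftStable p F X
  aug : AugPrimeTo p X

/-- A (fully) characteristic element. -/
structure IsCharacteristic (F : FusionSystem S) (X : LocBurnside p S S) : Prop where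
  generated : IsGenerated p F X
  right_stable : IsRightStable p F X
  left_stable : IsLeftStable p F X
  aug : AugPrimeTo p X

/-- `X ∘ X ≡ X` modulo `p`. -/
def IsIdempotentMod (X : LocBurnside p S S) : Prop :=
  ∃ Y : LocBurnside p S S, comp p X X - X = (p : ZLoc p) • Y

structure IsCharacteristicIdempotent (F : FusionSystem S) (X : LocBurnside p S S) : Prop where
  characteristic : IsCharacteristic p F X
  idempotent : comp p X X = X

end Characteristic

end BisetFusion

end

/-! Bideflation does not respect composition, so idempotency cannot be carried across directly. It
is controlled instead through a copy of the Burnside ring of `S`. The class `[L, φ]` factors as `[L,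
φ]_L^S ∘ [L, id]_S^L`. Hence, for right stable `X` and `F`-generated `W`, the product `X ∘ W`
depends only on `toIncl W`, the image of `W` under `[L, φ] ↦ [L, incl]` (`IsRightStable.comp_eq`).
In particular, if `X` is right characteristic and idempotent mod `p`, then `a = toIncl X` is
idempotent mod `p` in the span of the classes `[L, incl]`, and its augmentation is prime to `p`.

Because `S` is a `p`-group, this forces `a ≡ 1` mod `p`. If `p ∣ ε(b)`, then `b ∘ [P, incl]` is a
combination of multiples of `p` and of classes `[R, incl]` with `|R| < |P|` (`comp_mem_inclFilt`),
so multiplication by `b` is nilpotent mod `p`. Apply this to `b = 1 - a`, which is idempotent mod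
`p`. If `X` is an exact idempotent, Nakayama's lemma improves the congruence to `a = 1`.

Deflation sends `[L, φ]` to `[LT/T, φ̄]`, so it commutes with `toIncl`, and it preserves right
stability. For the deflation `X̄` this gives `X̄ ∘ X̄ = X̄ ∘ toIncl X̄ = X̄ ∘ (1 + p ȳ) ≡ X̄` mod
`p`, and likewise `ε(X̄) ≡ 1`. When `a = 1` the same computation gives `X̄ ∘ X̄ = X̄`.

The existence of `φ̄` in `F/T` is immediate if `T ≤ L`. For other `L` it uses saturation
(`lifts_of_isSaturated`): by induction from larger subgroups, every morphism is a composite of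
morphisms that extend to larger subgroups and morphisms that are trivial modulo `T`.

Left statements follow by passing to opposite bisets. For uniqueness, two characteristic idempotents
`X`, `W` satisfy `X ∘ W = X` by right stability and `X ∘ W = W` by the dual argument. -/

noncomputable section
namespace BisetFusion
universe u

/-! ### Classes in the localized Burnside modules, and linear maps induced by functors -/

section Functor

variable {G H K G' H' : Type u} [Group G] [Group H] [Group K] [Group G'] [Group H']

/-- A construction on bisets which respects isomorphisms and disjoint unions and preserves
left-freeness. -/
structure BisetFunctor (G H G' H' : Type u) [Group G] [Group H] [Group G'] [Group H'] where
  obj : Biset G H → Biset G' H'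
  iso : ∀ {X Y : Biset G H}, Biset.Iso X Y → Nonempty (Biset.Iso (obj X) (obj Y))
  sum : ∀ X Y : Biset G H, Nonempty (Biset.Iso (obj (X.sum Y)) ((obj X).sum (obj Y)))
  free : ∀ {X : Biset G H}, X.IsLeftFree → (obj X).IsLeftFree

/-- The class of a left-free biset in `A(G, H)`. -/
def leftFreeClass (X : Biset G H) (hX : X.IsLeftFree) : leftFree G H := ⟨X.cls, X, hX, rfl⟩

def BisetFunctor.mapInt (Φ : BisetFunctor G H G' H') : Burnside G H →+ Burnside G' H' :=
  Algebra.GrothendieckAddGroup.lift (AddMonoidHom.mk' (fun x : leftFree G H =>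
    (Algebra.GrothendieckAddGroup.of (⟨Quotient.map (sa := Biset.isoSetoid G H)
      (sb := Biset.isoSetoid G' H') Φ.obj (fun _ _ ⟨e⟩ => Φ.iso e) x.1, by
        obtain ⟨_, X, hX, rfl⟩ := x
        exact ⟨Φ.obj X, Φ.free hX, rfl⟩⟩ : leftFree G' H') : Burnside G' H')) (by
      rintro ⟨_, X, hX, rfl⟩ ⟨_, Y, hY, rfl⟩
      obtain ⟨e⟩ := Φ.sum X Y
      refine Eq.trans ?_ (map_add Algebra.GrothendieckAddGroup.of _ _)
      exact congrArg Algebra.GrothendieckAddGroup.of (Subtype.ext e.cls_eq)))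

theorem BisetFunctor.mapInt_of (Φ : BisetFunctor G H G' H') (X : Biset G H) (hX : X.IsLeftFree) :
    Φ.mapInt (Algebra.GrothendieckAddGroup.of (leftFreeClass X hX)) =
      Algebra.GrothendieckAddGroup.of (leftFreeClass (Φ.obj X) (Φ.free hX)) :=
  groth_lift_of _ _

variable (p : ℕ) [hp : Fact p.Prime]

/-- The class of a left-free biset in `A(G, H)_(p)`. -/
def locClass (X : Biset G H) (hX : X.IsLeftFree) : LocBurnside p G H :=
  1 ⊗ₜ Algebra.GrothendieckAddGroup.of (leftFreeClass X hX)

theorem pairClass_eq [Finite G] [Finite H] (L : Subgroup G) (φ : L →* H) :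
    pairClass p L φ = locClass p (Biset.pair L φ) (Biset.pair_isLeftFree L φ) := rfl

variable {p}

theorem locClass_congr {X Y : Biset G H} (e : Biset.Iso X Y) (hX : X.IsLeftFree)
    (hY : Y.IsLeftFree) : locClass p X hX = locClass p Y hY :=
  congrArg (fun z : leftFree G H => (1 : ZLoc p) ⊗ₜ[ℤ]
    (Algebra.GrothendieckAddGroup.of z : Burnside G H)) (Subtype.ext e.cls_eq)

theorem locClass_sum {X Y : Biset G H} (hX : X.IsLeftFree) (hY : Y.IsLeftFree) :
    locClass p (X.sum Y) (hX.sum hY) = locClass p X hX + locClass p Y hY := by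
  rw [locClass, locClass, locClass, ← TensorProduct.tmul_add, ← map_add]
  rfl

theorem locBurnside_hom_ext {M : Type*} [AddCommGroup M] [Module (ZLoc p) M]
    {f g : LocBurnside p G H →ₗ[ZLoc p] M}
    (h : ∀ (X : Biset G H) (hX : X.IsLeftFree), f (locClass p X hX) = g (locClass p X hX)) :
    f = g := by
  have key : (f.toAddMonoidHom.comp (TensorProduct.mk ℤ (ZLoc p) (Burnside G H) 1).toAddMonoidHom) =
      g.toAddMonoidHom.comp (TensorProduct.mk ℤ (ZLoc p) (Burnside G H) 1).toAddMonoidHom := by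
    refine groth_ext ?_
    rintro ⟨_, X, hX, rfl⟩
    exact h X hX
  refine LinearMap.ext fun x => ?_
  induction x using TensorProduct.induction_on with
  | zero => simp
  | add x y hx hy => rw [map_add, map_add, hx, hy]
  | tmul c y =>
    have h1 : c ⊗ₜ[ℤ] y = c • ((1 : ZLoc p) ⊗ₜ[ℤ] y) := by
      rw [TensorProduct.smul_tmul', smul_eq_mul, mul_one]
    rw [h1, map_smul, map_smul]
    exact congrArg (c • ·) (DFunLike.congr_fun key y)

theorem locBurnside_mem {N : Submodule (ZLoc p) (LocBurnside p G H)}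
    (h : ∀ (X : Biset G H) (hX : X.IsLeftFree), locClass p X hX ∈ N) (x : LocBurnside p G H) :
    x ∈ N := by
  have : N.mkQ = 0 := locBurnside_hom_ext fun X hX => by
    simpa using h X hX
  have h1 := LinearMap.congr_fun this x
  simpa using h1

@[elab_as_elim]
theorem locBurnside_induction {motive : LocBurnside p G H → Prop}
    (cls : ∀ (X : Biset G H) (hX : X.IsLeftFree), motive (locClass p X hX))
    (add : ∀ x y, motive x → motive y → motive (x + y))
    (smul : ∀ (c : ZLoc p) x, motive x → motive (c • x)) (x : LocBurnside p G H) : motive x := by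
  let N : Submodule (ZLoc p) (LocBurnside p G H) :=
    { carrier := {x | motive x}
      add_mem' := fun {a b} ha hb => add a b ha hb
      zero_mem' := by
        have := smul 0 _ (cls (Biset.empty G H) (fun _ x => PEmpty.elim x))
        rwa [zero_smul] at this
      smul_mem' := fun c x hx => smul c x hx }
  exact locBurnside_mem (N := N) cls x

variable (p) in
/-- The linear map induced by a functor on bisets. -/
def BisetFunctor.map (Φ : BisetFunctor G H G' H') :
    LocBurnside p G H →ₗ[ZLoc p] LocBurnside p G' H' :=
  Φ.mapInt.toIntLinearMap.baseChange (ZLoc p)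

theorem BisetFunctor.map_locClass (Φ : BisetFunctor G H G' H') (X : Biset G H)
    (hX : X.IsLeftFree) :
    Φ.map p (locClass p X hX) = locClass p (Φ.obj X) (Φ.free hX) := by
  rw [BisetFunctor.map, locClass, LinearMap.baseChange_tmul]
  exact congrArg _ (Φ.mapInt_of X hX)

theorem comp_tmul (a b : ZLoc p) (x : Burnside H K) (y : Burnside G H) :
    comp p (a ⊗ₜ[ℤ] x) (b ⊗ₜ[ℤ] y) = (a * b) ⊗ₜ[ℤ] burnsideComp x y :=
  rfl

theorem burnsideComp_of (x : leftFree H K) (y : leftFree G H) :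
    burnsideComp (Algebra.GrothendieckAddGroup.of x) (Algebra.GrothendieckAddGroup.of y) =
      Algebra.GrothendieckAddGroup.of (compClass x y) := by
  rw [burnsideComp, groth_lift_of]
  exact groth_lift_of _ _

theorem comp_locClass {X : Biset H K} {Y : Biset G H} (hX : X.IsLeftFree) (hY : Y.IsLeftFree) :
    comp p (locClass p X hX) (locClass p Y hY) = locClass p (X.comp Y) (hX.comp hY) := by
  rw [locClass, locClass, comp_tmul, mul_one, burnsideComp_of]
  rfl

/-- The composition pairing is constructed over `ℤ`; linearity over `ℤ_(p)` is checked on pure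
tensors. -/
theorem comp_smul_left (c : ZLoc p) (x : LocBurnside p H K) (y : LocBurnside p G H) :
    comp p (c • x) y = c • comp p x y := by
  induction x using TensorProduct.induction_on with
  | zero => simp
  | add x x' hx hx' => rw [smul_add, map_add, map_add, LinearMap.add_apply, hx, hx',
      LinearMap.add_apply, smul_add]
  | tmul a x =>
    induction y using TensorProduct.induction_on with
    | zero => simp
    | add y y' hy hy' => rw [map_add, map_add, hy, hy', smul_add]
    | tmul b y =>
      rw [TensorProduct.smul_tmul', comp_tmul, comp_tmul, TensorProduct.smul_tmul', smul_eq_mul,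
        smul_eq_mul, mul_assoc]

theorem comp_smul_right (c : ZLoc p) (x : LocBurnside p H K) (y : LocBurnside p G H) :
    comp p x (c • y) = c • comp p x y := by
  induction x using TensorProduct.induction_on with
  | zero => simp
  | add x x' hx hx' => rw [map_add, LinearMap.add_apply, hx, hx', LinearMap.add_apply, smul_add]
  | tmul a x =>
    induction y using TensorProduct.induction_on with
    | zero => simp
    | add y y' hy hy' => rw [smul_add, map_add, map_add, hy, hy', smul_add]
    | tmul b y =>
      rw [TensorProduct.smul_tmul', comp_tmul, comp_tmul, TensorProduct.smul_tmul', smul_eq_mul,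
        smul_eq_mul, mul_left_comm]

/-- Composition as a `ℤ_(p)`-bilinear map. -/
def compL : LocBurnside p H K →ₗ[ZLoc p] LocBurnside p G H →ₗ[ZLoc p] LocBurnside p G K :=
  LinearMap.mk₂ (ZLoc p) (fun x y => comp p x y) (fun _ _ _ => by simp) comp_smul_left
    (fun _ _ _ => by simp) comp_smul_right

theorem compL_apply (x : LocBurnside p H K) (y : LocBurnside p G H) :
    compL x y = comp p x y := rfl

theorem aug_locClass (X : Biset G H) (hX : X.IsLeftFree) :
    aug p (locClass p X hX) = (X.numOrbits : ZLoc p) := by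
  rw [aug, locClass]
  simp only [LinearMap.comp_apply, LinearMap.baseChange_tmul, LinearEquiv.coe_coe,
    AddMonoidHom.coe_toIntLinearMap, augInt]
  rw [groth_lift_of]
  change ((X.numOrbits : ℕ) : ℤ) • (1 : ZLoc p) = _
  rw [zsmul_one, Int.cast_natCast]

theorem toBig_locClass (X : Biset G H) (hX : X.IsLeftFree) :
    toBig p (locClass p X hX) = 1 ⊗ₜ Algebra.GrothendieckAddGroup.of X.cls := by
  rw [toBig, locClass, LinearMap.baseChange_tmul, AddMonoidHom.coe_toIntLinearMap, toBigInt,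
    groth_lift_of]
  rfl

theorem bidef_locClass {S : Type u} [Group S] (T : Subgroup S) [T.Normal] (X : Biset S S)
    (hX : X.IsLeftFree) :
    bidef p T (locClass p X hX) = 1 ⊗ₜ Algebra.GrothendieckAddGroup.of (X.defl T T).cls := by
  rw [bidef, locClass, LinearMap.baseChange_tmul, AddMonoidHom.coe_toIntLinearMap, bidefInt,
    groth_lift_of]
  rfl

end Functor

/-! ### Constructions on bisets -/

namespace Biset

variable {G H K J : Type u} [Group G] [Group H] [Group K] [Group J]

theorem rmul_one {X : Biset G H} (x : X.carrier) : rmul x 1 = x := one_smul _ _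

theorem rmul_rmul {X : Biset G H} (x : X.carrier) (g g' : G) :
    rmul (rmul x g) g' = rmul x (g * g') := (mul_smul (MulOpposite.op g') (MulOpposite.op g) x).symm

theorem smul_rmul {X : Biset G H} (x : X.carrier) (h : H) (g : G) :
    h • rmul x g = rmul (h • x) g := smul_comm _ _ _

/-- A bijection commuting with both actions is an isomorphism of bisets. -/
def Iso.ofBijective {X Y : Biset G H} (f : X.carrier → Y.carrier) (hf : Function.Bijective f)
    (hl : ∀ (h : H) x, f (h • x) = h • f x) (hr : ∀ (g : G) x, f (rmul x g) = rmul (f x) g) :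
    Iso X Y := ⟨Equiv.ofBijective f hf, hl, hr⟩

/-- A biset generated by one element `x` is isomorphic to `H ×_{(L,φ)} G` if the graph of `φ`
describes the stabilizer of `x`. -/
theorem pairIso [Finite G] [Finite H] {L : Subgroup G} {φ : L →* H} {X : Biset G H}
    (x : X.carrier) (hgen : ∀ y : X.carrier, ∃ (h : H) (g : G), y = h • rmul x g)
    (hstab : ∀ (h : H) (g : G), h • x = rmul x g ↔ ∃ hg : g ∈ L, φ ⟨g, hg⟩ = h) :
    Nonempty (Iso (pair L φ) X) := by
  let f : (pair L φ).carrier → X.carrier := Quotient.lift (fun a : H × G => a.1 • rmul x a.2) (by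
    rintro a b ⟨k, h1, h2⟩
    have h3 := (hstab (φ k) k).2 ⟨k.2, rfl⟩
    change a.1 • rmul x a.2 = b.1 • rmul x b.2
    rw [h1, h2, mul_smul, smul_rmul x (φ k), h3, rmul_rmul])
  refine ⟨Iso.ofBijective f ⟨?_, ?_⟩ ?_ ?_⟩
  · rintro ⟨h, g⟩ ⟨h', g'⟩ (e : h • rmul x g = h' • rmul x g')
    have h1 : (h'⁻¹ * h) • x = rmul x (g' * g⁻¹) := by
      have h2 := congrArg (fun z => rmul z g⁻¹) e
      simp only [← smul_rmul] at h2
      rw [rmul_rmul, rmul_rmul, mul_inv_cancel, rmul_one] at h2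
      rw [mul_smul, h2, inv_smul_smul]
    obtain ⟨hk, hk'⟩ := (hstab _ _).1 h1
    refine (Quotient.sound ⟨⟨_, hk⟩, ?_, ?_⟩ : Quotient.mk (pairSetoid L φ) (h', g') = _).symm
    · rw [hk']; simp
    · simp
  · intro y
    obtain ⟨h, g, rfl⟩ := hgen y
    exact ⟨Quotient.mk _ (h, g), rfl⟩
  · rintro k ⟨h, g⟩
    exact mul_smul _ _ _
  · rintro k ⟨h, g⟩
    change h • rmul x (g * k) = rmul (h • rmul x g) k
    rw [← smul_rmul, rmul_rmul]

/-- The base point of `H ×_{(L,φ)} G`. -/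
def basePoint [Finite G] [Finite H] (L : Subgroup G) (φ : L →* H) : (pair L φ).carrier :=
  Quotient.mk (pairSetoid L φ) (1, 1)

theorem pair_gen [Finite G] [Finite H] {L : Subgroup G} {φ : L →* H} (y : (pair L φ).carrier) :
    ∃ (h : H) (g : G), y = h • rmul (basePoint L φ) g := by
  obtain ⟨h, g⟩ := y
  refine ⟨h, g, ?_⟩
  change Quotient.mk _ _ = Quotient.mk _ (h * 1, 1 * g)
  rw [mul_one, one_mul]

theorem basePoint_stab [Finite G] [Finite H] {L : Subgroup G} {φ : L →* H} (h : H) (g : G) :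
    h • basePoint L φ = rmul (basePoint L φ) g ↔ ∃ hg : g ∈ L, φ ⟨g, hg⟩ = h := by
  constructor
  · intro e
    have e' : Quotient.mk (pairSetoid L φ) (h * 1, 1) = Quotient.mk (pairSetoid L φ) (1, 1 * g) := e
    obtain ⟨k, h1, h2⟩ := Quotient.exact e'.symm
    simp only [one_mul, mul_one] at h1 h2
    subst h2
    exact ⟨k.2, h1.symm⟩
  · rintro ⟨hg, rfl⟩
    refine (Quotient.sound ⟨⟨g, hg⟩, ?_, ?_⟩ : Quotient.mk (pairSetoid L φ) (1, 1 * g) = _).symm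
    · simp
    · simp

/-! #### Associativity and units -/

/-- The class of `(x, y)` in `X ×_H Y`. -/
abbrev tmk {X : Biset H K} {Y : Biset G H} (x : X.carrier) (y : Y.carrier) : (X.comp Y).carrier :=
  Quotient.mk (compSetoid X Y) (x, y)

theorem tmk_rmul {X : Biset H K} {Y : Biset G H} (x : X.carrier) (h : H) (y : Y.carrier) :
    tmk (rmul x h) y = tmk (X := X) x (h • y) := Quotient.sound ⟨h, rfl, rfl⟩

def compAssoc (X : Biset K J) (Y : Biset H K) (Z : Biset G H) :
    Iso ((X.comp Y).comp Z) (X.comp (Y.comp Z)) where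
  toEquiv :=
    { toFun := Quotient.lift (fun a : (X.comp Y).carrier × Z.carrier =>
        Quotient.lift (fun b : X.carrier × Y.carrier => tmk (X := X) b.1 (tmk (X := Y) b.2 a.2)) (by
          rintro ⟨x, y⟩ ⟨x', y'⟩ ⟨k, h1, h2⟩
          simp only at h1 h2 ⊢
          subst h1 h2
          rw [tmk_rmul]
          rfl) a.1) (by
        rintro ⟨⟨x, y⟩, z⟩ ⟨⟨x', y'⟩, z'⟩ ⟨h, h1, h2⟩
        simp only at h1 h2
        subst h2
        have h3 : tmk (X := X) x y = tmk x' (rmul y' h) := h1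
        obtain ⟨k, h4, h5⟩ := Quotient.exact h3
        simp only at h4 h5
        change tmk (X := X) x (tmk (X := Y) y z) = tmk x' (tmk y' (h • z))
        rw [h4, tmk_rmul, ← tmk_rmul (X := Y), h5]
        rfl)
      invFun := Quotient.lift (fun a : X.carrier × (Y.comp Z).carrier =>
        Quotient.lift (fun b : Y.carrier × Z.carrier =>
          tmk (X := X.comp Y) (tmk (X := X) a.1 b.1) b.2) (by
          rintro ⟨y, z⟩ ⟨y', z'⟩ ⟨k, h1, h2⟩
          simp only at h1 h2 ⊢
          subst h1 h2
          exact tmk_rmul (X := X.comp Y) (tmk (X := X) a.1 y') k z) a.2) (by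
        rintro ⟨x, ⟨y, z⟩⟩ ⟨x', ⟨y', z'⟩⟩ ⟨h, h1, h2⟩
        simp only at h1 h2
        subst h1
        have h3 : tmk (X := Y) y' z' = tmk (h • y) z := h2
        obtain ⟨k, h4, h5⟩ := Quotient.exact h3
        simp only at h4 h5
        change tmk (X := X.comp Y) (tmk (X := X) (rmul x' h) y) z =
          tmk (X := X.comp Y) (tmk (X := X) x' y') z'
        rw [tmk_rmul, h4, h5]
        exact (tmk_rmul (X := X.comp Y) (tmk (X := X) x' (h • y)) k z').symm)
      left_inv := by rintro ⟨⟨x, y⟩, z⟩; rfl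
      right_inv := by rintro ⟨x, ⟨y, z⟩⟩; rfl }
  map_left := by rintro k ⟨⟨x, y⟩, z⟩; rfl
  map_right := by rintro k ⟨⟨x, y⟩, z⟩; rfl

/-- Restriction of the right action along a homomorphism. -/
def res (f : G →* H) (X : Biset H K) : Biset G K where
  carrier := X.carrier
  right := MulAction.compHom X.carrier (MonoidHom.op f)
  comm := @SMulCommClass.mk _ _ _ (_) (_) (fun k g x => smul_comm k (MulOpposite.op (f g.unop)) x)

theorem res_rmul (f : G →* H) (X : Biset H K) (x : X.carrier) (g : G) :
    rmul (X := res f X) x g = rmul (X := X) x (f g) := rfl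

/-- As a left `H`-set the right factor is the single free orbit of its base point `e`, so every
class is represented by `(x, e)` for exactly one `x`. The right action is read off from `e g = f(g)
e`. -/
theorem compPairTop [Finite G] [Finite H] (f : G →* H) (X : Biset H K) :
    Nonempty (Iso (X.comp (pair ⊤ (f.comp (⊤ : Subgroup G).subtype))) (res f X)) := by
  let e := basePoint ⊤ (f.comp (⊤ : Subgroup G).subtype)
  have he : ∀ g : G, f g • e = rmul e g := fun g => (basePoint_stab _ _).2 ⟨trivial, rfl⟩
  refine ⟨(Iso.ofBijective (X := res f X) (fun x => tmk (X := X) x e) ⟨?_, ?_⟩ ?_ ?_).symm⟩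
  · intro x y h
    obtain ⟨h, h1, h2⟩ := Quotient.exact h
    have h3 := pair_isLeftFree _ _ h e h2.symm
    subst h3
    exact h1.trans (rmul_one _)
  · rintro ⟨x, y⟩
    obtain ⟨h, g, rfl⟩ := pair_gen y
    refine ⟨rmul (X := X) x (h * f g), ?_⟩
    change tmk (X := X) _ e = tmk (X := X) x (h • rmul e g)
    rw [tmk_rmul, mul_smul, he]
  · intro k x
    rfl
  · intro g (x : X.carrier)
    change tmk (X := X) (rmul x (f g)) e = tmk (X := X) x (rmul e g)
    rw [tmk_rmul, he]

def resId (X : Biset H K) : Iso (res (MonoidHom.id H) X) X :=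
  ⟨Equiv.refl _, fun _ _ => rfl, fun _ _ => rfl⟩

/-- The composite of two transitive bisets, when there is only one double coset. -/
theorem compPair [Finite G] [Finite H] [Finite K] {R : Subgroup H} {φ : R →* K} {L : Subgroup G}
    {ψ : L →* H} {M : Subgroup G} {χ : M →* K} (hcos : ∀ h : H, ∃ (r : R) (l : L), h = r * ψ l)
    (hM : ∀ g : G, g ∈ M ↔ ∃ hg : g ∈ L, ψ ⟨g, hg⟩ ∈ R)
    (hχ : ∀ (g : M) (l : L) (r : R), (l : G) = g → (r : H) = ψ l → χ g = φ r) :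
    Nonempty (Iso (pair M χ) ((pair R φ).comp (pair L ψ))) := by
  let d := basePoint R φ
  let e := basePoint L ψ
  refine pairIso (tmk (X := pair R φ) d e) ?_ ?_
  · rintro ⟨x, y⟩
    obtain ⟨k, h, rfl⟩ := pair_gen x
    obtain ⟨h', g, rfl⟩ := pair_gen y
    -- The middle element `h h'` of `k d h ⊗ h' e g` splits as `r ψ(l)`: the factor `r` passes to
    -- the left through `d` as `φ(r)`, and `ψ(l)` passes to the right through `e` as `l`.
    obtain ⟨r, l, hrl⟩ := hcos (h * h')
    refine ⟨k * φ r, l * g, ?_⟩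
    have hr : φ r • d = rmul d r := (basePoint_stab _ _).2 ⟨r.2, rfl⟩
    have hl : ψ l • e = rmul e l := (basePoint_stab _ _).2 ⟨l.2, rfl⟩
    change tmk (X := pair R φ) (k • rmul d h) (h' • rmul e g) =
      tmk (X := pair R φ) ((k * φ r) • d) (rmul e (l * g))
    have hd : (k * φ r) • d = rmul (k • d) r := by rw [mul_smul, hr, smul_rmul]
    have he : rmul e (l * g) = ψ l • rmul e g := by rw [← rmul_rmul, ← hl, smul_rmul]
    rw [hd, he, tmk_rmul, smul_smul, ← hrl, smul_rmul d k h, tmk_rmul, smul_smul]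
  · intro k g
    constructor
    · intro h
      have h' : tmk (X := pair R φ) (k • d) e = tmk (X := pair R φ) d (rmul e g) := h
      obtain ⟨h, h1, h2⟩ := Quotient.exact h'
      simp only at h1 h2
      obtain ⟨hr, hr'⟩ := (basePoint_stab _ _).1 h1
      obtain ⟨hl, hl'⟩ := (basePoint_stab _ _).1 h2.symm
      subst hl'
      have hg : g ∈ M := (hM g).2 ⟨hl, hr⟩
      exact ⟨hg, (hχ ⟨g, hg⟩ ⟨g, hl⟩ ⟨_, hr⟩ rfl rfl).trans hr'⟩
    · rintro ⟨hg, rfl⟩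
      obtain ⟨hl, hr⟩ := (hM g).1 hg
      have h1 : φ ⟨_, hr⟩ • d = rmul d (ψ ⟨g, hl⟩) := (basePoint_stab _ _).2 ⟨hr, rfl⟩
      have h2 : ψ ⟨g, hl⟩ • e = rmul e g := (basePoint_stab _ _).2 ⟨hl, rfl⟩
      change tmk (X := pair R φ) (χ ⟨g, hg⟩ • d) e = tmk (X := pair R φ) d (rmul e g)
      rw [hχ ⟨g, hg⟩ ⟨g, hl⟩ ⟨_, hr⟩ rfl rfl, h1, tmk_rmul, h2]

/-! #### Left orbits, and inflation of right `G`-sets -/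

/-- The right `G`-set `H \ X`. -/
def orb (X : Biset G H) : Biset G PUnit.{u + 1} where
  carrier := Quotient (MulAction.orbitRel H X.carrier)
  left := { smul := fun _ x => x, one_smul := fun _ => rfl, mul_smul := fun _ _ _ => rfl }
  right :=
    { smul := fun g => Quotient.map (fun x => g • x) (by
        rintro a b ⟨h, rfl⟩
        exact ⟨h, smul_comm h g b⟩)
      one_smul := by
        rintro ⟨a⟩
        exact congrArg (Quotient.mk _) (one_smul _ a)
      mul_smul := by
        rintro g h ⟨a⟩
        exact congrArg (Quotient.mk _) (mul_smul g h a) }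
  comm := @SMulCommClass.mk _ _ _ (_) (_) (fun _ _ _ => rfl)

/-- The class of `x` in `H \ X`. -/
abbrev omk {X : Biset G H} (x : X.carrier) : (orb X).carrier :=
  Quotient.mk (MulAction.orbitRel H X.carrier) x

theorem omk_smul {X : Biset G H} (h : H) (x : X.carrier) : omk (h • x) = omk x :=
  Quotient.sound ⟨h, rfl⟩

theorem isLeftFree_punit (X : Biset G PUnit.{u + 1}) : X.IsLeftFree := fun _ _ _ => rfl

theorem punit_smul {X : Biset G PUnit.{u + 1}} (h : PUnit.{u + 1}) (x : X.carrier) :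
    @HSMul.hSMul _ _ _ (@instHSMul _ _ X.left.toSMul) h x = x := X.left.one_smul x

def Iso.orb {X Y : Biset G H} (e : Iso X Y) : Iso X.orb Y.orb where
  toEquiv := Quotient.congr e.toEquiv (by
    intro a b
    refine exists_congr fun h => ?_
    change h • b = a ↔ h • e.toEquiv b = e.toEquiv a
    rw [← e.map_left, e.toEquiv.injective.eq_iff])
  map_left _ _ := rfl
  map_right := by
    rintro g ⟨x⟩
    exact congrArg (Quotient.mk _) (e.map_right g x)

def orbSum (X Y : Biset G H) : Iso (X.sum Y).orb (X.orb.sum Y.orb) where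
  toEquiv :=
    { toFun := Quotient.lift (fun a : X.carrier ⊕ Y.carrier =>
        Sum.elim (fun x => (Sum.inl (omk x) : X.orb.carrier ⊕ Y.orb.carrier))
          (fun x => Sum.inr (omk x)) a) (by
        rintro (a | a) (b | b) ⟨m, h⟩
        · exact congrArg Sum.inl (Quotient.sound ⟨m, Sum.inl_injective h⟩)
        · exact (Sum.inr_ne_inl h).elim
        · exact (Sum.inl_ne_inr h).elim
        · exact congrArg Sum.inr (Quotient.sound ⟨m, Sum.inr_injective h⟩))
      invFun := Sum.elim
        (Quotient.map Sum.inl (by rintro a b ⟨m, h⟩; exact ⟨m, congrArg Sum.inl h⟩))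
        (Quotient.map Sum.inr (by rintro a b ⟨m, h⟩; exact ⟨m, congrArg Sum.inr h⟩))
      left_inv := by rintro ⟨a | a⟩ <;> rfl
      right_inv := by
        rintro (a | a) <;> refine Quotient.inductionOn a fun b => rfl }
  map_left := by rintro k ⟨a | a⟩ <;> rfl
  map_right := by rintro k ⟨a | a⟩ <;> rfl

def orbComp (X : Biset H K) (Y : Biset G H) : Iso (X.comp Y).orb (X.orb.comp Y) where
  toEquiv :=
    { toFun := Quotient.lift (Quotient.map (fun a : X.carrier × Y.carrier => (omk a.1, a.2)) (by
          rintro ⟨x, y⟩ ⟨x', y'⟩ ⟨h, h1, h2⟩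
          exact ⟨h, congrArg omk h1, h2⟩)) (by
        rintro _ ⟨x, y⟩ ⟨k, rfl⟩
        exact congrArg (Quotient.mk (compSetoid X.orb Y)) (Prod.ext (omk_smul k x) rfl))
      invFun := Quotient.lift (fun a : X.orb.carrier × Y.carrier =>
        Quotient.lift (fun x => omk (tmk (X := X) x a.2)) (by
          rintro _ x ⟨k, rfl⟩
          exact omk_smul k (tmk (X := X) x a.2)) a.1) (by
        rintro ⟨⟨x⟩, y⟩ ⟨⟨x'⟩, y'⟩ ⟨h, h1, h2⟩
        simp only at h1 h2
        subst h2
        have h3 : omk x = omk (rmul x' h) := h1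
        obtain ⟨k, h4⟩ := Quotient.exact h3
        change k • rmul x' h = x at h4
        change omk (tmk (X := X) x y) = omk (tmk (X := X) x' (h • y))
        rw [← h4, ← tmk_rmul (X := X)]
        exact omk_smul k (tmk (X := X) (rmul x' h) y))
      left_inv := by rintro ⟨⟨x, y⟩⟩; rfl
      right_inv := by rintro ⟨⟨x⟩, y⟩; rfl }
  map_left := by rintro k ⟨⟨x, y⟩⟩; rfl
  map_right := by rintro k ⟨⟨x, y⟩⟩; rfl

/-- An element `g` fixes the orbit `H e` of the base point exactly when `e g ∈ H e`, that is, when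
`g ∈ L`. The values of `φ` are forgotten. -/
theorem orbPair [Finite G] [Finite H] (L : Subgroup G) (φ : L →* H) :
    Nonempty (Iso (pair L (1 : L →* PUnit.{u + 1})) (pair L φ).orb) := by
  refine pairIso (omk (basePoint L φ)) ?_ ?_
  · rintro ⟨y⟩
    obtain ⟨h, g, rfl⟩ := pair_gen y
    exact ⟨1, g, omk_smul _ (rmul (basePoint L φ) g)⟩
  · intro h g
    constructor
    · intro e
      have e' : omk (rmul (basePoint L φ) g) = omk (basePoint L φ) := e.symm
      obtain ⟨k, hk⟩ := Quotient.exact e'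
      obtain ⟨hg, -⟩ := (basePoint_stab _ _).1 hk
      exact ⟨hg, rfl⟩
    · rintro ⟨hg, -⟩
      change omk (basePoint L φ) = omk (rmul (basePoint L φ) g)
      rw [← (basePoint_stab (φ ⟨g, hg⟩) g).2 ⟨hg, rfl⟩, omk_smul]

/-- The biset `H × V` for a right `G`-set `V` and a homomorphism `f : G → H`. -/
def infl (f : G →* H) (V : Biset G PUnit.{u + 1}) [Finite H] : Biset G H where
  carrier := H × V.carrier
  left :=
    { smul := fun h a => (h * a.1, a.2)
      one_smul := fun _ => Prod.ext (one_mul _) rfl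
      mul_smul := fun _ _ _ => Prod.ext (mul_assoc _ _ _) rfl }
  right :=
    { smul := fun g a => (a.1 * f g.unop, g • a.2)
      one_smul := fun a => Prod.ext ((congrArg (a.1 * ·) (map_one f)).trans (mul_one _))
        (one_smul _ _)
      mul_smul := fun _ _ a => Prod.ext
        ((congrArg (a.1 * ·) (map_mul f _ _)).trans (mul_assoc _ _ _).symm) (mul_smul _ _ _) }
  comm := @SMulCommClass.mk _ _ _ (_) (_) (fun _ _ _ => Prod.ext (mul_assoc _ _ _).symm rfl)

theorem infl_isLeftFree [Finite H] (f : G →* H) (V : Biset G PUnit.{u + 1}) :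
    (infl f V).IsLeftFree := fun h a e => by
  have : h * a.1 = a.1 := congrArg Prod.fst e
  simpa using this

def Iso.infl [Finite H] (f : G →* H) {V W : Biset G PUnit.{u + 1}} (e : Iso V W) :
    Iso (infl f V) (infl f W) where
  toEquiv := Equiv.prodCongr (Equiv.refl H) e.toEquiv
  map_left _ _ := rfl
  map_right g a := Prod.ext rfl (e.map_right g a.2)

def inflSum [Finite H] (f : G →* H) (V W : Biset G PUnit.{u + 1}) :
    Iso (infl f (V.sum W)) ((infl f V).sum (infl f W)) where
  toEquiv := Equiv.prodSumDistrib H V.carrier W.carrier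
  map_left := by rintro h ⟨a, v | v⟩ <;> rfl
  map_right := by rintro h ⟨a, v | v⟩ <;> rfl

/-- For the base point `e` of the transitive `G`-set, `h (1, e) = (1, e) g` holds exactly when `g ∈
L` and `h = f(g)`. -/
theorem inflPair [Finite G] [Finite H] (f : G →* H) (L : Subgroup G) :
    Nonempty (Iso (pair L (f.comp L.subtype)) (infl f (pair L (1 : L →* PUnit.{u + 1})))) := by
  let e := basePoint L (1 : L →* PUnit.{u + 1})
  refine pairIso ((1, e) : H × _) ?_ ?_
  · rintro ⟨h, y⟩
    obtain ⟨k, g, rfl⟩ := pair_gen y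
    refine ⟨h * (f g)⁻¹, g, ?_⟩
    refine Prod.ext ?_ (punit_smul k (rmul e g))
    change h = h * (f g)⁻¹ * (1 * f g)
    simp
  · intro h g
    constructor
    · intro h1
      have h2 : h * 1 = 1 * f g := congrArg Prod.fst h1
      have h3 : e = rmul e g := congrArg Prod.snd h1
      obtain ⟨hg, -⟩ := (basePoint_stab (L := L) (φ := 1) (1 : PUnit.{u + 1}) g).1
        ((punit_smul 1 e).trans h3)
      exact ⟨hg, by simpa using h2.symm⟩
    · rintro ⟨hg, rfl⟩
      refine Prod.ext ?_ ?_
      · change f g * 1 = 1 * f g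
        simp
      · change e = rmul e g
        exact (punit_smul 1 e).symm.trans ((basePoint_stab _ _).2 ⟨hg, rfl⟩)

theorem resInfl [Finite H] (f : G →* K) (f' : K →* H) (V : Biset K PUnit.{u + 1}) :
    Nonempty (Iso (res f (infl f' V)) (infl (f'.comp f) (res f V))) :=
  ⟨⟨Equiv.refl _, fun _ _ => rfl, fun _ _ => rfl⟩⟩

/-! #### Restriction and opposites -/

def Iso.res (f : G →* H) {X Y : Biset H K} (e : Iso X Y) : Iso (X.res f) (Y.res f) :=
  ⟨e.toEquiv, e.map_left, fun g x => e.map_right (f g) x⟩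

def resSum (f : G →* H) (X Y : Biset H K) : Iso ((X.sum Y).res f) ((X.res f).sum (Y.res f)) where
  toEquiv := Equiv.refl _
  map_left _ _ := rfl
  map_right := by rintro h (v | v) <;> rfl

/-- The opposite biset. -/
def opp (X : Biset G H) : Biset H G where
  carrier := X.carrier
  left :=
    { smul := fun g x => rmul x g⁻¹
      one_smul := fun x => by
        change rmul x (1 : G)⁻¹ = x
        rw [inv_one, rmul_one]
      mul_smul := fun g g' x => by
        change rmul x (g * g')⁻¹ = rmul (rmul x g'⁻¹) g⁻¹
        rw [rmul_rmul, mul_inv_rev] }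
  right :=
    { smul := fun h x => h.unop⁻¹ • x
      one_smul := fun x => by
        change ((1 : Hᵐᵒᵖ).unop)⁻¹ • x = x
        simp
      mul_smul := fun h h' x => by
        change ((h * h').unop)⁻¹ • x = h.unop⁻¹ • h'.unop⁻¹ • x
        rw [smul_smul, MulOpposite.unop_mul, mul_inv_rev] }
  comm := @SMulCommClass.mk _ _ _ (_) (_) (fun g h x => (smul_rmul x _ _).symm)

def Iso.opp {X Y : Biset G H} (e : Iso X Y) : Iso X.opp Y.opp :=
  ⟨e.toEquiv, fun g x => e.map_right g⁻¹ x, fun h x => e.map_left h⁻¹ x⟩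

def oppSum (X Y : Biset G H) : Iso (X.sum Y).opp (X.opp.sum Y.opp) where
  toEquiv := Equiv.refl _
  map_left := by rintro h (v | v) <;> rfl
  map_right := by rintro h (v | v) <;> rfl

def oppOpp (X : Biset G H) : Iso X.opp.opp X where
  toEquiv := Equiv.refl _
  map_left := by
    intro h (x : X.carrier)
    change h⁻¹⁻¹ • x = h • x
    rw [inv_inv]
  map_right := by
    intro g (x : X.carrier)
    change rmul x g⁻¹⁻¹ = rmul x g
    rw [inv_inv]

def oppComp (X : Biset H K) (Y : Biset G H) : Iso (X.comp Y).opp (Y.opp.comp X.opp) where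
  toEquiv := Quotient.congr (Equiv.prodComm _ _) (by
    rintro ⟨x, y⟩ ⟨x', y'⟩
    refine exists_congr fun h => ?_
    change x = rmul x' h ∧ y' = h • y ↔ y = h⁻¹ • y' ∧ x' = rmul x h⁻¹
    constructor
    · rintro ⟨rfl, rfl⟩
      exact ⟨by simp, by rw [rmul_rmul, mul_inv_cancel, rmul_one]⟩
    · rintro ⟨rfl, rfl⟩
      exact ⟨by rw [rmul_rmul, inv_mul_cancel, rmul_one], by simp⟩)
  map_left := by rintro k ⟨x, y⟩; rfl
  map_right := by rintro k ⟨x, y⟩; rfl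

/-- The hypothesis says that the graphs of `φ` and `φ'` are transposes of each other. Taking
opposites exchanges the two sides of the stabilizer of the base point. -/
theorem oppPair [Finite G] [Finite H] {L : Subgroup G} {φ : L →* H} {L' : Subgroup H}
    {φ' : L' →* G}
    (h : ∀ g h, (∃ hg : g ∈ L, φ ⟨g, hg⟩ = h) ↔ ∃ hh : h ∈ L', φ' ⟨h, hh⟩ = g) :
    Nonempty (Iso (pair L' φ') (pair L φ).opp) := by
  let e := basePoint L φ
  refine pairIso (X := (pair L φ).opp) e ?_ ?_
  · intro y
    obtain ⟨h, g, rfl⟩ := pair_gen y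
    refine ⟨g⁻¹, h⁻¹, ?_⟩
    change h • rmul e g = rmul (h⁻¹⁻¹ • e) g⁻¹⁻¹
    rw [inv_inv, inv_inv, smul_rmul]
  · intro g k
    rw [← h, ← basePoint_stab]
    change rmul e g⁻¹ = k⁻¹ • e ↔ k • e = rmul e g
    constructor
    · intro h1
      have h2 := congrArg (fun z => k • rmul z g) h1
      rw [rmul_rmul, inv_mul_cancel, rmul_one, ← smul_rmul, smul_inv_smul] at h2
      exact h2
    · intro h1
      have h2 := congrArg (fun z => k⁻¹ • rmul z g⁻¹) h1
      rw [rmul_rmul, mul_inv_cancel, rmul_one, ← smul_rmul, inv_smul_smul] at h2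
      exact h2

/-! #### Deflation -/

/-- The stabilizer of the base point in the double quotient is the image of the graph of `φ`. The
hypotheses say that this image is again the graph of a homomorphism, which is what makes the double
quotient left-free. -/
theorem deflPair [Finite G] [Finite H] (N : Subgroup G) [N.Normal] (M : Subgroup H) [M.Normal]
    {L : Subgroup G} {φ : L →* H} {L' : Subgroup (G ⧸ N)} {φ' : L' →* H ⧸ M}
    (hL : ∀ x : L, ((x : G) : G ⧸ N) ∈ L')
    (hL' : ∀ y ∈ L', ∃ x : L, ((x : G) : G ⧸ N) = y)
    (hφ : ∀ (x : L) (y : L'), (y : G ⧸ N) = ((x : G) : G ⧸ N) → φ' y = (φ x : H ⧸ M)) :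
    Nonempty (Iso (pair L' φ') ((pair L φ).defl N M)) := by
  let e := basePoint L φ
  let q : (pair L φ).carrier → ((pair L φ).defl N M).carrier :=
    Quotient.mk (deflSetoid N M (pair L φ))
  have hmk : ∀ (h : H) (g : G) (x : (pair L φ).carrier),
    ((h : H ⧸ M) • rmul (q x) (g : G ⧸ N)) = q (h • rmul x g) := fun _ _ _ => rfl
  refine pairIso (q e) ?_ ?_
  · rintro ⟨y⟩
    obtain ⟨h, g, rfl⟩ := pair_gen y
    exact ⟨h, g, rfl⟩
  · rintro ⟨h⟩ ⟨g⟩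
    constructor
    · intro h1
      have h2 : q (h • e) = q (rmul e g) := h1
      obtain ⟨m, hm, n, hn, h3⟩ := Quotient.exact h2
      rw [← smul_rmul, smul_smul] at h3
      have h4 : (m * h) • e = rmul e (g * n⁻¹) := by
        rw [← rmul_rmul, h3, ← smul_rmul, rmul_rmul, mul_inv_cancel, rmul_one]
      obtain ⟨hk, hk'⟩ := (basePoint_stab _ _).1 h4
      have h5 : (g : G ⧸ N) = ((g * n⁻¹ : G) : G ⧸ N) :=
        QuotientGroup.eq.2 (by simpa using inv_mem hn)
      have h6 : (g : G ⧸ N) ∈ L' := h5 ▸ hL ⟨_, hk⟩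
      refine ⟨h6, (hφ ⟨_, hk⟩ ⟨_, h6⟩ h5).trans ?_⟩
      rw [hk']
      change ((m * h : H) : H ⧸ M) = (h : H ⧸ M)
      rw [QuotientGroup.mk_mul, (QuotientGroup.eq_one_iff _).2 hm, one_mul]
    · rintro ⟨hg, h1⟩
      obtain ⟨x, hx⟩ := hL' _ hg
      have h2 := hφ x ⟨_, hg⟩ hx.symm
      have h3 : (φ x : H ⧸ M) • q e = rmul (q e) ((x : G) : G ⧸ N) :=
        congrArg q ((basePoint_stab _ _).2 ⟨x.2, rfl⟩)
      rw [hx, ← h2, h1] at h3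
      exact h3

theorem oppDefl (N : Subgroup G) [N.Normal] (M : Subgroup H) [M.Normal] (X : Biset G H) :
    Nonempty (Iso (X.defl N M).opp (X.opp.defl M N)) := ⟨{
  toEquiv := Quotient.congr (Equiv.refl _) (by
    intro a b
    change (∃ m ∈ M, ∃ n ∈ N, b = m • rmul a n) ↔ ∃ n ∈ N, ∃ m ∈ M, b = rmul (m⁻¹ • a) n⁻¹
    constructor
    · rintro ⟨m, hm, n, hn, h⟩
      exact ⟨n⁻¹, inv_mem hn, m⁻¹, inv_mem hm, by rw [h, inv_inv, inv_inv, smul_rmul]⟩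
    · rintro ⟨n, hn, m, hm, h⟩
      exact ⟨m⁻¹, inv_mem hm, n⁻¹, inv_mem hn, by rw [h, smul_rmul]⟩)
  map_left := by
    rintro ⟨g⟩ ⟨x⟩
    rfl
  map_right := by
    rintro ⟨g⟩ ⟨x⟩
    rfl }⟩

/-- As `f` maps `N'` onto `N`, dividing the restricted biset by `M` and `N'` identifies the same
points as dividing `X` by `M` and `N`. The right actions agree because `f'` is `f` seen modulo `N'`
and `N`. -/
theorem deflRes (N : Subgroup H) [N.Normal] (M : Subgroup K) [M.Normal] (N' : Subgroup G)
    [N'.Normal] (f : G →* H) {J : Type u} [Group J] (e : J →* G ⧸ N') (f' : J →* H ⧸ N)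
    (hN : ∀ n ∈ N', f n ∈ N) (hN' : ∀ n ∈ N, ∃ n' ∈ N', f n' = n)
    (he : ∀ (j : J) (g : G), e j = g → f' j = f g) (X : Biset H K) :
    Nonempty (Iso (((X.res f).defl N' M).res e) ((X.defl N M).res f')) := ⟨{
  toEquiv := Quotient.congr (Equiv.refl _) (by
    intro a b
    change (∃ m ∈ M, ∃ n ∈ N', b = m • rmul (X := X) a (f n)) ↔
      ∃ m ∈ M, ∃ n ∈ N, b = m • rmul (X := X) a n
    constructor
    · rintro ⟨m, hm, n, hn, h⟩
      exact ⟨m, hm, f n, hN n hn, h⟩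
    · rintro ⟨m, hm, n, hn, h⟩
      obtain ⟨n', hn', rfl⟩ := hN' n hn
      exact ⟨m, hm, n', hn', h⟩)
  map_left := by
    rintro ⟨g⟩ ⟨x⟩
    rfl
  map_right := by
    rintro j ⟨x⟩
    obtain ⟨g, hg⟩ := QuotientGroup.mk_surjective (e j)
    let q : X.carrier → ((X.res f).defl N' M).carrier := Quotient.mk (deflSetoid N' M (X.res f))
    let q' : X.carrier → (X.defl N M).carrier := Quotient.mk (deflSetoid N M X)
    have h1 : rmul (X := ((X.res f).defl N' M).res e) (q x) j = q (rmul x (f g)) := by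
      rw [res_rmul, ← hg]
      rfl
    have h2 : rmul (X := (X.defl N M).res f') (q' x) j = q' (rmul x (f g)) := by
      rw [res_rmul, he j g hg.symm]
      rfl
    change Quotient.congr _ _ (rmul (X := ((X.res f).defl N' M).res e) (q x) j) =
      rmul (X := (X.defl N M).res f') (q' x) j
    rw [h1, h2]
    rfl }⟩

def freePartRes (f : G →* H) (X : Biset H K) : Iso (X.res f).freePart (X.freePart.res f) :=
  ⟨Equiv.refl _, fun _ _ => rfl, fun _ _ => rfl⟩

theorem isLeftFree_res (f : G →* H) {X : Biset H K} (hX : X.IsLeftFree) : (X.res f).IsLeftFree := hX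

/-! #### The number of left orbits of a transitive biset -/

theorem numOrbits_pair [Finite G] [Finite H] (L : Subgroup G) (φ : L →* H) :
    (pair L φ).numOrbits = L.index := by
  obtain ⟨e⟩ := orbPair L φ
  have h1 : (pair L φ).numOrbits = Nat.card (pair L φ).orb.carrier := rfl
  rw [h1, ← Nat.card_congr e.toEquiv, Subgroup.index,
    ← Nat.card_congr (QuotientGroup.quotientRightRelEquivQuotientLeftRel L)]
  refine Nat.card_congr (Quotient.congr (Equiv.punitProd G) ?_)
  rintro ⟨a, g⟩ ⟨b, h⟩
  change (∃ k : L, b = a * 1 ∧ g = k * h) ↔ (QuotientGroup.rightRel L) g h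
  rw [QuotientGroup.rightRel_apply]
  constructor
  · rintro ⟨k, -, rfl⟩
    simp
  · intro hk
    exact ⟨⟨h * g⁻¹, hk⟩⁻¹, rfl, by simp⟩

end Biset

/-! ### Decomposition of right `G`-sets into orbits -/

namespace Biset

variable {G H : Type u} [Group G] [Group H]

/-- The sub-biset on an invariant subset. -/
def sub (X : Biset G H) (s : Set X.carrier) (hl : ∀ (h : H), ∀ x ∈ s, h • x ∈ s)
    (hr : ∀ (g : G), ∀ x ∈ s, rmul x g ∈ s) : Biset G H where
  carrier := s
  left :=
    { smul := fun h x => ⟨h • x.1, hl h x.1 x.2⟩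
      one_smul := fun x => Subtype.ext (one_smul _ x.1)
      mul_smul := fun h k x => Subtype.ext (mul_smul h k x.1) }
  right :=
    { smul := fun g x => ⟨g • x.1, hr g.unop x.1 x.2⟩
      one_smul := fun x => Subtype.ext (one_smul _ x.1)
      mul_smul := fun h k x => Subtype.ext (mul_smul h k x.1) }
  comm := @SMulCommClass.mk _ _ _ (_) (_) (fun h g x => Subtype.ext (smul_comm h g x.1))

theorem sub_compl (X : Biset G H) (s : Set X.carrier) (hl : ∀ (h : H), ∀ x ∈ s, h • x ∈ s)
    (hr : ∀ (g : G), ∀ x ∈ s, rmul x g ∈ s) (hl' : ∀ (h : H), ∀ x ∈ sᶜ, h • x ∈ sᶜ)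
    (hr' : ∀ (g : G), ∀ x ∈ sᶜ, rmul x g ∈ sᶜ) :
    Nonempty (Iso ((X.sub s hl hr).sum (X.sub sᶜ hl' hr')) X) := by
  classical
  refine ⟨⟨Equiv.Set.sumCompl s, ?_, ?_⟩⟩
  · rintro h (x | x) <;> rfl
  · rintro h (x | x) <;> rfl

/-- The stabilizer of a point of a right `G`-set. -/
def rstab {V : Biset G PUnit.{u + 1}} (v : V.carrier) : Subgroup G where
  carrier := {g | rmul v g = v}
  one_mem' := rmul_one v
  mul_mem' {a b} (ha : rmul v a = v) (hb : rmul v b = v) := by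
    change rmul v (a * b) = v
    rw [← rmul_rmul, ha, hb]
  inv_mem' {a} (ha : rmul v a = v) := by
    change rmul v a⁻¹ = v
    conv_lhs => rw [← ha]
    rw [rmul_rmul, mul_inv_cancel, rmul_one]

/-- The orbit of `v` is split off from its complement. The strict drop in size drives the induction
in `span_pairClass_one`. -/
theorem exists_iso_orbit_sum [Finite G] (V : Biset G PUnit.{u + 1}) (v : V.carrier) :
    ∃ (L : Subgroup G) (W : Biset G PUnit.{u + 1}), Nat.card W.carrier < Nat.card V.carrier ∧
      Nonempty (Iso ((pair L (1 : L →* PUnit.{u + 1})).sum W) V) := by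
  let s : Set V.carrier := {y | ∃ g : G, y = rmul v g}
  have hr : ∀ (g : G), ∀ x ∈ s, rmul x g ∈ s := by
    rintro g _ ⟨h, rfl⟩
    exact ⟨h * g, rmul_rmul _ _ _⟩
  have hl (t : Set V.carrier) (h : PUnit.{u + 1}) (x) (hx : x ∈ t) :
      @HSMul.hSMul _ _ _ (@instHSMul _ _ V.left.toSMul) h x ∈ t := by rwa [punit_smul]
  have hr' : ∀ (g : G), ∀ x ∈ sᶜ, rmul x g ∈ sᶜ := by
    intro g x hx hx'
    have := hr g⁻¹ _ hx'
    rw [rmul_rmul, mul_inv_cancel, rmul_one] at this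
    exact hx this
  have hv : v ∈ s := ⟨1, (rmul_one v).symm⟩
  obtain ⟨e⟩ := sub_compl V s (hl _) hr (hl _) hr'
  obtain ⟨f⟩ : Nonempty (Iso (pair (rstab v) (1 : rstab v →* PUnit.{u + 1}))
      (V.sub s (hl _) hr)) := by
    refine pairIso (X := V.sub s (hl _) hr) (⟨v, hv⟩ : s) ?_ ?_
    · rintro ⟨_, g, rfl⟩
      exact ⟨1, g, Subtype.ext (punit_smul _ _).symm⟩
    · intro h g
      constructor
      · intro h1
        have h2 := (punit_smul h v).symm.trans (congrArg Subtype.val h1)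
        exact ⟨h2.symm, rfl⟩
      · rintro ⟨hg, -⟩
        exact Subtype.ext ((punit_smul h v).trans (Eq.symm hg))
  refine ⟨rstab v, V.sub sᶜ (hl _) hr', ?_, ⟨(f.sum (Iso.refl _)).trans e⟩⟩
  rw [← Nat.card_congr e.toEquiv]
  change Nat.card (sᶜ : Set V.carrier) < Nat.card (s ⊕ (sᶜ : Set V.carrier))
  rw [Nat.card_sum]
  have : 0 < Nat.card s := Nat.card_pos_iff.2 ⟨⟨⟨v, hv⟩⟩, inferInstance⟩
  omega

end Biset

/-! ### The functors -/

section Functors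

variable {G H K J : Type u} [Group G] [Group H] [Group K] [Group J]

variable (G H) in
def orbF : BisetFunctor G H G PUnit.{u + 1} where
  obj := Biset.orb
  iso e := ⟨e.orb⟩
  sum X Y := ⟨Biset.orbSum X Y⟩
  free _ := Biset.isLeftFree_punit _

def inflF [Finite H] (f : G →* H) : BisetFunctor G PUnit.{u + 1} G H where
  obj V := Biset.infl f V
  iso e := ⟨e.infl f⟩
  sum X Y := ⟨Biset.inflSum f X Y⟩
  free _ := Biset.infl_isLeftFree f _

def resF (K : Type u) [Group K] (f : G →* H) : BisetFunctor H K G K where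
  obj X := X.res f
  iso e := ⟨e.res f⟩
  sum X Y := ⟨Biset.resSum f X Y⟩
  free hX := Biset.isLeftFree_res f hX

/-- A double quotient of a left-free biset need not be left-free. Taking free parts is additive, so
the target can be kept among left-free bisets, and nothing is lost whenever the double quotient is
already left-free. -/
def deflF (N : Subgroup G) [N.Normal] (M : Subgroup H) [M.Normal] :
    BisetFunctor G H (G ⧸ N) (H ⧸ M) where
  obj X := (X.defl N M).freePart
  iso e := (Biset.Iso.deflCongr N M e).map Biset.Iso.freePart
  sum X Y := (Biset.defl_sum N M X Y).map fun e => e.freePart.trans (Biset.freePartSum _ _)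
  free _ := Biset.freePart_isLeftFree _

variable (G H) in
def oppF : BisetFunctor G H H G where
  obj X := X.opp.freePart
  iso e := ⟨e.opp.freePart⟩
  sum X Y := ⟨(Biset.oppSum X Y).freePart.trans (Biset.freePartSum _ _)⟩
  free _ := Biset.freePart_isLeftFree _

variable {p : ℕ} [hp : Fact p.Prime]

/-! ### Composition, restriction, orbits and augmentation on classes -/

theorem comp_assoc (x : LocBurnside p K J) (y : LocBurnside p H K) (z : LocBurnside p G H) :
    comp p (comp p x y) z = comp p x (comp p y z) := by
  induction x using locBurnside_induction with
  | add x x' h h' => simp only [map_add, LinearMap.add_apply, h, h']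
  | smul c x h => simp only [comp_smul_left, h]
  | cls X hX =>
    induction y using locBurnside_induction with
    | add x x' h h' => simp only [map_add, LinearMap.add_apply, h, h']
    | smul c x h => simp only [comp_smul_left, comp_smul_right, h]
    | cls Y hY =>
      induction z using locBurnside_induction with
      | add x x' h h' => simp only [map_add, h, h']
      | smul c x h => simp only [comp_smul_right, h]
      | cls Z hZ =>
        simp only [comp_locClass]
        exact locClass_congr (Biset.compAssoc X Y Z) _ _

theorem comp_homClass [Finite G] [Finite H] (x : LocBurnside p H K) (f : G →* H) :
    comp p x (homClass p f) = (resF K f).map p x := by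
  induction x using locBurnside_induction with
  | add x x' h h' => simp only [map_add, LinearMap.add_apply, h, h']
  | smul c x h => simp only [comp_smul_left, map_smul, h]
  | cls X hX =>
    obtain ⟨e⟩ := Biset.compPairTop f X
    rw [homClass, pairClass_eq, comp_locClass, BisetFunctor.map_locClass]
    exact locClass_congr e _ _

theorem comp_homClass_id [Finite G] (x : LocBurnside p G K) :
    comp p x (homClass p (MonoidHom.id G)) = x := by
  rw [comp_homClass]
  induction x using locBurnside_induction with
  | add x x' h h' => simp only [map_add, h, h']
  | smul c x h => simp only [map_smul, h]
  | cls X hX =>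
    rw [BisetFunctor.map_locClass]
    exact locClass_congr (Biset.resId X) _ _

theorem orb_comp (x : LocBurnside p H K) (y : LocBurnside p G H) :
    (orbF G K).map p (comp p x y) = comp p ((orbF H K).map p x) y := by
  induction x using locBurnside_induction with
  | add x x' h h' => simp only [map_add, LinearMap.add_apply, h, h']
  | smul c x h => simp only [comp_smul_left, map_smul, h]
  | cls X hX =>
    induction y using locBurnside_induction with
    | add x x' h h' => simp only [map_add, h, h']
    | smul c x h => simp only [comp_smul_right, map_smul, h]
    | cls Y hY =>
      simp only [comp_locClass, BisetFunctor.map_locClass]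
      exact locClass_congr (Biset.orbComp X Y) _ _

theorem orb_pairClass [Finite G] [Finite H] (L : Subgroup G) (φ : L →* H) :
    (orbF G H).map p (pairClass p L φ) = pairClass p L (1 : L →* PUnit.{u + 1}) := by
  obtain ⟨e⟩ := Biset.orbPair L φ
  rw [pairClass_eq, BisetFunctor.map_locClass, pairClass_eq]
  exact locClass_congr e.symm _ _

theorem infl_pairClass [Finite G] [Finite H] (f : G →* H) (L : Subgroup G) :
    (inflF f).map p (pairClass p L (1 : L →* PUnit.{u + 1})) =
      pairClass p L (f.comp L.subtype) := by
  obtain ⟨e⟩ := Biset.inflPair f L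
  rw [pairClass_eq, BisetFunctor.map_locClass, pairClass_eq]
  exact locClass_congr e.symm _ _

theorem res_infl [Finite H] (f : G →* K) (f' : K →* H) (z : LocBurnside p K PUnit.{u + 1}) :
    (resF H f).map p ((inflF f').map p z) = (inflF (f'.comp f)).map p ((resF PUnit f).map p z) := by
  induction z using locBurnside_induction with
  | add x x' h h' => simp only [map_add, h, h']
  | smul c x h => simp only [map_smul, h]
  | cls V hV =>
    obtain ⟨e⟩ := Biset.resInfl f f' V
    simp only [BisetFunctor.map_locClass]
    exact locClass_congr e _ _

theorem aug_pairClass [Finite G] [Finite H] (L : Subgroup G) (φ : L →* H) :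
    aug p (pairClass p L φ) = (L.index : ZLoc p) := by
  rw [pairClass_eq, aug_locClass, Biset.numOrbits_pair]

theorem aug_res (f : G →* H) (z : LocBurnside p H K) :
    aug p ((resF K f).map p z) = aug p z := by
  induction z using locBurnside_induction with
  | add x x' h h' => simp only [map_add, h, h']
  | smul c x h => simp only [map_smul, h]
  | cls V hV =>
    rw [BisetFunctor.map_locClass, aug_locClass, aug_locClass]
    rfl

/-- This factorization separates the morphism `φ` from the restriction to its domain `L`. Right
stability acts on the first factor only. -/
theorem homClass_comp_pairClass [Finite G] [Finite H] (L : Subgroup G) (φ : L →* H) :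
    comp p (homClass p φ) (pairClass p L (MonoidHom.id L)) = pairClass p L φ := by
  obtain ⟨e⟩ := Biset.compPair (R := (⊤ : Subgroup L)) (φ := φ.comp (⊤ : Subgroup L).subtype)
    (L := L) (ψ := MonoidHom.id L) (M := L) (χ := φ) (fun h => ⟨1, h, by simp⟩) (by simp) (by
      intro g l r h1 h2
      have h3 : (r : L) = g := h2.trans (Subtype.ext h1)
      exact congrArg φ h3.symm)
  rw [homClass, pairClass_eq, pairClass_eq, pairClass_eq, comp_locClass]
  exact locClass_congr e.symm _ _

theorem pairClass_comp_pairClass_id [Finite G] [Finite H] (f : G →* H) (L : Subgroup G)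
    (R : Subgroup L) :
    comp p (pairClass p R ((f.comp L.subtype).comp R.subtype)) (pairClass p L (MonoidHom.id L)) =
      pairClass p (R.map L.subtype) (f.comp (R.map L.subtype).subtype) := by
  obtain ⟨e⟩ := Biset.compPair (R := R) (φ := (f.comp L.subtype).comp R.subtype)
    (L := L) (ψ := MonoidHom.id L) (M := R.map L.subtype)
    (χ := f.comp (R.map L.subtype).subtype) (fun h => ⟨1, h, by simp⟩) (by simp) (by
      intro g l r h1 h2
      have h3 : ((r : L) : G) = g := (congrArg Subtype.val h2).trans h1
      exact congrArg f h3.symm)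
  rw [pairClass_eq, pairClass_eq, pairClass_eq, comp_locClass]
  exact locClass_congr e.symm _ _

/-- `A(G, 1)` is spanned by the classes of the transitive right `G`-sets. -/
theorem span_pairClass_one [Finite G] :
    Submodule.span (ZLoc p) (Set.range fun L : Subgroup G =>
      pairClass p L (1 : L →* PUnit.{u + 1})) = ⊤ := by
  refine eq_top_iff.2 fun z _ => locBurnside_mem (fun V hV => ?_) z
  induction h : Nat.card V.carrier using Nat.strong_induction_on generalizing V with
  | _ n ih =>
    rcases isEmpty_or_nonempty V.carrier with hE | ⟨⟨v⟩⟩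
    -- For empty `V`, `V ⊔ V ≅ V`, so the class `x` of `V` satisfies `x + x = x` and vanishes.
    · have e : Biset.Iso (V.sum V) V :=
        ⟨Equiv.emptySum _ _, fun _ x => x.elim hE.elim hE.elim,
          fun _ x => x.elim hE.elim hE.elim⟩
      have h1 := (locClass_sum (p := p) hV hV).symm.trans (locClass_congr e _ hV)
      rw [add_eq_left.1 h1]
      exact zero_mem _
    · obtain ⟨L, W, hW, ⟨e⟩⟩ := Biset.exists_iso_orbit_sum V v
      rw [← locClass_congr (p := p) e
        ((Biset.pair_isLeftFree _ _).sum (Biset.isLeftFree_punit W)) hV,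
        locClass_sum (Biset.pair_isLeftFree _ _) (Biset.isLeftFree_punit W)]
      exact add_mem (Submodule.subset_span ⟨L, rfl⟩)
        (ih _ (h ▸ hW) W (Biset.isLeftFree_punit W) rfl)

end Functors

/-! ### The ring `ℤ_(p)` -/

section ZLocal

variable {p : ℕ} [hp : Fact p.Prime]

theorem isUnit_zloc {x : ZLoc p} (hx : ¬ (p : ZLoc p) ∣ x) : IsUnit x := by
  obtain ⟨q, hq⟩ := x
  have hq' : ¬ p ∣ q.den := hq
  have hnum : ¬ (p : ℤ) ∣ q.num := by
    rintro ⟨c, hc⟩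
    refine hx ⟨⟨Rat.divInt c q.den, fun h => hq' (h.trans ?_)⟩, Subtype.ext ?_⟩
    · have := Rat.den_dvd c q.den
      exact_mod_cast this
    · change q = ((p : ZLoc p) : ℚ) * Rat.divInt c q.den
      have h1 : ((p : ZLoc p) : ℚ) = (p : ℚ) := by simp
      rw [h1, Rat.divInt_eq_div]
      conv_lhs => rw [← Rat.num_div_den q, hc]
      push_cast
      ring
  have hq0 : q ≠ 0 := by
    rintro rfl
    simp at hnum
  have hinv : ¬ p ∣ q⁻¹.den := by
    rw [Rat.inv_def, Rat.divInt_eq_div]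
    intro h
    have h2 : ((((q.den : ℤ) : ℚ) / (q.num : ℚ)).den : ℤ) ∣ q.num := by
      rw [← Rat.divInt_eq_div]
      exact Rat.den_dvd _ _
    exact hnum ((Int.natCast_dvd_natCast.2 h).trans h2)
  refine IsUnit.of_mul_eq_one ⟨q⁻¹, hinv⟩ (Subtype.ext ?_)
  exact mul_inv_cancel₀ hq0

theorem not_dvd_one_zloc : ¬ (p : ZLoc p) ∣ 1 := by
  rintro ⟨⟨q, hq⟩, h⟩
  have h1 : (1 : ℚ) = p * q := by
    have := congrArg Subtype.val h
    simpa using this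
  have hp0 : (p : ℚ) ≠ 0 := by exact_mod_cast hp.out.ne_zero
  have h2 : q = (p : ℚ)⁻¹ := by field_simp; linarith
  subst h2
  refine hq ?_
  rw [Rat.inv_natCast_den_of_pos hp.out.pos]

/-- No `p y + 1` is divisible by `p`, so each is a unit. This is the condition for Nakayama's lemma
in `eq_one_of_idempotent`. -/
theorem span_p_le_jacobson : Ideal.span {(p : ZLoc p)} ≤ Ideal.jacobson ⊥ := by
  rw [Ideal.span_singleton_le_iff_mem, Ideal.mem_jacobson_bot]
  intro y
  refine isUnit_zloc fun h => not_dvd_one_zloc (p := p) ?_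
  exact (dvd_add_right (Dvd.intro y rfl)).1 h

theorem dvd_one_sub_of_idempotent_mod {x y : ZLoc p} (h : x * x - x = p * y) (hx : ¬ (p : ZLoc p) ∣ x) :
    (p : ZLoc p) ∣ 1 - x := by
  have h1 : (p : ZLoc p) ∣ x * (1 - x) := ⟨-y, by linear_combination -h⟩
  exact (isUnit_zloc hx).dvd_mul_left.1 h1

end ZLocal

/-! ### The image of the Burnside ring of `S` in `A(S, S)` -/

section BurnsideRing

open scoped Pointwise

variable {p : ℕ} [hp : Fact p.Prime] {S : Type u} [Group S] [Finite S]

variable (p) in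
/-- The class `[L, incl]_S^S`. -/
def inclClass (L : Subgroup S) : LocBurnside p S S := pairClass p L L.subtype

variable (p S) in
/-- The span of the classes `[L, incl]_S^S`: a copy of the Burnside ring of `S`. -/
def inclSpan : Submodule (ZLoc p) (LocBurnside p S S) :=
  Submodule.span (ZLoc p) (Set.range (inclClass p))

variable (p S) in
/-- The map `[L, φ] ↦ [L, incl]`. -/
def toIncl : LocBurnside p S S →ₗ[ZLoc p] LocBurnside p S S :=
  (inflF (MonoidHom.id S)).map p ∘ₗ (orbF S S).map p

theorem inclClass_mem (L : Subgroup S) : inclClass p L ∈ inclSpan p S :=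
  Submodule.subset_span ⟨L, rfl⟩

theorem homClass_id_eq : homClass p (MonoidHom.id S) = inclClass p ⊤ := rfl

theorem infl_id_pairClass (L : Subgroup S) :
    (inflF (MonoidHom.id S)).map p (pairClass p L (1 : L →* PUnit.{u + 1})) = inclClass p L :=
  infl_pairClass _ _

theorem hom_ext_punit {M : Type*} [AddCommGroup M] [Module (ZLoc p) M]
    {f g : LocBurnside p S PUnit.{u + 1} →ₗ[ZLoc p] M}
    (h : ∀ L : Subgroup S, f (pairClass p L 1) = g (pairClass p L 1)) : f = g :=
  LinearMap.ext_on_range span_pairClass_one h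

theorem mem_of_pairClass_punit {M : Type*} [AddCommGroup M] [Module (ZLoc p) M]
    {N : Submodule (ZLoc p) M} (f : LocBurnside p S PUnit.{u + 1} →ₗ[ZLoc p] M)
    (h : ∀ L : Subgroup S, f (pairClass p L 1) ∈ N) (z) : f z ∈ N := by
  have h1 : N.mkQ ∘ₗ f = 0 := hom_ext_punit fun L => by simpa using h L
  have h2 := LinearMap.congr_fun h1 z
  simpa using h2

theorem infl_mem (z : LocBurnside p S PUnit.{u + 1}) :
    (inflF (MonoidHom.id S)).map p z ∈ inclSpan p S :=
  mem_of_pairClass_punit ((inflF (MonoidHom.id S)).map p)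
    (fun L => by rw [infl_id_pairClass]; exact inclClass_mem L) z

theorem toIncl_mem (x : LocBurnside p S S) : toIncl p S x ∈ inclSpan p S := infl_mem _

theorem toIncl_pairClass (L : Subgroup S) (φ : L →* S) :
    toIncl p S (pairClass p L φ) = inclClass p L := by
  rw [toIncl, LinearMap.comp_apply, orb_pairClass, infl_id_pairClass]

theorem toIncl_of_mem {x : LocBurnside p S S} (hx : x ∈ inclSpan p S) : toIncl p S x = x := by
  refine LinearMap.eqOn_span (f := toIncl p S) (g := LinearMap.id) ?_ hx
  rintro _ ⟨L, rfl⟩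
  exact toIncl_pairClass L _

theorem aug_infl (z : LocBurnside p S PUnit.{u + 1}) :
    aug p ((inflF (MonoidHom.id S)).map p z) = aug p z := by
  refine LinearMap.congr_fun (f := aug p ∘ₗ (inflF (MonoidHom.id S)).map p) (g := aug p)
    (hom_ext_punit fun L => ?_) z
  rw [LinearMap.comp_apply, infl_id_pairClass, inclClass, aug_pairClass, aug_pairClass]

/-- Induction from `P` to `S`. -/
def indIncl (P : Subgroup S) : LocBurnside p P PUnit.{u + 1} →ₗ[ZLoc p] LocBurnside p S S :=
  compL.flip (pairClass p P (MonoidHom.id P)) ∘ₗ (inflF P.subtype).map p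

theorem indIncl_apply (P : Subgroup S) (w : LocBurnside p P PUnit.{u + 1}) :
    indIncl P w = comp p ((inflF P.subtype).map p w) (pairClass p P (MonoidHom.id P)) := rfl

theorem indIncl_pairClass (P : Subgroup S) (R : Subgroup P) :
    indIncl P (pairClass p R 1) = inclClass p (R.map P.subtype) := by
  rw [indIncl_apply, infl_pairClass]
  exact pairClass_comp_pairClass_id (MonoidHom.id S) P R

/-- Factor `[P, incl]_S^S` through `P`. Composing with the first factor restricts the right `S`-set
`z` to `P`, and the second induces back to `S`: multiplying by the class of `P\S` in the Burnside
ring is restriction followed by induction. -/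
theorem comp_inclClass (z : LocBurnside p S PUnit.{u + 1}) (P : Subgroup S) :
    comp p ((inflF (MonoidHom.id S)).map p z) (inclClass p P) =
      indIncl P ((resF PUnit.{u + 1} P.subtype).map p z) := by
  rw [inclClass, ← homClass_comp_pairClass, ← comp_assoc, comp_homClass, res_infl, indIncl_apply]
  rfl

theorem indIncl_mem (P : Subgroup S) (w : LocBurnside p P PUnit.{u + 1}) :
    indIncl P w ∈ inclSpan p S :=
  mem_of_pairClass_punit _ (fun R => by rw [indIncl_pairClass]; exact inclClass_mem _) w

theorem aug_indIncl (P : Subgroup S) (w : LocBurnside p P PUnit.{u + 1}) :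
    aug p (indIncl P w) = aug p w * (P.index : ZLoc p) := by
  refine LinearMap.congr_fun (f := aug p ∘ₗ indIncl P)
    (g := LinearMap.mulRight (ZLoc p) (P.index : ZLoc p) ∘ₗ aug p)
    (hom_ext_punit fun R => ?_) w
  rw [LinearMap.comp_apply, LinearMap.comp_apply, indIncl_pairClass, inclClass, aug_pairClass,
    aug_pairClass, Subgroup.index_map_subtype, LinearMap.mulRight_apply, Nat.cast_mul]

theorem comp_mem_inclSpan {x y : LocBurnside p S S} (hx : x ∈ inclSpan p S)
    (hy : y ∈ inclSpan p S) :
    comp p x y ∈ inclSpan p S := by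
  rw [← toIncl_of_mem hx]
  refine (Submodule.span_le (p := (inclSpan p S).comap (compL (toIncl p S x)))).2 ?_ hy
  rintro _ ⟨P, rfl⟩
  change comp p ((inflF (MonoidHom.id S)).map p _) (inclClass p P) ∈ inclSpan p S
  rw [comp_inclClass]
  exact indIncl_mem _ _

/-- Against `[P, incl]`, restriction to `P` keeps the augmentation and induction multiplies it by
`|S : P| = ε([P, incl])`. -/
theorem aug_comp {x y : LocBurnside p S S} (hx : x ∈ inclSpan p S) (hy : y ∈ inclSpan p S) :
    aug p (comp p x y) = aug p x * aug p y := by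
  rw [← toIncl_of_mem hx]
  refine LinearMap.eqOn_span (f := aug p ∘ₗ compL (toIncl p S x))
    (g := LinearMap.mulLeft (ZLoc p) (aug p (toIncl p S x)) ∘ₗ aug p) ?_ hy
  rintro _ ⟨P, rfl⟩
  change aug p (comp p ((inflF (MonoidHom.id S)).map p _) (inclClass p P)) =
    aug p ((inflF (MonoidHom.id S)).map p _) * _
  rw [comp_inclClass, aug_indIncl, aug_res, aug_infl, inclClass, aug_pairClass]

theorem homClass_id_comp_pairClass (L : Subgroup S) (φ : L →* S) :
    comp p (homClass p (MonoidHom.id S)) (pairClass p L φ) = pairClass p L φ := by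
  obtain ⟨e⟩ := Biset.compPair (R := (⊤ : Subgroup S))
    (φ := (MonoidHom.id S).comp (⊤ : Subgroup S).subtype)
    (L := L) (ψ := φ) (M := L) (χ := φ) (fun h => ⟨⟨h, trivial⟩, 1, by simp⟩) (by simp) (by
      intro g l r h1 h2
      have h3 : l = g := Subtype.ext h1
      subst h3
      exact h2.symm)
  rw [homClass, pairClass_eq, pairClass_eq, comp_locClass]
  exact locClass_congr e.symm _ _

theorem homClass_id_comp {x : LocBurnside p S S} (hx : x ∈ inclSpan p S) :
    comp p (homClass p (MonoidHom.id S)) x = x := by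
  refine LinearMap.eqOn_span (f := compL (homClass p (MonoidHom.id S))) (g := LinearMap.id) ?_ hx
  rintro _ ⟨P, rfl⟩
  exact homClass_id_comp_pairClass _ _

/-- The span of the `[L, incl]_S^S` with `|L| < k`, together with `p` times everything. -/
def inclFilt (p : ℕ) [Fact p.Prime] (S : Type u) [Group S] [Finite S] (k : ℕ) :
    Submodule (ZLoc p) (LocBurnside p S S) :=
  Submodule.span (ZLoc p) {x | ∃ L : Subgroup S, Nat.card L < k ∧ x = inclClass p L} ⊔
    (p : ZLoc p) • inclSpan p S

theorem inclFilt_mono {k l : ℕ} (h : k ≤ l) : inclFilt p S k ≤ inclFilt p S l := by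
  refine sup_le_sup_right (Submodule.span_mono ?_) _
  rintro _ ⟨L, hL, e⟩
  exact ⟨L, hL.trans_le h, e⟩

theorem p_smul_mem_inclFilt {x : LocBurnside p S S} (hx : x ∈ inclSpan p S) (k : ℕ) :
    (p : ZLoc p) • x ∈ inclFilt p S k :=
  Submodule.mem_sup_right (Submodule.smul_mem_pointwise_smul _ _ _ hx)

/-- It suffices to treat transitive `P`-sets `R\P`. For `R = P` the difference is zero. For proper
`R` the induced class belongs to a smaller subgroup, and the augmentation `|P : R|` is a positive
power of `p`. -/
theorem indIncl_sub_mem (hS : IsPGroup p S) (P : Subgroup S)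
    (w : LocBurnside p P PUnit.{u + 1}) :
    indIncl P w - aug p w • inclClass p P ∈ inclFilt p S (Nat.card P) := by
  refine mem_of_pairClass_punit (indIncl P - (aug p).smulRight (inclClass p P)) (fun R => ?_) w
  rw [LinearMap.sub_apply, LinearMap.smulRight_apply, indIncl_pairClass, aug_pairClass]
  by_cases hR : R = ⊤
  · subst hR
    rw [← MonoidHom.range_eq_map, Subgroup.range_subtype, Subgroup.index_top, Nat.cast_one,
      one_smul, sub_self]
    exact zero_mem _
  · refine sub_mem (Submodule.mem_sup_left (Submodule.subset_span ⟨_, ?_, rfl⟩)) ?_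
    · rw [Subgroup.card_subtype]
      refine lt_of_le_of_ne (Subgroup.card_le_card_group R) fun h => hR ?_
      exact Subgroup.eq_top_of_card_eq R h
    · obtain ⟨n, hn⟩ := (hS.to_subgroup P).index R
      have hn0 : n ≠ 0 := by
        rintro rfl
        exact hR (Subgroup.index_eq_one.1 hn)
      obtain ⟨m, rfl⟩ := Nat.exists_eq_succ_of_ne_zero hn0
      rw [hn, pow_succ', Nat.cast_mul, mul_smul]
      exact p_smul_mem_inclFilt (Submodule.smul_mem _ _ (inclClass_mem P)) _

/-- Restricting `b` to `P` and inducing back gives `b ∘ [P, incl] ≡ ε(b) [P, incl]` modulo the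
filtration step `|P|`. Since `p ∣ ε(b)`, the leading term is absorbed as well. -/
theorem comp_mem_inclFilt (hS : IsPGroup p S) {b : LocBurnside p S S} (hb : b ∈ inclSpan p S)
    (hp : (p : ZLoc p) ∣ aug p b) {k : ℕ} {x : LocBurnside p S S} (hx : x ∈ inclFilt p S (k + 1)) :
    comp p b x ∈ inclFilt p S k := by
  suffices h : inclFilt p S (k + 1) ≤ (inclFilt p S k).comap (compL b) from h hx
  refine sup_le (Submodule.span_le.2 ?_) ?_
  · rintro _ ⟨P, hP, rfl⟩
    refine inclFilt_mono (Nat.lt_succ_iff.1 hP) ?_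
    obtain ⟨c, hc⟩ := hp
    have h1 := indIncl_sub_mem hS P ((resF PUnit.{u + 1} P.subtype).map p ((orbF S S).map p b))
    rw [← comp_inclClass, aug_res, ← aug_infl ((orbF S S).map p b)] at h1
    change comp p (toIncl p S b) _ - aug p (toIncl p S b) • _ ∈ _ at h1
    rw [toIncl_of_mem hb, hc, mul_smul] at h1
    exact (Submodule.sub_mem_iff_left _
      (p_smul_mem_inclFilt (Submodule.smul_mem _ _ (inclClass_mem P)) _)).1 h1
  · intro y hy
    obtain ⟨j, hj, rfl⟩ := (Submodule.mem_smul_pointwise_iff_exists _ _ _).1 hy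
    change comp p b ((p : ZLoc p) • j) ∈ inclFilt p S k
    rw [comp_smul_right]
    exact p_smul_mem_inclFilt (comp_mem_inclSpan hb hj) _

/-- Each multiplication by `b` lowers the filtration by one. It starts at `|S| + 1`, which allows
every subgroup, and at `0` only the multiples of `p` remain. -/
theorem exists_iterate_mem (hS : IsPGroup p S) {b : LocBurnside p S S} (hb : b ∈ inclSpan p S)
    (hp : (p : ZLoc p) ∣ aug p b) :
    ∃ (n : ℕ), ∃ y ∈ inclSpan p S, (fun x => comp p b x)^[n] b = (p : ZLoc p) • y := by
  have h1 : ∀ (n k : ℕ) (x), x ∈ inclFilt p S (n + k) →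
      (fun x => comp p b x)^[n] x ∈ inclFilt p S k := by
    intro n
    induction n with
    | zero =>
      intro k x hx
      simpa using hx
    | succ n ih =>
      intro k x hx
      rw [Function.iterate_succ_apply]
      refine ih k _ (comp_mem_inclFilt hS hb hp ?_)
      convert hx using 2
      omega
  have h2 : b ∈ inclFilt p S (Nat.card S + 1 + 0) := by
    refine Submodule.mem_sup_left (Submodule.span_mono ?_ hb)
    rintro _ ⟨L, rfl⟩
    exact ⟨L, Nat.lt_succ_of_le (Subgroup.card_le_card_group L), rfl⟩
  have h3 := h1 _ _ _ h2
  have h4 : {x | ∃ L : Subgroup S, Nat.card L < 0 ∧ x = inclClass p L} = ∅ := by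
    ext x
    simp
  rw [inclFilt, h4, Submodule.span_empty, bot_sup_eq] at h3
  obtain ⟨y, hy, e⟩ := (Submodule.mem_smul_pointwise_iff_exists _ _ _).1 h3
  exact ⟨_, y, hy, e.symm⟩

/-! ### Idempotents of the Burnside ring with augmentation prime to `p` -/

theorem one_sub_comp_one_sub {a : LocBurnside p S S} (ha : a ∈ inclSpan p S) :
    comp p (homClass p (MonoidHom.id S) - a) (homClass p (MonoidHom.id S) - a) -
      (homClass p (MonoidHom.id S) - a) = comp p a a - a := by
  simp only [map_sub, LinearMap.sub_apply, comp_homClass_id, homClass_id_comp ha]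
  abel

theorem aug_one : aug p (homClass p (MonoidHom.id S)) = 1 := by
  rw [homClass, aug_pairClass, Subgroup.index_top, Nat.cast_one]

theorem dvd_aug_one_sub {a : LocBurnside p S S} (ha : a ∈ inclSpan p S)
    (hp : ¬ (p : ZLoc p) ∣ aug p a) {w : LocBurnside p S S}
    (hw : comp p a a - a = (p : ZLoc p) • w) :
    (p : ZLoc p) ∣ aug p (homClass p (MonoidHom.id S) - a) := by
  have h1 := congrArg (aug p) hw
  rw [map_sub, aug_comp ha ha, map_smul] at h1
  rw [map_sub, aug_one]
  exact dvd_one_sub_of_idempotent_mod h1 hp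

/-- The element `b = 1 - a` is again idempotent mod `p`, so all its powers are congruent to `b`.
Since `p ∣ ε(b)`, one of these powers is a multiple of `p`. -/
theorem eq_one_add_of_idempotent_mod (hS : IsPGroup p S) {a : LocBurnside p S S}
    (ha : a ∈ inclSpan p S) (hp : ¬ (p : ZLoc p) ∣ aug p a) {w : LocBurnside p S S}
    (hw : comp p a a - a = (p : ZLoc p) • w) :
    ∃ y, a = homClass p (MonoidHom.id S) + (p : ZLoc p) • y := by
  have hb : homClass p (MonoidHom.id S) - a ∈ inclSpan p S := sub_mem (inclClass_mem _) ha
  have hbb := one_sub_comp_one_sub ha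
  have hd := dvd_aug_one_sub ha hp hw
  rw [hw] at hbb
  set b := homClass p (MonoidHom.id S) - a with hbdef
  obtain ⟨n, y, -, hy⟩ := exists_iterate_mem hS hb hd
  have h1 : ∀ n, ∃ z, (fun x => comp p b x)^[n] b = b + (p : ZLoc p) • z := by
    intro n
    induction n with
    | zero => exact ⟨0, by simp⟩
    | succ n ih =>
      obtain ⟨z, hz⟩ := ih
      refine ⟨w + comp p b z, ?_⟩
      rw [Function.iterate_succ_apply', hz]
      rw [map_add, comp_smul_right, sub_eq_iff_eq_add.1 hbb, smul_add]
      abel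
  obtain ⟨z, hz⟩ := h1 n
  refine ⟨z - y, ?_⟩
  have h2 : b = (p : ZLoc p) • y - (p : ZLoc p) • z := by rw [← hy, hz]; abel
  have h3 : a = homClass p (MonoidHom.id S) - b := by rw [hbdef]; abel
  rw [h3, h2, smul_sub]
  abel

/-- Now `b = 1 - a` equals all its powers, so `b = p y` with `y` in the Burnside ring `J`. From `b ∘
x = b ∘ (b ∘ x) = p (b ∘ (y ∘ x))` it follows that `b ∘ J ≤ p (b ∘ J)`. Nakayama's lemma gives `b ∘
J = 0`, and `b = b ∘ b` lies in it. -/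
theorem eq_one_of_idempotent (hS : IsPGroup p S) {a : LocBurnside p S S}
    (ha : a ∈ inclSpan p S) (hp : ¬ (p : ZLoc p) ∣ aug p a) (haa : comp p a a = a) :
    a = homClass p (MonoidHom.id S) := by
  have hb : homClass p (MonoidHom.id S) - a ∈ inclSpan p S := sub_mem (inclClass_mem _) ha
  have hbb := one_sub_comp_one_sub ha
  have hd := dvd_aug_one_sub ha hp (w := 0) (by rw [haa, sub_self, smul_zero])
  rw [haa, sub_self, sub_eq_zero] at hbb
  suffices h : homClass p (MonoidHom.id S) - a = 0 from (sub_eq_zero.1 h).symm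
  set b := homClass p (MonoidHom.id S) - a
  obtain ⟨n, y, hyJ, hy⟩ := exists_iterate_mem hS hb hd
  have h1 : (fun x => comp p b x)^[n] b = b := Function.iterate_fixed hbb n
  rw [h1] at hy
  have hfg : ((inclSpan p S).map (compL b)).FG :=
    Submodule.FG.map _ (Submodule.fg_span (Set.finite_range _))
  have hN := Submodule.eq_bot_of_le_smul_of_le_jacobson_bot (Ideal.span {(p : ZLoc p)}) _ hfg (by
    rintro _ ⟨x, hx, rfl⟩
    have h2 : compL b x = (p : ZLoc p) • compL b (comp p y x) := by
      conv_lhs => rw [compL_apply, ← hbb, comp_assoc]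
      conv_lhs => enter [2, 1, 2]; rw [hy]
      rw [comp_smul_left, comp_smul_right, compL_apply]
    rw [h2]
    exact Submodule.smul_mem_smul (Ideal.mem_span_singleton_self _)
      ⟨_, comp_mem_inclSpan hyJ hx, rfl⟩) span_p_le_jacobson
  have h3 : compL b b ∈ (inclSpan p S).map (compL b) := ⟨b, hb, rfl⟩
  rw [hN, Submodule.mem_bot, compL_apply, hbb] at h3
  exact h3

end BurnsideRing

/-! ### Lifting morphisms of a saturated fusion system to a quotient -/

section Sylow

open scoped Pointwise

theorem exists_conj_mem_sylow {p : ℕ} [Fact p.Prime] {G : Type*} [Group G] [Finite G]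
    (A : Sylow p G) {D : Subgroup G} (hD : IsPGroup p D) :
    ∃ g : G, ∀ d ∈ D, g * d * g⁻¹ ∈ A := by
  obtain ⟨B, hB⟩ := hD.exists_le_sylow
  obtain ⟨g, hg⟩ := MulAction.exists_smul_eq G B A
  refine ⟨g, fun d hd => ?_⟩
  have h1 : g * d * g⁻¹ ∈ (g • B : Sylow p G) := by
    have : (MulAut.conj g) • d ∈ (MulAut.conj g) • (B : Subgroup G) :=
      Subgroup.smul_mem_pointwise_smul _ _ _ (hB hd)
    exact this
  rwa [hg] at h1

/-- A Frattini-type argument: `A` is still Sylow in `K A`, so the conjugating element can be taken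
there, and its factor in `A` can be dropped because `A` is stable under it. -/
theorem exists_mul_conj_mem_sylow {p : ℕ} [Fact p.Prime] {G : Type*} [Group G] [Finite G]
    (A : Sylow p G) (K : Subgroup G) [K.Normal] {D : Subgroup G} (hD : IsPGroup p D)
    (hDK : D ≤ K) : ∃ k ∈ K, ∀ d ∈ D, k * d * k⁻¹ ∈ A := by
  let H : Subgroup G := K ⊔ A
  have hAH : (A : Subgroup G) ≤ H := le_sup_right
  have hDH : D ≤ H := hDK.trans le_sup_left
  obtain ⟨⟨g, hgH⟩, hg⟩ := exists_conj_mem_sylow (A.subtype hAH) (D := D.subgroupOf H)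
    (hD.comap_of_injective _ (Subgroup.subtype_injective H))
  have hg' : g⁻¹ ∈ K ⊔ (A : Subgroup G) := inv_mem hgH
  obtain ⟨k, hk, a, ha, hka⟩ := Subgroup.mem_sup_of_normal_left.1 hg'
  refine ⟨k⁻¹, inv_mem hk, fun d hd => ?_⟩
  have h1 := hg ⟨d, hDH hd⟩ hd
  have h2 : g * d * g⁻¹ ∈ (A : Subgroup G) := h1
  have h3 : g = a⁻¹ * k⁻¹ := by rw [← mul_inv_rev, hka, inv_inv]
  have h4 : k⁻¹ * d * k⁻¹⁻¹ = a * (g * d * g⁻¹) * a⁻¹ := by rw [h3]; group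
  rw [h4]
  exact mul_mem (mul_mem ha h2) (inv_mem ha)

end Sylow

namespace FusionSystem

variable {S : Type u} [Group S] {F : FusionSystem S}

/-! ### Restricting, composing and inverting morphisms into `S` -/

theorem homS_of_hom {P Q : Subgroup S} {φ : P →* Q} (hφ : φ ∈ F.Hom P Q) :
    Q.subtype.comp φ ∈ F.HomS P :=
  ⟨(Subgroup.inclusion le_top).comp φ, F.comp_mem hφ (F.conj_mem _ 1 (by intro x; simp)),
    fun _ => rfl⟩

theorem hom_of_homS {P Q : Subgroup S} {φ : P →* S} (hφ : φ ∈ F.HomS P) (hQ : ∀ x, φ x ∈ Q) :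
    φ.codRestrict Q hQ ∈ F.Hom P Q := by
  have hinj := F.homS_injective hφ
  obtain ⟨ψ, hψ, h⟩ := hφ
  have h1 := (F.iso_mem hψ φ.range (MonoidHom.ofInjective hinj) h).1
  exact F.comp_mem (ψ := Subgroup.inclusion (by rintro _ ⟨x, rfl⟩; exact hQ x)) h1
    (F.conj_mem _ 1 (by intro x; simp))

theorem homS_conj {P : Subgroup S} {φ : P →* S} (g : S) (h : ∀ x, φ x = g * x * g⁻¹) :
    φ ∈ F.HomS P := by
  have : φ = (MulAut.conj g).toMonoidHom.comp P.subtype := MonoidHom.ext h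
  rw [this]
  exact F.conj_mem_homS P g

theorem homS_comp {P Q : Subgroup S} {φ : P →* S} {ψ : Q →* S} {θ : P →* S} (hφ : φ ∈ F.HomS P)
    (hψ : ψ ∈ F.HomS Q) (hQ : ∀ x, φ x ∈ Q) (h : ∀ x, θ x = ψ ⟨φ x, hQ x⟩) : θ ∈ F.HomS P := by
  obtain ⟨ψ', hψ', hψ''⟩ := hψ
  exact ⟨ψ'.comp (φ.codRestrict Q hQ), F.comp_mem (hom_of_homS hφ hQ) hψ',
    fun x => (h x).trans (hψ'' _)⟩

theorem homS_restrict {P Q : Subgroup S} {ψ : Q →* S} {θ : P →* S} (hψ : ψ ∈ F.HomS Q)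
    (hQ : P ≤ Q) (h : ∀ x : P, θ x = ψ ⟨x, hQ x.2⟩) : θ ∈ F.HomS P :=
  homS_comp (φ := P.subtype) (homS_conj 1 (by simp)) hψ (fun x => hQ x.2) h

theorem homS_inv {P R : Subgroup S} {φ : P →* S} {θ : R →* S} (hφ : φ ∈ F.HomS P)
    (hR : ∀ y : R, ∃ x : P, φ x = y) (hφR : ∀ x, φ x ∈ R)
    (h : ∀ x : P, θ ⟨φ x, hφR x⟩ = x) : θ ∈ F.HomS R := by
  have hbij : Function.Bijective (φ.codRestrict R hφR) := by
    constructor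
    · intro x y hxy
      exact F.homS_injective hφ (congrArg Subtype.val hxy)
    · intro y
      obtain ⟨x, hx⟩ := hR y
      exact ⟨x, Subtype.ext hx⟩
  have h1 := (F.iso_mem (hom_of_homS hφ hφR) R (MulEquiv.ofBijective _ hbij) (fun _ => rfl)).2
  have h2 := homS_of_hom h1
  refine homS_restrict h2 le_rfl fun y => ?_
  obtain ⟨x, rfl⟩ := hbij.2 y
  change θ ⟨φ x, hφR x⟩ = ((MulEquiv.ofBijective _ hbij).symm (MulEquiv.ofBijective _ hbij x) : S)
  rw [MulEquiv.symm_apply_apply, h]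

theorem homS_symm {P : Subgroup S} {φ : P →* S} (hφ : φ ∈ F.HomS P) :
    P.subtype.comp (MonoidHom.ofInjective (F.homS_injective hφ)).symm.toMonoidHom ∈
      F.HomS φ.range :=
  homS_inv hφ (fun y => y.2) (fun x => ⟨x, rfl⟩) fun x => congrArg Subtype.val
    ((MonoidHom.ofInjective (F.homS_injective hφ)).symm_apply_apply x)

theorem mem_autF {Q : Subgroup S} {e : MulAut Q} (h : Q.subtype.comp e.toMonoidHom ∈ F.HomS Q) :
    e ∈ F.autF Q :=
  hom_of_homS h (fun x => (e x).2)

theorem homS_of_mem_autF {Q : Subgroup S} {e : MulAut Q} (h : e ∈ F.autF Q) :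
    Q.subtype.comp e.toMonoidHom ∈ F.HomS Q := homS_of_hom h

theorem mem_sylow_iff {p : ℕ} {Q : Subgroup S} {A : Sylow p (F.autF Q)}
    (hA : (A : Subgroup (F.autF Q)).map (F.autF Q).subtype = autS Q) {e : F.autF Q} :
    e ∈ A ↔ ∃ y ∈ Subgroup.normalizer (Q : Set S),
      ∀ u : Q, ((e : MulAut Q) u : S) = y * u * y⁻¹ := by
  have h1 : e ∈ A ↔ (e : MulAut Q) ∈ autS Q := by
    rw [← hA]
    constructor
    · intro h
      exact ⟨e, h, rfl⟩
    · rintro ⟨e', h, h'⟩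
      rwa [← Subtype.ext h']
  rw [h1]
  constructor
  · rintro ⟨y, hy⟩
    refine ⟨y, y.2, fun u => ?_⟩
    rw [← hy]
    rfl
  · rintro ⟨y, hy, h⟩
    exact ⟨⟨y, hy⟩, MulEquiv.ext fun u => Subtype.ext (h u).symm⟩

/-! ### Morphisms that descend to `S ⧸ T` -/

variable [Finite S] {T : Subgroup S} [T.Normal] (hT : F.StronglyClosed T)

/-- A homomorphism `φ : P → S` induces a morphism of `F/T` on the image of `P` in `S ⧸ T`. -/
def Lifts {P : Subgroup S} (φ : P →* S) : Prop :=
  ∃ ρ ∈ (F.quotient T hT).HomS (P.map (QuotientGroup.mk' T)),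
    ∀ (x : P) (y : P.map (QuotientGroup.mk' T)), (y : S ⧸ T) = ((x : S) : S ⧸ T) →
      ρ y = ((φ x : S) : S ⧸ T)

variable {hT}

theorem Lifts.comp {P Q : Subgroup S} {φ : P →* S} {ψ : Q →* S} {θ : P →* S} (hφ : Lifts hT φ)
    (hψ : Lifts hT ψ) (hQ : ∀ x, φ x ∈ Q) (h : ∀ x, θ x = ψ ⟨φ x, hQ x⟩) : Lifts hT θ := by
  obtain ⟨ρ, hρ, h1⟩ := hφ
  obtain ⟨σ, hσ, h2⟩ := hψ
  have hmem : ∀ y, ρ y ∈ Q.map (QuotientGroup.mk' T) := by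
    rintro ⟨_, x, hx, rfl⟩
    rw [h1 ⟨x, hx⟩ _ rfl]
    exact ⟨_, hQ _, rfl⟩
  refine ⟨σ.comp (ρ.codRestrict _ hmem), homS_comp hρ hσ hmem (fun _ => rfl), ?_⟩
  intro x y hxy
  rw [h x]
  exact h2 ⟨φ x, hQ x⟩ ⟨ρ y, hmem y⟩ (h1 x y hxy)

theorem lifts_of_congr {P : Subgroup S} {φ : P →* S}
    (h : ∀ x, ((φ x : S) : S ⧸ T) = ((x : S) : S ⧸ T)) : Lifts hT φ :=
  ⟨(P.map (QuotientGroup.mk' T)).subtype, homS_conj 1 (by simp), fun x _ hxy =>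
    hxy.trans (h x).symm⟩

theorem Lifts.restrict {P Q : Subgroup S} {ψ : Q →* S} {θ : P →* S} (hψ : Lifts hT ψ)
    (hQ : P ≤ Q) (h : ∀ x : P, θ x = ψ ⟨x, hQ x.2⟩) : Lifts hT θ :=
  Lifts.comp (φ := P.subtype) (lifts_of_congr fun _ => rfl) hψ (fun x => hQ x.2) h

theorem Lifts.inv {P R : Subgroup S} {φ : P →* S} {θ : R →* S} (hφ : Lifts hT φ)
    (hR : ∀ y : R, ∃ x : P, φ x = y) (hφR : ∀ x, φ x ∈ R)
    (h : ∀ x : P, θ ⟨φ x, hφR x⟩ = x) : Lifts hT θ := by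
  obtain ⟨ρ, hρ, h1⟩ := hφ
  have hinj := (F.quotient T hT).homS_injective hρ
  let q := QuotientGroup.mk' T
  have hρR : ρ.range = R.map q := by
    ext z
    constructor
    · rintro ⟨⟨_, x, hx, rfl⟩, rfl⟩
      rw [h1 ⟨x, hx⟩ _ rfl]
      exact ⟨_, hφR _, rfl⟩
    · rintro ⟨r, hr, rfl⟩
      obtain ⟨x, hx⟩ := hR ⟨r, hr⟩
      refine ⟨⟨_, x, x.2, rfl⟩, ?_⟩
      rw [h1 x _ rfl, hx]
      rfl
  have hmem : ∀ y, ρ y ∈ R.map q := fun y => hρR ▸ ⟨y, rfl⟩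
  have hbij : Function.Bijective (ρ.codRestrict _ hmem) := by
    constructor
    · intro x y hxy
      exact hinj (congrArg Subtype.val hxy)
    · rintro ⟨y, hy⟩
      rw [← hρR] at hy
      obtain ⟨x, rfl⟩ := hy
      exact ⟨x, rfl⟩
  let e := MulEquiv.ofBijective _ hbij
  refine ⟨(P.map q).subtype.comp e.symm.toMonoidHom, homS_inv hρ ?_ hmem ?_, ?_⟩
  · intro y
    obtain ⟨x, hx⟩ := hbij.2 y
    exact ⟨x, congrArg Subtype.val hx⟩
  · intro x
    exact congrArg Subtype.val (e.symm_apply_apply x)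
  · intro y z hyz
    obtain ⟨x, hx⟩ := hR y
    have h2 : z = e ⟨q x, x, x.2, rfl⟩ := by
      refine Subtype.ext (hyz.trans ?_)
      rw [← hx]
      exact (h1 x ⟨q x, x, x.2, rfl⟩ rfl).symm
    change ((e.symm z : P.map q) : S ⧸ T) = _
    rw [h2, e.symm_apply_apply]
    have h3 : y = ⟨φ x, hφR x⟩ := Subtype.ext hx.symm
    rw [h3, h]
    rfl

/-- Since `T ≤ P`, the preimage of `P/T` is `P` itself, so `φ` is a morphism of the kind that
defines `F/T`. Strong closure gives `φ(T) ≤ T`, hence the induced map. -/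
theorem lifts_of_le {P : Subgroup S} (hTP : T ≤ P) {φ : P →* S} (hφ : φ ∈ F.HomS P) :
    Lifts hT φ := by
  let q := QuotientGroup.mk' T
  have hle : (P.map q).comap q = P := by
    rw [Subgroup.comap_map_eq, QuotientGroup.ker_mk', sup_eq_left.2 hTP]
  have hker : (q.subgroupMap P).ker ≤ (q.comp φ).ker := by
    intro x hx
    have hx1 : q x = 1 := congrArg Subtype.val hx
    have hx2 : (x : S) ∈ T := (QuotientGroup.eq_one_iff _).1 hx1
    obtain ⟨ψ, hψ, h⟩ := hφ
    refine (QuotientGroup.eq_one_iff _).2 ?_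
    rw [h]
    exact hT.apply_mem hψ x hx2
  let ρ : P.map q →* S ⧸ T :=
    (q.subgroupMap P).liftOfSurjective (q.subgroupMap_surjective P) ⟨q.comp φ, hker⟩
  have hρ : ∀ (x : P) (y : P.map q), (y : S ⧸ T) = ((x : S) : S ⧸ T) →
      ρ y = ((φ x : S) : S ⧸ T) := by
    intro x y hxy
    have h1 : y = q.subgroupMap P x := Subtype.ext hxy
    rw [h1]
    exact MonoidHom.liftOfRightInverse_comp_apply _ _ _ ⟨q.comp φ, hker⟩ x
  refine ⟨ρ, ⟨ρ.codRestrict ⊤ (fun _ => trivial), ⟨(φ.comp (Subgroup.inclusion hle.le)).codRestrict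
    _ (fun x => trivial), hom_of_homS (homS_restrict hφ hle.le fun _ => rfl) _, ?_⟩,
    fun _ => rfl⟩, hρ⟩
  intro x y hxy
  exact hρ ⟨x, hle.le x.2⟩ y hxy

/-! #### Extension of morphisms to larger subgroups -/

theorem exists_fullyNormalized (P : Subgroup S) :
    ∃ Q, F.FullyNormalized Q ∧ ∃ φ ∈ F.HomS P, φ.range = Q := by
  obtain ⟨Q, ⟨φ, hφ, rfl⟩, hmax⟩ := Set.exists_max_image {Q | ∃ φ ∈ F.HomS P, φ.range = Q}
    (fun Q => Nat.card (Subgroup.normalizer (Q : Set S))) (Set.toFinite _)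
    ⟨_, P.subtype, homS_conj 1 (by simp), rfl⟩
  refine ⟨_, fun R ⟨ψ, hψ, hbij⟩ => hmax R ?_, φ, hφ, rfl⟩
  refine ⟨(R.subtype.comp ψ).comp φ.rangeRestrict,
    homS_comp hφ (homS_of_hom hψ) (fun x => ⟨x, rfl⟩) (fun _ => rfl), ?_⟩
  ext r
  constructor
  · rintro ⟨x, rfl⟩
    exact (ψ _).2
  · intro hr
    obtain ⟨⟨_, x, rfl⟩, h⟩ := hbij.2 ⟨r, hr⟩
    exact ⟨x, congrArg Subtype.val h⟩

variable {p : ℕ} [hp : Fact p.Prime]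

/-- An isomorphism onto a fully normalized subgroup can be chosen to extend to the normalizer. -/
theorem exists_extends_normalizer (hS : IsPGroup p S) (hF : F.IsSaturated p) {P Q : Subgroup S}
    (hQ : F.FullyNormalized Q) {φ : P →* S} (hφ : φ ∈ F.HomS P) (hφQ : φ.range = Q) :
    ∃ ψ ∈ F.HomS (Subgroup.normalizer (P : Set S)),
      (∀ x (hx : x ∈ P), ψ ⟨x, Subgroup.le_normalizer hx⟩ ∈ Q) ∧
      ∀ y ∈ Q, ∃ (x : S) (hx : x ∈ P), ψ ⟨x, Subgroup.le_normalizer hx⟩ = y := by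
  subst hφQ
  obtain ⟨A, hA⟩ := hF.sylow_of_fullyNormalized _ hQ
  let N := Subgroup.normalizer (P : Set S)
  let e : P ≃* φ.range := MonoidHom.ofInjective (F.homS_injective hφ)
  -- The conjugation action of `N_S(P)` on `P`, transported to `φ(P)`.
  let c : N →* MulAut φ.range := (MulAut.congr e).toMonoidHom.comp P.normalizerMonoidHom
  have hc' : ∀ (x : N) (u : P), ∃ v : P, (v : S) = x * u * (x : S)⁻¹ ∧ c x (e u) = e v := by
    intro x u
    refine ⟨P.normalizerMonoidHom x u, rfl, ?_⟩
    change e (P.normalizerMonoidHom x (e.symm (e u))) = _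
    rw [e.symm_apply_apply]
  have hc : ∀ x, c x ∈ F.autF φ.range := by
    intro x
    refine mem_autF ?_
    have h1 : (φ.comp (P.normalizerMonoidHom x).toMonoidHom) ∈ F.HomS P :=
      homS_comp (φ := P.subtype.comp (P.normalizerMonoidHom x).toMonoidHom)
        (homS_conj x (fun u => rfl)) hφ
        (fun u => (P.normalizerMonoidHom x u).2) (fun _ => rfl)
    refine homS_comp (homS_symm hφ) h1 (fun y => (e.symm y).2) fun y => rfl
  let c' : N →* F.autF φ.range := c.codRestrict _ hc
  have hD : IsPGroup p c'.range := (hS.to_subgroup N).of_surjective c'.rangeRestrict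
    c'.rangeRestrict_surjective
  -- The transported action has a `p`-group as image, and `Aut_S(φ(P))` is Sylow in `Aut_F(φ(P))`.
  -- Twisting `φ` by `β` moves that image into `Aut_S(φ(P))`, which says exactly that `N_S(P)` lies
  -- in the extender of the twisted map `θ`.
  obtain ⟨β, hβ⟩ := exists_conj_mem_sylow A hD
  let θ : P →* S := (φ.range.subtype.comp (β : MulAut φ.range).toMonoidHom).comp e.toMonoidHom
  have hθ : θ ∈ F.HomS P :=
    homS_comp hφ (homS_of_mem_autF β.2) (fun x => ⟨x, rfl⟩) (fun _ => rfl)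
  have hθr : θ.range = φ.range := by
    ext y
    constructor
    · rintro ⟨x, rfl⟩
      exact ((β : MulAut φ.range) (e x)).2
    · intro hy
      obtain ⟨z, hz⟩ := (β : MulAut φ.range).surjective ⟨y, hy⟩
      obtain ⟨x, rfl⟩ := e.surjective z
      exact ⟨x, congrArg Subtype.val hz⟩
  have hN : N ≤ extender θ := by
    intro x hx
    refine ⟨hx, ?_⟩
    obtain ⟨y, hy, h1⟩ := (mem_sylow_iff hA).1 (hβ (c' ⟨x, hx⟩) ⟨_, rfl⟩)
    refine ⟨y, by rwa [hθr], fun u v huv => ?_⟩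
    have h2 := h1 ((β : MulAut φ.range) (e u))
    have h3 : ((β * c' ⟨x, hx⟩ * β⁻¹ : F.autF φ.range) : MulAut φ.range)
        ((β : MulAut φ.range) (e u)) = (β : MulAut φ.range) (c ⟨x, hx⟩ (e u)) := by
      change (β : MulAut φ.range) (c ⟨x, hx⟩
        (((β : MulAut φ.range)⁻¹) ((β : MulAut φ.range) (e u)))) = _
      rw [MulAut.inv_apply_self]
    obtain ⟨w, hw, hw'⟩ := hc' ⟨x, hx⟩ u
    rw [h3, hw'] at h2
    have h4 : v = w := Subtype.ext (huv.trans hw.symm)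
    rw [h4]
    exact h2
  obtain ⟨ψ, hψ, hψ'⟩ := hF.extension P θ hθ (by
    rw [hθr]
    exact hF.fullyCentralized_of_fullyNormalized _ hQ)
  refine ⟨ψ.comp (Subgroup.inclusion hN), homS_restrict hψ hN fun _ => rfl, ?_, ?_⟩
  · intro x hx
    have : ψ ⟨x, _⟩ = θ ⟨x, hx⟩ := hψ' ⟨x, hx⟩ ⟨x, hN (Subgroup.le_normalizer hx)⟩ rfl
    change ψ ⟨x, _⟩ ∈ _
    rw [this, ← hθr]
    exact ⟨_, rfl⟩
  · intro y hy
    rw [← hθr] at hy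
    obtain ⟨x, rfl⟩ := hy
    exact ⟨x, x.2, hψ' x ⟨x, hN (Subgroup.le_normalizer x.2)⟩ rfl⟩

theorem lt_normalizer (hS : IsPGroup p S) {P : Subgroup S} (hP : P ≠ ⊤) :
    P < Subgroup.normalizer (P : Set S) := by
  have := hS.isNilpotent
  exact Group.normalizerCondition_of_isNilpotent P (lt_top_iff_ne_top.2 hP)

/-- In the `p`-group `Q T`, which properly contains `Q`, the normalizer of `Q` is strictly larger
than `Q`. Cancelling the `Q`-factor of a new normalizing element leaves an element of `T`. -/
theorem exists_mem_normalizer (hS : IsPGroup p S) {Q : Subgroup S} (hTQ : ¬ T ≤ Q) :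
    ∃ t ∈ T, t ∉ Q ∧ t ∈ Subgroup.normalizer (Q : Set S) := by
  let R : Subgroup S := Q ⊔ T
  have hQR : Q ≤ R := le_sup_left
  have hne : Q.subgroupOf R ≠ ⊤ := by
    rw [Ne, Subgroup.subgroupOf_eq_top]
    exact fun h => hTQ (le_sup_right.trans h)
  obtain ⟨⟨r, hrR⟩, hr, hr'⟩ := SetLike.exists_of_lt (lt_normalizer (hS.to_subgroup R) hne)
  have hrN : r ∈ Subgroup.normalizer (Q : Set S) := by
    rw [Subgroup.mem_normalizer_iff] at hr ⊢
    intro x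
    constructor
    · intro hx
      exact (hr ⟨x, hQR hx⟩).1 hx
    · intro hx
      have hxR : x ∈ R := by
        have h1 := mul_mem (mul_mem (inv_mem hrR) (hQR hx)) hrR
        have h2 : r⁻¹ * (r * x * r⁻¹) * r = x := by group
        rwa [h2] at h1
      exact (hr ⟨x, hxR⟩).2 hx
  obtain ⟨q, hq, t, ht, rfl⟩ := Subgroup.mem_sup_of_normal_right.1 hrR
  refine ⟨t, ht, fun h => hr' (mul_mem hq h), ?_⟩
  have := mul_mem (inv_mem (Subgroup.le_normalizer hq)) hrN
  rwa [inv_mul_cancel_left] at this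

/-- Modify `α` by an automorphism `k` of `Q` that is trivial modulo `T`, so that `ν = k α` extends
to a subgroup larger than `Q`. Then `ν` descends by `ih`, `k⁻¹` descends to the inclusion, and `α =
k⁻¹ ν`. -/
theorem lifts_of_mem_autF (hS : IsPGroup p S) (hF : F.IsSaturated p) {Q : Subgroup S}
    (hQ : F.FullyNormalized Q) (hTQ : ¬ T ≤ Q)
    (ih : ∀ R : Subgroup S, Q < R → ∀ ψ ∈ F.HomS R, Lifts hT ψ) {α : MulAut Q}
    (hα : α ∈ F.autF Q) : Lifts hT (Q.subtype.comp α.toMonoidHom) := by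
  obtain ⟨A, hA⟩ := hF.sylow_of_fullyNormalized _ hQ
  let K : Subgroup (F.autF Q) :=
    { carrier := {κ | ∀ x : Q, (((κ : MulAut Q) x : S) : S ⧸ T) = ((x : S) : S ⧸ T)}
      one_mem' := fun x => rfl
      mul_mem' := fun {a b} ha hb x => (ha _).trans (hb x)
      inv_mem' := fun {a} ha x => by
        have h1 := ha (((a : MulAut Q)⁻¹) x)
        rw [MulAut.apply_inv_self] at h1
        exact h1.symm }
  have hKn : K.Normal := by
    refine ⟨fun κ hκ β x => ?_⟩
    have h1 := hκ (((β : MulAut Q)⁻¹) x)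
    have h2 : ((((β : MulAut Q)⁻¹ x : Q) : S)⁻¹ * ((κ : MulAut Q) ((β : MulAut Q)⁻¹ x) : Q)) ∈ T :=
      QuotientGroup.eq.1 h1.symm
    have h3 := hT.apply_mem β.2 (((β : MulAut Q)⁻¹ x)⁻¹ * (κ : MulAut Q) ((β : MulAut Q)⁻¹ x)) h2
    refine (QuotientGroup.eq.2 ?_).symm
    convert h3 using 1
    change (x : S)⁻¹ * ((β : MulAut Q) ((κ : MulAut Q) (((β : MulAut Q)⁻¹) x)) : S) =
      ((β : MulAut Q) ((((β : MulAut Q)⁻¹ x)⁻¹ * (κ : MulAut Q) ((β : MulAut Q)⁻¹ x))) : S)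
    rw [map_mul, map_inv, MulAut.apply_inv_self]
    rfl
  let a : F.autF Q := ⟨α, hα⟩
  -- Conjugation by `α` may move `A ⊓ K` out of the Sylow subgroup `A = Aut_S(Q)`, but keeps it
  -- inside the normal subgroup `K`. Hence some `k ∈ K` brings it back into `A`.
  let D : Subgroup (F.autF Q) := ((A : Subgroup (F.autF Q)) ⊓ K).map (MulAut.conj a).toMonoidHom
  have hD : IsPGroup p D := (A.2.to_le inf_le_left).map _
  obtain ⟨k, hk, hkA⟩ := exists_mul_conj_mem_sylow A K hD (by
    rintro _ ⟨d, hd, rfl⟩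
    exact hKn.conj_mem d hd.2 a)
  let ν : F.autF Q := k * a
  have hνr : (Q.subtype.comp (ν : MulAut Q).toMonoidHom).range = Q := by
    ext y
    constructor
    · rintro ⟨x, rfl⟩
      exact ((ν : MulAut Q) x).2
    · intro hy
      obtain ⟨z, hz⟩ := (ν : MulAut Q).surjective ⟨y, hy⟩
      exact ⟨z, congrArg Subtype.val hz⟩
  obtain ⟨ψ, hψ, hψ'⟩ := hF.extension Q _ (homS_of_mem_autF ν.2) (by
    rw [hνr]
    exact hF.fullyCentralized_of_fullyNormalized _ hQ)
  have hQle : Q ≤ extender (Q.subtype.comp (ν : MulAut Q).toMonoidHom) := by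
    intro x hx
    refine ⟨Subgroup.le_normalizer hx, ((ν : MulAut Q) ⟨x, hx⟩ : S), ?_, fun u v huv => ?_⟩
    · rw [hνr]
      exact Subgroup.le_normalizer ((ν : MulAut Q) ⟨x, hx⟩).2
    · have : v = ⟨x, hx⟩ * u * ⟨x, hx⟩⁻¹ := Subtype.ext huv
      rw [this, map_mul, map_mul, map_inv]
      rfl
  obtain ⟨t, htT, htQ, htN⟩ := exists_mem_normalizer (T := T) hS hTQ
  -- Conjugation by `t ∈ T` is trivial modulo `T`, so it restricts to an element `d` of `A ⊓ K`. By
  -- the choice of `k`, `ν d ν⁻¹` lies in `Aut_S(Q)`, which is the condition for `t` to be in the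
  -- extender.
  have ht : t ∈ extender (Q.subtype.comp (ν : MulAut Q).toMonoidHom) := by
    let d : F.autF Q := ⟨Q.normalizerMonoidHom ⟨t, htN⟩,
      mem_autF (homS_conj t fun u => rfl)⟩
    have hdA : d ∈ A := (mem_sylow_iff hA).2 ⟨t, htN, fun u => rfl⟩
    have hdK : d ∈ K := by
      intro x
      change ((t * x * t⁻¹ : S) : S ⧸ T) = _
      rw [QuotientGroup.mk_mul, QuotientGroup.mk_mul, QuotientGroup.mk_inv,
        (QuotientGroup.eq_one_iff t).2 htT]
      simp
    obtain ⟨y, hy, h1⟩ := (mem_sylow_iff hA).1 (hkA _ ⟨d, ⟨hdA, hdK⟩, rfl⟩)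
    refine ⟨htN, y, by rwa [hνr], fun u v huv => ?_⟩
    have h2 := h1 ((ν : MulAut Q) u)
    have h3 : k * ((MulAut.conj a).toMonoidHom d) * k⁻¹ = ν * d * ν⁻¹ := by
      change k * (a * d * a⁻¹) * k⁻¹ = k * a * d * (k * a)⁻¹
      group
    rw [h3] at h2
    have h4 : ((ν * d * ν⁻¹ : F.autF Q) : MulAut Q) ((ν : MulAut Q) u) = (ν : MulAut Q) v := by
      change (ν : MulAut Q) ((d : MulAut Q) (((ν : MulAut Q)⁻¹) ((ν : MulAut Q) u))) = _
      rw [MulAut.inv_apply_self]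
      exact congrArg (ν : MulAut Q) (Subtype.ext huv.symm)
    rw [h4] at h2
    exact h2
  have hlt : Q < extender (Q.subtype.comp (ν : MulAut Q).toMonoidHom) :=
    lt_of_le_of_ne hQle fun h => htQ (h ▸ ht)
  have hν : Lifts hT (Q.subtype.comp (ν : MulAut Q).toMonoidHom) :=
    (ih _ hlt ψ hψ).restrict hQle fun x => (hψ' x ⟨x, hQle x.2⟩ rfl).symm
  have hk' : Lifts hT (Q.subtype.comp ((k⁻¹ : F.autF Q) : MulAut Q).toMonoidHom) :=
    lifts_of_congr (inv_mem hk : k⁻¹ ∈ K)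
  refine hν.comp hk' (fun x => ((ν : MulAut Q) x).2) fun x => ?_
  change (α x : S) = ((((k⁻¹ * ν : F.autF Q)) : MulAut Q) x : S)
  rw [inv_mul_cancel_left]

variable (hT) in
/-- Every morphism of a saturated fusion system induces a morphism of the quotient system. -/
theorem lifts_of_isSaturated (hS : IsPGroup p S) (hF : F.IsSaturated p) {P : Subgroup S}
    {φ : P →* S} (hφ : φ ∈ F.HomS P) : Lifts hT φ := by
  induction h : Nat.card S - Nat.card P using Nat.strong_induction_on generalizing P φ with
  | _ n ih =>
    have ih' : ∀ R : Subgroup S, Nat.card P < Nat.card R → ∀ ψ ∈ F.HomS R, Lifts hT ψ := by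
      intro R hR ψ hψ
      refine ih _ ?_ hψ rfl
      have := Subgroup.card_le_card_group R
      omega
    by_cases hTP : T ≤ P
    · exact lifts_of_le hTP hφ
    have hcard : ∀ R Q : Subgroup S, Nat.card R = Nat.card P → R < Q → Nat.card P < Nat.card Q :=
      fun R Q h h' => h ▸ Set.Finite.card_lt_card (Set.toFinite (Q : Set S)) h'
    have hcard' : ∀ {R : Subgroup S} {θ : R →* S}, θ ∈ F.HomS R →
        Nat.card θ.range = Nat.card R := fun hθ =>
      Nat.card_congr (MonoidHom.ofInjective (F.homS_injective hθ)).symm.toEquiv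
    obtain ⟨Q, hQ, χ, hχ, rfl⟩ := F.exists_fullyNormalized P
    -- An isomorphism onto the fully normalized subgroup can be replaced by one that extends to
    -- `N_S(R)`. This is larger than `R`, so the extension descends by induction, and so does its
    -- restriction.
    have key : ∀ (R : Subgroup S) (θ : R →* S), θ ∈ F.HomS R → Nat.card R = Nat.card P →
        θ.range = χ.range → ∃ η ∈ F.HomS R, Lifts hT η ∧ η.range = χ.range := by
      intro R θ hθ hR hθr
      obtain ⟨ψ, hψ, h1, h2⟩ := exists_extends_normalizer hS hF hQ hθ hθr
      -- If `R` were all of `S`, so would be `P`, which has the same order, and then `T ≤ P`.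
      have hRtop : R ≠ ⊤ := by
        rintro rfl
        rw [Subgroup.card_top] at hR
        exact hTP ((Subgroup.eq_top_of_card_eq P hR.symm) ▸ le_top)
      refine ⟨ψ.comp (Subgroup.inclusion Subgroup.le_normalizer),
        homS_restrict hψ Subgroup.le_normalizer fun _ => rfl,
        (ih' _ (hcard R _ hR (lt_normalizer hS hRtop)) ψ hψ).restrict Subgroup.le_normalizer
          fun _ => rfl, ?_⟩
      ext y
      constructor
      · rintro ⟨x, rfl⟩
        exact h1 x x.2
      · intro hy
        obtain ⟨x, hx, e⟩ := h2 y hy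
        exact ⟨⟨x, hx⟩, e⟩
    obtain ⟨η, hη, hηl, hηr⟩ := key P χ hχ rfl rfl
    have hφi := homS_symm hφ
    obtain ⟨ζ, hζ, hζl, hζr⟩ := key φ.range (χ.comp
      (MonoidHom.ofInjective (F.homS_injective hφ)).symm.toMonoidHom)
      (homS_comp hφi hχ (fun x => ((MonoidHom.ofInjective (F.homS_injective hφ)).symm x).2)
        fun _ => rfl) (hcard' hφ) (by
        rw [MonoidHom.range_comp, MonoidHom.range_eq_top.2 (MulEquiv.surjective _),
          ← MonoidHom.range_eq_map])
    -- If the fully normalized subgroup contains `T`, then `φ = (φ η⁻¹) η`, where `φ η⁻¹` starts at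
    -- a subgroup containing `T` and descends directly.
    by_cases hTQ : T ≤ χ.range
    · have hηi := homS_symm hη
      have hα : φ.comp (MonoidHom.ofInjective (F.homS_injective hη)).symm.toMonoidHom ∈
          F.HomS η.range := homS_comp hηi hφ
        (fun x => ((MonoidHom.ofInjective (F.homS_injective hη)).symm x).2) fun _ => rfl
      refine hηl.comp (lifts_of_le (hηr ▸ hTQ) hα) (fun x => ⟨x, rfl⟩) fun x => ?_
      exact (congrArg φ ((MonoidHom.ofInjective (F.homS_injective hη)).symm_apply_apply x)).symm
    · generalize χ.range = Q at *
      subst hηr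
      let e := MonoidHom.ofInjective (F.homS_injective hη)
      let f := MonoidHom.ofInjective (F.homS_injective hζ)
      let φ' : P ≃* φ.range := MonoidHom.ofInjective (F.homS_injective hφ)
      -- Here `α = ζ φ η⁻¹`, so `φ = ζ⁻¹ α η` is a composite of three maps that descend.
      let α : MulAut η.range := e.symm.trans (φ'.trans (f.trans (MulEquiv.subgroupCongr hζr)))
      have hα' : φ.comp e.symm.toMonoidHom ∈ F.HomS η.range :=
        homS_comp (homS_symm hη) hφ (fun x => (e.symm x).2) fun _ => rfl
      have hα : α ∈ F.autF η.range :=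
        mem_autF (homS_comp hα' hζ (fun x => (φ' (e.symm x)).2) fun _ => rfl)
      have hηc : Nat.card η.range = Nat.card P := hcard' hη
      have hαl := lifts_of_mem_autF (hT := hT) hS hF hQ hTQ
        (fun R hR ψ hψ => ih' R (hcard _ R hηc hR) ψ hψ) hα
      have hζi : Lifts hT (φ.range.subtype.comp f.symm.toMonoidHom) :=
        hζl.inv (fun y => y.2) (fun x => ⟨x, rfl⟩) fun x => congrArg Subtype.val
          (f.symm_apply_apply x)
      have h1 : Lifts hT (ζ.comp φ'.toMonoidHom) := by
        refine hηl.comp hαl (fun x => ⟨x, rfl⟩) fun x => ?_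
        change ζ (φ' x) = ζ (φ' (e.symm (e x)))
        rw [e.symm_apply_apply]
      refine h1.comp hζi (fun x => ⟨φ' x, rfl⟩) fun x => ?_
      change φ x = ((f.symm (f (φ' x)) : φ.range) : S)
      rw [f.symm_apply_apply]
      rfl

end FusionSystem

/-! ### Duality -/

section Duality

variable {p : ℕ} [hp : Fact p.Prime] {G H K : Type u} [Group G] [Group H] [Group K]

variable (p G H) in
/-- The span of the classes of the bisets on which both actions are free. -/
def bifreeSpan : Submodule (ZLoc p) (LocBurnside p G H) :=
  Submodule.span (ZLoc p)
    {x | ∃ (X : Biset G H) (hX : X.IsLeftFree), X.opp.IsLeftFree ∧ x = locClass p X hX}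

variable (p G H) in
/-- The linear map sending the class of a bifree biset to that of its opposite. -/
def op : LocBurnside p G H →ₗ[ZLoc p] LocBurnside p H G := (oppF G H).map p

theorem op_locClass {X : Biset G H} (hX : X.IsLeftFree) (hX' : X.opp.IsLeftFree) :
    op p G H (locClass p X hX) = locClass p X.opp hX' := by
  rw [op, BisetFunctor.map_locClass]
  exact locClass_congr hX'.freePartIso _ _

/-- Opposites reverse composition. The restriction to bifree bisets ensures that `op`, which takes a
free part, discards no points. -/
theorem op_comp {x : LocBurnside p H K} (hx : x ∈ bifreeSpan p H K) {y : LocBurnside p G H}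
    (hy : y ∈ bifreeSpan p G H) :
    op p G K (comp p x y) = comp p (op p G H y) (op p H K x) := by
  refine LinearMap.eqOn_span (f := op p G K ∘ₗ compL.flip y)
    (g := compL (op p G H y) ∘ₗ op p H K) ?_ hx
  rintro _ ⟨X, hX, hX', rfl⟩
  refine LinearMap.eqOn_span (f := op p G K ∘ₗ compL (locClass p X hX))
    (g := compL.flip (op p H K (locClass p X hX)) ∘ₗ op p G H) ?_ hy
  rintro _ ⟨Y, hY, hY', rfl⟩
  change op p G K (comp p (locClass p X hX) (locClass p Y hY)) =
    comp p (op p G H (locClass p Y hY)) (op p H K (locClass p X hX))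
  rw [comp_locClass, op_locClass hX hX', op_locClass hY hY', comp_locClass, op_locClass _
    ((hY'.comp hX').of_iso (Biset.oppComp X Y).symm)]
  exact locClass_congr (Biset.oppComp X Y) _ _

variable [Finite G] [Finite H]

theorem opp_pair_isLeftFree {L : Subgroup G} {φ : L →* H} (hφ : Function.Injective φ) :
    (Biset.pair L φ).opp.IsLeftFree := by
  obtain ⟨e⟩ := Biset.oppPair (L := L) (φ := φ) (L' := φ.range)
    (φ' := L.subtype.comp (MonoidHom.ofInjective hφ).symm.toMonoidHom) (by
      intro g h
      constructor
      · rintro ⟨hg, rfl⟩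
        exact ⟨⟨_, rfl⟩, congrArg Subtype.val
          ((MonoidHom.ofInjective hφ).symm_apply_apply ⟨g, hg⟩)⟩
      · rintro ⟨hh, rfl⟩
        exact ⟨((MonoidHom.ofInjective hφ).symm ⟨h, hh⟩).2, congrArg Subtype.val
          ((MonoidHom.ofInjective hφ).apply_symm_apply ⟨h, hh⟩)⟩)
  exact (Biset.pair_isLeftFree _ _).of_iso e

theorem pairClass_mem_bifreeSpan {L : Subgroup G} {φ : L →* H} (hφ : Function.Injective φ) :
    pairClass p L φ ∈ bifreeSpan p G H :=
  Submodule.subset_span ⟨_, Biset.pair_isLeftFree _ _, opp_pair_isLeftFree hφ, rfl⟩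

theorem homClass_mem_bifreeSpan {φ : G →* H} (hφ : Function.Injective φ) :
    homClass p φ ∈ bifreeSpan p G H :=
  pairClass_mem_bifreeSpan (hφ.comp Subtype.val_injective)

theorem op_pairClass {L : Subgroup G} {φ : L →* H} {L' : Subgroup H} {φ' : L' →* G}
    (h : ∀ g h, (∃ hg : g ∈ L, φ ⟨g, hg⟩ = h) ↔ ∃ hh : h ∈ L', φ' ⟨h, hh⟩ = g) :
    op p G H (pairClass p L φ) = pairClass p L' φ' := by
  obtain ⟨e⟩ := Biset.oppPair h
  rw [pairClass_eq, op_locClass _ ((Biset.pair_isLeftFree _ _).of_iso e), pairClass_eq]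
  exact locClass_congr e.symm _ _

variable {S : Type u} [Group S] [Finite S] {F : FusionSystem S}

theorem op_homClass {P : Subgroup S} {φ : P →* S} (hφ : Function.Injective φ) :
    op p P S (homClass p φ) =
      pairClass p φ.range (MonoidHom.ofInjective hφ).symm.toMonoidHom :=
  op_pairClass fun g h => by
    constructor
    · rintro ⟨hg, rfl⟩
      exact ⟨⟨_, rfl⟩, (MonoidHom.ofInjective hφ).symm_apply_apply g⟩
    · rintro ⟨hh, rfl⟩
      exact ⟨trivial, congrArg Subtype.val ((MonoidHom.ofInjective hφ).apply_symm_apply ⟨h, hh⟩)⟩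

theorem op_pairClass_symm {P : Subgroup S} {φ : P →* S} (hφ : Function.Injective φ) :
    op p S P (pairClass p φ.range (MonoidHom.ofInjective hφ).symm.toMonoidHom) =
      homClass p φ :=
  op_pairClass fun h g => by
    constructor
    · rintro ⟨hh, rfl⟩
      exact ⟨trivial, congrArg Subtype.val ((MonoidHom.ofInjective hφ).apply_symm_apply ⟨h, hh⟩)⟩
    · rintro ⟨hg, rfl⟩
      exact ⟨⟨_, rfl⟩, (MonoidHom.ofInjective hφ).symm_apply_apply g⟩

theorem op_homClass_subtype (P : Subgroup S) :
    op p P S (homClass p P.subtype) = pairClass p P (MonoidHom.id P) :=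
  op_pairClass fun g h => by
    constructor
    · rintro ⟨hg, rfl⟩
      exact ⟨g.2, rfl⟩
    · rintro ⟨hh, rfl⟩
      exact ⟨trivial, rfl⟩

theorem op_pairClass_id (P : Subgroup S) :
    op p S P (pairClass p P (MonoidHom.id P)) = homClass p P.subtype :=
  op_pairClass fun h g => by
    constructor
    · rintro ⟨hh, rfl⟩
      exact ⟨trivial, rfl⟩
    · rintro ⟨hg, rfl⟩
      exact ⟨g.2, rfl⟩

theorem op_pairClass_eq {P : Subgroup S} {φ : P →* S} (hφ : Function.Injective φ) :
    op p S S (pairClass p P φ) = pairClass p φ.range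
      (P.subtype.comp (MonoidHom.ofInjective hφ).symm.toMonoidHom) :=
  op_pairClass fun g h => by
    constructor
    · rintro ⟨hg, rfl⟩
      exact ⟨⟨_, rfl⟩, congrArg Subtype.val
        ((MonoidHom.ofInjective hφ).symm_apply_apply ⟨g, hg⟩)⟩
    · rintro ⟨hh, rfl⟩
      exact ⟨((MonoidHom.ofInjective hφ).symm ⟨h, hh⟩).2, congrArg Subtype.val
        ((MonoidHom.ofInjective hφ).apply_symm_apply ⟨h, hh⟩)⟩

/-- Two linear maps agree on `F`-generated elements if they agree on the generators. -/
theorem IsGenerated.hom_eq {M : Type*} [AddCommGroup M] [Module (ZLoc p) M]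
    {f g : LocBurnside p S S →ₗ[ZLoc p] M} {X : LocBurnside p S S} (hX : IsGenerated p F X)
    (h : ∀ (L : Subgroup S) (φ : L →* S), φ ∈ F.HomS L →
      f (pairClass p L φ) = g (pairClass p L φ)) : f X = g X := by
  refine LinearMap.eqOn_span (f := f) (g := g) ?_ hX
  rintro _ ⟨L, φ, hφ, rfl⟩
  exact h L φ hφ

theorem IsGenerated.mem {M : Type*} [AddCommGroup M] [Module (ZLoc p) M]
    {f : LocBurnside p S S →ₗ[ZLoc p] M} {N : Submodule (ZLoc p) M} {X : LocBurnside p S S}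
    (hX : IsGenerated p F X) (h : ∀ (L : Subgroup S) (φ : L →* S), φ ∈ F.HomS L →
      f (pairClass p L φ) ∈ N) : f X ∈ N := by
  refine (Submodule.span_le (p := N.comap f)).2 ?_ hX
  rintro _ ⟨L, φ, hφ, rfl⟩
  exact h L φ hφ

theorem IsGenerated.mem_bifreeSpan {X : LocBurnside p S S} (hX : IsGenerated p F X) :
    X ∈ bifreeSpan p S S :=
  hX.mem (f := LinearMap.id) fun _ _ hφ => pairClass_mem_bifreeSpan (F.homS_injective hφ)

theorem IsGenerated.op {X : LocBurnside p S S} (hX : IsGenerated p F X) :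
    IsGenerated p F (op p S S X) :=
  hX.mem (f := BisetFusion.op p S S) fun L φ hφ => by
    rw [op_pairClass_eq (F.homS_injective hφ)]
    exact Submodule.subset_span ⟨_, _, FusionSystem.homS_symm hφ, rfl⟩

theorem IsGenerated.op_op {X : LocBurnside p S S} (hX : IsGenerated p F X) :
    BisetFusion.op p S S (BisetFusion.op p S S X) = X :=
  hX.hom_eq (f := BisetFusion.op p S S ∘ₗ BisetFusion.op p S S) (g := LinearMap.id)
    fun L φ hφ => by
      rw [LinearMap.comp_apply, pairClass_eq, op_locClass _
        (opp_pair_isLeftFree (F.homS_injective hφ)), op_locClass _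
        ((Biset.pair_isLeftFree L φ).of_iso (Biset.oppOpp _).symm)]
      exact locClass_congr (Biset.oppOpp _) _ _

theorem IsGenerated.aug_op {X : LocBurnside p S S} (hX : IsGenerated p F X) :
    BisetFusion.aug p (BisetFusion.op p S S X) = BisetFusion.aug p X :=
  hX.hom_eq (f := BisetFusion.aug p ∘ₗ BisetFusion.op p S S) (g := BisetFusion.aug p)
    fun L φ hφ => by
      rw [LinearMap.comp_apply, op_pairClass_eq (F.homS_injective hφ), aug_pairClass,
        aug_pairClass]
      congr 1
      have h1 := L.card_mul_index
      have h2 := φ.range.card_mul_index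
      rw [← Nat.card_congr (MonoidHom.ofInjective (F.homS_injective hφ)).toEquiv, ← h1] at h2
      exact Nat.eq_of_mul_eq_mul_left Nat.card_pos h2

/-- Taking opposites exchanges `[φ(P), φ⁻¹]_S^P` with `[P, φ]_P^S` and `[P, id]_S^P` with `[P,
incl]_P^S`, so the two stability equations correspond. -/
theorem IsLeftStable.op {X : LocBurnside p S S} (hX : IsGenerated p F X)
    (h : IsLeftStable p F X) : IsRightStable p F (op p S S X) := by
  intro P φ hφ
  have hinj := F.homS_injective hφ
  have h1 := congrArg (BisetFusion.op p S P) (h P φ hφ)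
  rw [op_comp (pairClass_mem_bifreeSpan (MulEquiv.injective _)) hX.mem_bifreeSpan,
    op_comp (pairClass_mem_bifreeSpan Function.injective_id) hX.mem_bifreeSpan,
    op_pairClass_symm, op_pairClass_id] at h1
  exact h1

theorem IsRightStable.op {X : LocBurnside p S S} (hX : IsGenerated p F X)
    (h : IsRightStable p F X) : IsLeftStable p F (op p S S X) := by
  intro P φ hφ
  have hinj := F.homS_injective hφ
  have h1 := congrArg (BisetFusion.op p P S) (h P φ hφ)
  rw [op_comp hX.mem_bifreeSpan (homClass_mem_bifreeSpan hinj),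
    op_comp hX.mem_bifreeSpan (homClass_mem_bifreeSpan P.subtype_injective), op_homClass hinj,
    op_homClass_subtype] at h1
  exact h1

theorem IsLeftCharacteristic.op {X : LocBurnside p S S} (h : IsLeftCharacteristic p F X) :
    IsRightCharacteristic p F (op p S S X) :=
  ⟨h.generated.op, h.stable.op h.generated, by
    rw [AugPrimeTo, h.generated.aug_op]
    exact h.aug⟩

theorem IsRightCharacteristic.op {X : LocBurnside p S S} (h : IsRightCharacteristic p F X) :
    IsLeftCharacteristic p F (op p S S X) :=
  ⟨h.generated.op, h.stable.op h.generated, by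
    rw [AugPrimeTo, h.generated.aug_op]
    exact h.aug⟩

theorem IsIdempotentMod.op {X : LocBurnside p S S} (hX : IsGenerated p F X)
    (h : IsIdempotentMod p X) : IsIdempotentMod p (op p S S X) := by
  obtain ⟨Y, hY⟩ := h
  refine ⟨BisetFusion.op p S S Y, ?_⟩
  rw [← op_comp hX.mem_bifreeSpan hX.mem_bifreeSpan, ← map_sub, hY, map_smul]

theorem IsCharacteristic.right {X : LocBurnside p S S} (h : IsCharacteristic p F X) :
    IsRightCharacteristic p F X := ⟨h.generated, h.right_stable, h.aug⟩

theorem IsCharacteristic.left {X : LocBurnside p S S} (h : IsCharacteristic p F X) :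
    IsLeftCharacteristic p F X := ⟨h.generated, h.left_stable, h.aug⟩

end Duality

/-! ### Right characteristic elements -/

section RightCharacteristic

variable {p : ℕ} [hp : Fact p.Prime] {S : Type u} [Group S] [Finite S] {F : FusionSystem S}

/-- On a generator, write `[L, φ] = [L, φ]_L^S ∘ [L, id]_S^L`; right stability replaces `φ` by the
inclusion in the first factor. -/
theorem IsRightStable.comp_eq {X W : LocBurnside p S S} (hX : IsRightStable p F X)
    (hW : IsGenerated p F W) : comp p X W = comp p X (toIncl p S W) :=
  hW.hom_eq (f := compL X) (g := compL X ∘ₗ toIncl p S) fun L φ hφ => by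
    rw [LinearMap.comp_apply, toIncl_pairClass, compL_apply, compL_apply, inclClass,
      ← homClass_comp_pairClass L φ,
      ← homClass_comp_pairClass L L.subtype, ← comp_assoc, ← comp_assoc, hX L φ hφ]

theorem IsGenerated.aug_toIncl {X : LocBurnside p S S} (hX : IsGenerated p F X) :
    BisetFusion.aug p (toIncl p S X) = BisetFusion.aug p X :=
  hX.hom_eq (f := BisetFusion.aug p ∘ₗ toIncl p S) (g := BisetFusion.aug p) fun L φ _ => by
    rw [LinearMap.comp_apply, toIncl_pairClass, inclClass, aug_pairClass, aug_pairClass]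

/-- Right stability replaces the right factor `X` by `toIncl X`. The left factor may be replaced
because `toIncl` depends only on left orbits, which `X` and `toIncl X` share and which are
compatible with composing on the right. -/
theorem toIncl_comp_toIncl {X : LocBurnside p S S} (hX : IsGenerated p F X)
    (h : IsRightStable p F X) :
    comp p (toIncl p S X) (toIncl p S X) = toIncl p S (comp p X X) := by
  have h1 : (orbF S S).map p (toIncl p S X) = (orbF S S).map p X :=
    hX.hom_eq (f := (orbF S S).map p ∘ₗ toIncl p S) (g := (orbF S S).map p) fun L φ _ => by
      rw [LinearMap.comp_apply, toIncl_pairClass, inclClass, orb_pairClass, orb_pairClass]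
  rw [h.comp_eq hX, ← toIncl_of_mem (comp_mem_inclSpan (toIncl_mem X) (toIncl_mem X))]
  simp only [toIncl, LinearMap.comp_apply, orb_comp] at h1 ⊢
  rw [h1]

theorem IsRightCharacteristic.toIncl_eq_mod (hS : IsPGroup p S) {X : LocBurnside p S S}
    (h : IsRightCharacteristic p F X) (hX : IsIdempotentMod p X) :
    ∃ y, toIncl p S X = homClass p (MonoidHom.id S) + (p : ZLoc p) • y := by
  obtain ⟨Y, hY⟩ := hX
  refine eq_one_add_of_idempotent_mod hS (toIncl_mem X) (by
    rw [h.generated.aug_toIncl]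
    exact h.aug) (w := toIncl p S Y) ?_
  rw [toIncl_comp_toIncl h.generated h.stable, ← map_sub, hY, map_smul]

theorem IsRightCharacteristic.toIncl_eq_one (hS : IsPGroup p S) {X : LocBurnside p S S}
    (h : IsRightCharacteristic p F X) (hX : comp p X X = X) :
    toIncl p S X = homClass p (MonoidHom.id S) :=
  eq_one_of_idempotent hS (toIncl_mem X) (by
    rw [h.generated.aug_toIncl]
    exact h.aug) (by rw [toIncl_comp_toIncl h.generated h.stable, hX])

/-- A right stable element is fixed by right multiplication with a right characteristic
idempotent. -/
theorem IsRightStable.comp_idempotent (hS : IsPGroup p S) {X W : LocBurnside p S S}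
    (hX : IsRightStable p F X) (hW : IsRightCharacteristic p F W) (hWW : comp p W W = W) :
    comp p X W = X := by
  rw [hX.comp_eq hW.generated, hW.toIncl_eq_one hS hWW, comp_homClass_id]

/-- Right stability of `X` gives `X ∘ W = X`. The same argument for the opposites, using left
stability of `W`, gives `X ∘ W = W`. -/
theorem IsCharacteristicIdempotent.unique (hS : IsPGroup p S) {X W : LocBurnside p S S}
    (hX : IsCharacteristicIdempotent p F X) (hW : IsCharacteristicIdempotent p F W) : W = X := by
  have hXg := hX.characteristic.generated
  have hWg := hW.characteristic.generated
  have h1 := hX.characteristic.right_stable.comp_idempotent hS hW.characteristic.right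
    hW.idempotent
  have h2 := (hW.characteristic.left_stable.op hWg).comp_idempotent hS
    hX.characteristic.left.op (by rw [← op_comp hXg.mem_bifreeSpan hXg.mem_bifreeSpan,
      hX.idempotent])
  rw [← op_comp hXg.mem_bifreeSpan hWg.mem_bifreeSpan, h1] at h2
  rw [← hXg.op_op, h2, hWg.op_op]

end RightCharacteristic

/-! ### Bideflation -/

section Deflation

variable {p : ℕ} [hp : Fact p.Prime] {S : Type u} [Group S] (T : Subgroup S) [T.Normal]

variable (p) in
/-- Bideflation, followed by taking the free part of a biset. -/
def deflL : LocBurnside p S S →ₗ[ZLoc p] LocBurnside p (S ⧸ T) (S ⧸ T) := (deflF T T).map p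

theorem deflL_locClass {X : Biset S S} (hX : X.IsLeftFree) (hX' : (X.defl T T).IsLeftFree) :
    deflL p T (locClass p X hX) = locClass p (X.defl T T) hX' := by
  rw [deflL, BisetFunctor.map_locClass]
  exact locClass_congr hX'.freePartIso _ _

variable {T}

/-- A subgroup of `S ⧸ T` maps to the quotient of its preimage by `T`, inversely to the
projection. -/
theorem exists_quotient_comap (P : Subgroup (S ⧸ T)) :
    ∃ e : P →* (P.comap (QuotientGroup.mk' T)) ⧸ T.subgroupOf (P.comap (QuotientGroup.mk' T)),
      ∀ (j : P) (g : P.comap (QuotientGroup.mk' T)), e j = g →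
        (j : S ⧸ T) = ((g : S) : S ⧸ T) := by
  let R := P.comap (QuotientGroup.mk' T)
  let f : R →* P := (QuotientGroup.mk' T).subgroupComap P
  have hker : T.subgroupOf R = f.ker := by
    ext x
    rw [Subgroup.mem_subgroupOf, MonoidHom.mem_ker, ← QuotientGroup.eq_one_iff]
    exact ⟨fun h => Subtype.ext h, fun h => congrArg Subtype.val h⟩
  have hf : Function.Surjective f := by
    rintro ⟨y, hy⟩
    obtain ⟨s, rfl⟩ := QuotientGroup.mk_surjective y
    exact ⟨⟨s, hy⟩, rfl⟩
  let e : R ⧸ T.subgroupOf R ≃* P :=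
    (QuotientGroup.quotientMulEquivOfEq hker).trans
      (QuotientGroup.quotientKerEquivOfSurjective f hf)
  refine ⟨e.symm.toMonoidHom, fun j g h => ?_⟩
  have h1 : j = e g := by
    rw [← h]
    exact (e.apply_symm_apply j).symm
  rw [h1]
  rfl

/-- Since `φ` maps `T` onto `T`, deflating and then restricting along `ρ` amounts to restricting
along `φ` and then deflating. The right-hand side sees `φ` only through the restriction of `X`,
which right stability controls. -/
theorem res_deflL {P : Subgroup (S ⧸ T)} {ρ : P →* S ⧸ T}
    {e : P →* (P.comap (QuotientGroup.mk' T)) ⧸ T.subgroupOf (P.comap (QuotientGroup.mk' T))}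
    (he : ∀ (j : P) (g : P.comap (QuotientGroup.mk' T)), e j = g →
      (j : S ⧸ T) = ((g : S) : S ⧸ T))
    {φ : P.comap (QuotientGroup.mk' T) →* S}
    (hφT : ∀ x : P.comap (QuotientGroup.mk' T), (x : S) ∈ T → φ x ∈ T)
    (hφT' : ∀ t ∈ T, ∃ x : P.comap (QuotientGroup.mk' T), (x : S) ∈ T ∧ φ x = t)
    (h : ∀ (x : P.comap (QuotientGroup.mk' T)) (y : P), (y : S ⧸ T) = ((x : S) : S ⧸ T) →
      ρ y = ((φ x : S) : S ⧸ T)) (X : LocBurnside p S S) :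
    (resF (S ⧸ T) ρ).map p (deflL p T X) =
      (resF (S ⧸ T) e).map p ((deflF (T.subgroupOf _) T).map p ((resF S φ).map p X)) := by
  induction X using locBurnside_induction with
  | add x y hx hy => simp only [map_add, hx, hy]
  | smul c x hx => simp only [map_smul, hx]
  | cls X hX =>
    obtain ⟨i⟩ := Biset.deflRes T T (T.subgroupOf (P.comap (QuotientGroup.mk' T))) φ e ρ
      (fun n hn => hφT n hn) hφT' (fun j g hj => h g j (he j g hj)) X
    rw [deflL]
    simp only [BisetFunctor.map_locClass]
    exact locClass_congr ((Biset.freePartRes ρ _).symm.trans (i.symm.freePart.trans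
      (Biset.freePartRes e _))) _ _

variable [Finite S] {F : FusionSystem S}

theorem deflL_pairClass {L : Subgroup S} {φ : L →* S}
    {φ' : L.map (QuotientGroup.mk' T) →* S ⧸ T}
    (h : ∀ (x : L) (y : L.map (QuotientGroup.mk' T)), (y : S ⧸ T) = ((x : S) : S ⧸ T) →
      φ' y = ((φ x : S) : S ⧸ T)) :
    ((Biset.pair L φ).defl T T).IsLeftFree ∧
    deflL p T (pairClass p L φ) = pairClass p (L.map (QuotientGroup.mk' T)) φ' := by
  obtain ⟨e⟩ := Biset.deflPair T T (L := L) (φ := φ) (φ' := φ') (fun x => ⟨x, x.2, rfl⟩)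
    (by rintro _ ⟨x, hx, rfl⟩; exact ⟨⟨x, hx⟩, rfl⟩) h
  refine ⟨(Biset.pair_isLeftFree _ _).of_iso e, ?_⟩
  rw [pairClass_eq, deflL_locClass T _ ((Biset.pair_isLeftFree _ _).of_iso e), pairClass_eq]
  exact locClass_congr e.symm _ _

theorem deflL_inclClass (L : Subgroup S) :
    deflL p T (inclClass p L) = inclClass p (L.map (QuotientGroup.mk' T)) :=
  (deflL_pairClass fun _ _ h => h).2

theorem deflL_one : deflL p T (homClass p (MonoidHom.id S)) =
    homClass p (MonoidHom.id (S ⧸ T)) := by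
  rw [homClass_id_eq, deflL_inclClass, homClass_id_eq, Subgroup.map_top_of_surjective _
    (QuotientGroup.mk'_surjective T)]

/-! ### Bideflation of `F`-generated and characteristic elements -/

variable (hT : F.StronglyClosed T)

/-- Because `φ` descends to a homomorphism on `LT/T`, the double quotient of the biset of `[L, φ]`
is left-free, and taking its free part changes nothing. -/
theorem IsGenerated.toBig_deflL (hS : IsPGroup p S) (hF : F.IsSaturated p)
    {X : LocBurnside p S S} (hX : IsGenerated p F X) (hT : F.StronglyClosed T) :
    toBig p (deflL p T X) = bidef p T X :=
  hX.hom_eq (f := toBig p ∘ₗ deflL p T) (g := bidef p T) fun L φ hφ => by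
    obtain ⟨ρ, hρ, h⟩ := FusionSystem.lifts_of_isSaturated hT hS hF hφ
    rw [LinearMap.comp_apply, pairClass_eq, deflL_locClass T _ (deflL_pairClass (p := p) h).1,
      toBig_locClass, bidef_locClass]

theorem IsGenerated.deflL (hS : IsPGroup p S) (hF : F.IsSaturated p)
    {X : LocBurnside p S S} (hX : IsGenerated p F X) :
    IsGenerated p (F.quotient T hT) (deflL p T X) :=
  hX.mem (f := BisetFusion.deflL p T) fun L φ hφ => by
    obtain ⟨ρ, hρ, h⟩ := FusionSystem.lifts_of_isSaturated hT hS hF hφ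
    rw [(deflL_pairClass h).2]
    exact Submodule.subset_span ⟨_, _, hρ, rfl⟩

theorem IsGenerated.toIncl_deflL (hS : IsPGroup p S) (hF : F.IsSaturated p)
    {X : LocBurnside p S S} (hX : IsGenerated p F X) (hT : F.StronglyClosed T) :
    toIncl p (S ⧸ T) (BisetFusion.deflL p T X) = BisetFusion.deflL p T (toIncl p S X) :=
  hX.hom_eq (f := toIncl p (S ⧸ T) ∘ₗ BisetFusion.deflL p T)
    (g := BisetFusion.deflL p T ∘ₗ toIncl p S) fun L φ hφ => by
    obtain ⟨ρ, hρ, h⟩ := FusionSystem.lifts_of_isSaturated hT hS hF hφ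
    rw [LinearMap.comp_apply, LinearMap.comp_apply, (deflL_pairClass h).2, toIncl_pairClass,
      toIncl_pairClass, deflL_inclClass]

/-- The double quotient by `T` treats both sides alike, so it commutes with opposites. Injectivity
of the induced `ρ` keeps the deflated bisets bifree, so no points are discarded. -/
theorem IsGenerated.deflL_op (hS : IsPGroup p S) (hF : F.IsSaturated p)
    {X : LocBurnside p S S} (hX : IsGenerated p F X) (hT : F.StronglyClosed T) :
    BisetFusion.op p (S ⧸ T) (S ⧸ T) (BisetFusion.deflL p T (BisetFusion.op p S S X)) =
      BisetFusion.deflL p T X :=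
  hX.hom_eq (f := BisetFusion.op p (S ⧸ T) (S ⧸ T) ∘ₗ BisetFusion.deflL p T ∘ₗ
    BisetFusion.op p S S) (g := BisetFusion.deflL p T) fun L φ hφ => by
    obtain ⟨ρ, hρ, h⟩ := FusionSystem.lifts_of_isSaturated hT hS hF hφ
    obtain ⟨e⟩ := Biset.deflPair T T (L := L) (φ := φ) (φ' := ρ) (fun x => ⟨x, x.2, rfl⟩)
      (by rintro _ ⟨x, hx, rfl⟩; exact ⟨⟨x, hx⟩, rfl⟩) h
    obtain ⟨f⟩ := Biset.oppDefl T T (Biset.pair L φ)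
    have hfree := opp_pair_isLeftFree ((F.quotient T hT).homS_injective hρ)
    have h1 := (hfree.of_iso e.opp).of_iso f
    have h2 := f.symm.opp.trans (Biset.oppOpp _)
    have h3 := (Biset.pair_isLeftFree _ _).of_iso e
    rw [LinearMap.comp_apply, LinearMap.comp_apply, pairClass_eq, op_locClass _
      (opp_pair_isLeftFree (F.homS_injective hφ)), deflL_locClass T _ h1, op_locClass _
      (h3.of_iso h2.symm), deflL_locClass T _ h3]
    exact locClass_congr h2 _ _

/-- A morphism of `F/T` on `P` comes from a morphism `φ` of `F` on the preimage of `P`. By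
`res_deflL`, the restrictions of the deflation along `ρ` and along the inclusion are determined by
those of `X` along `φ` and along the inclusion, which agree. -/
theorem IsRightStable.deflL {X : LocBurnside p S S} (h : IsRightStable p F X) :
    IsRightStable p (F.quotient T hT) (deflL p T X) := by
  rintro P ρ ⟨ρ', ⟨φ, hφ, hind⟩, hρ⟩
  obtain ⟨e, he⟩ := exists_quotient_comap P
  have h1 := h _ _ (FusionSystem.homS_of_hom hφ)
  rw [comp_homClass, comp_homClass] at h1
  rw [comp_homClass, comp_homClass, res_deflL he (φ := (Subgroup.subtype _).comp φ) (ρ := ρ)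
    (fun x hx => hT.apply_mem hφ x hx) ?_ (fun x y hxy => (hρ y).trans (hind x y hxy)), h1,
    res_deflL he (φ := Subgroup.subtype _) (ρ := P.subtype) (fun x hx => hx) ?_
      (fun x y hxy => hxy)]
  · intro t ht
    refine ⟨⟨t, ?_⟩, ht, rfl⟩
    rw [Subgroup.mem_comap, QuotientGroup.mk'_apply, (QuotientGroup.eq_one_iff t).2 ht]
    exact one_mem P
  · intro t ht
    obtain ⟨x, hx⟩ := hT.exists_apply_eq hφ t ht
    exact ⟨x, hT.mem_of_apply_mem hφ x (hx ▸ ht), hx⟩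

theorem IsRightCharacteristic.deflL (hS : IsPGroup p S) (hF : F.IsSaturated p)
    {X : LocBurnside p S S} (h : IsRightCharacteristic p F X) (hX : IsIdempotentMod p X) :
    IsRightCharacteristic p (F.quotient T hT) (deflL p T X) ∧
      IsIdempotentMod p (BisetFusion.deflL p T X) := by
  have hg := h.generated.deflL hT hS hF
  have hs := h.stable.deflL hT
  obtain ⟨y, hy⟩ := h.toIncl_eq_mod hS hX
  have h1 : toIncl p (S ⧸ T) (BisetFusion.deflL p T X) = homClass p (MonoidHom.id (S ⧸ T)) +
      (p : ZLoc p) • BisetFusion.deflL p T y := by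
    rw [h.generated.toIncl_deflL hS hF hT, hy, map_add, map_smul, deflL_one]
  refine ⟨⟨hg, hs, ?_⟩,
    -- From `toIncl X̄ = 1 + p ȳ` follows `X̄ ∘ X̄ = X̄ ∘ (1 + p ȳ) = X̄ + p (X̄ ∘ ȳ)`.
    BisetFusion.comp p (BisetFusion.deflL p T X) (BisetFusion.deflL p T y), ?_⟩
  · rw [AugPrimeTo, ← hg.aug_toIncl, h1, map_add, aug_one, map_smul]
    intro hd
    exact not_dvd_one_zloc ((dvd_add_left (Dvd.intro _ rfl)).1 hd)
  · rw [hs.comp_eq hg, h1, map_add, comp_homClass_id, comp_smul_right, add_sub_cancel_left]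

theorem IsLeftCharacteristic.deflL (hS : IsPGroup p S) (hF : F.IsSaturated p)
    {X : LocBurnside p S S} (h : IsLeftCharacteristic p F X) (hX : IsIdempotentMod p X) :
    IsLeftCharacteristic p (F.quotient T hT) (deflL p T X) ∧
      IsIdempotentMod p (BisetFusion.deflL p T X) := by
  obtain ⟨h1, h2⟩ := h.op.deflL hT hS hF (hX.op h.generated)
  rw [← h.generated.deflL_op hS hF hT]
  exact ⟨h1.op, h2.op h1.generated⟩

theorem IsCharacteristic.deflL (hS : IsPGroup p S) (hF : F.IsSaturated p)
    {X : LocBurnside p S S} (h : IsCharacteristic p F X) (hX : IsIdempotentMod p X) :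
    IsCharacteristic p (F.quotient T hT) (deflL p T X) ∧
      IsIdempotentMod p (BisetFusion.deflL p T X) := by
  obtain ⟨h1, h2⟩ := h.right.deflL hT hS hF hX
  obtain ⟨h3, -⟩ := h.left.deflL hT hS hF hX
  exact ⟨⟨h1.generated, h1.stable, h3.stable, h1.aug⟩, h2⟩

/-- For an exact idempotent `toIncl X = 1`, so the error term disappears: `X̄ ∘ X̄ = X̄ ∘ 1`. -/
theorem IsCharacteristicIdempotent.deflL (hS : IsPGroup p S) (hF : F.IsSaturated p)
    {X : LocBurnside p S S} (h : IsCharacteristicIdempotent p F X) :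
    IsCharacteristicIdempotent p (F.quotient T hT) (deflL p T X) := by
  have hX : IsIdempotentMod p X := ⟨0, by rw [h.idempotent, sub_self, smul_zero]⟩
  have h1 := (h.characteristic.deflL hT hS hF hX).1
  refine ⟨h1, ?_⟩
  rw [h1.right_stable.comp_eq h1.generated, h.characteristic.generated.toIncl_deflL hS hF hT,
    h.characteristic.right.toIncl_eq_one hS h.idempotent, deflL_one, comp_homClass_id]

end Deflation

end BisetFusion

end

theorem mainTheorem10 (p : ℕ) [Fact p.Prime] {S : Type*} [Group S] [Finite S] (hS : IsPGroup p S)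
    (F : BisetFusion.FusionSystem S) (hF : F.IsSaturated p)
    (T : Subgroup S) [T.Normal] (hT : F.StronglyClosed T) :
    (∀ X : BisetFusion.LocBurnside p S S, BisetFusion.IsIdempotentMod p X →
      (BisetFusion.IsRightCharacteristic p F X →
        ∃ Y : BisetFusion.LocBurnside p (S ⧸ T) (S ⧸ T),
          BisetFusion.toBig p Y = BisetFusion.bidef p T X ∧
          BisetFusion.IsRightCharacteristic p (F.quotient T hT) Y ∧
          BisetFusion.IsIdempotentMod p Y) ∧
      (BisetFusion.IsLeftCharacteristic p F X →
        ∃ Y : BisetFusion.LocBurnside p (S ⧸ T) (S ⧸ T),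
          BisetFusion.toBig p Y = BisetFusion.bidef p T X ∧
          BisetFusion.IsLeftCharacteristic p (F.quotient T hT) Y ∧
          BisetFusion.IsIdempotentMod p Y) ∧
      (BisetFusion.IsCharacteristic p F X →
        ∃ Y : BisetFusion.LocBurnside p (S ⧸ T) (S ⧸ T),
          BisetFusion.toBig p Y = BisetFusion.bidef p T X ∧
          BisetFusion.IsCharacteristic p (F.quotient T hT) Y ∧
          BisetFusion.IsIdempotentMod p Y)) ∧
    (∀ ω : BisetFusion.LocBurnside p S S, BisetFusion.IsCharacteristicIdempotent p F ω →
      ∃ Y : BisetFusion.LocBurnside p (S ⧸ T) (S ⧸ T),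
        BisetFusion.toBig p Y = BisetFusion.bidef p T ω ∧
        BisetFusion.IsCharacteristicIdempotent p (F.quotient T hT) Y ∧
        ∀ Z : BisetFusion.LocBurnside p (S ⧸ T) (S ⧸ T),
          BisetFusion.IsCharacteristicIdempotent p (F.quotient T hT) Z → Z = Y) := by
  have hSq : IsPGroup p (S ⧸ T) := hS.to_quotient T
  refine ⟨fun X hX => ⟨fun h => ?_, fun h => ?_, fun h => ?_⟩, fun ω h => ?_⟩
  · exact ⟨_, h.generated.toBig_deflL hS hF hT, h.deflL hT hS hF hX⟩
  · exact ⟨_, h.generated.toBig_deflL hS hF hT, h.deflL hT hS hF hX⟩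
  · exact ⟨_, h.generated.toBig_deflL hS hF hT, h.deflL hT hS hF hX⟩
  · exact ⟨_, h.characteristic.generated.toBig_deflL hS hF hT, h.deflL hT hS hF,
      fun Z hZ => (h.deflL hT hS hF).unique hSq hZ⟩
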